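/- Let $1\le n\le 4$, let $\Omega\subset\mathbb R^n$ be a bounded domain (non-empty, open, connected) and let $\Omega_2$ be a non-empty domain with $\overline{\Omega_2}\subset\Omega$; both $\Omega$ and $\Omega_2$ are of class $C^4$. Put $\Gamma_1:=\partial\Omega$, $\Gamma:=\partial\Omega_2$, $\Omega_1:=\Omega\setminus\overline{\Omega_2}$, and let $\nu$ be the outer unit normal with respect to $\Omega$ on $\Gamma_1$ and with respect to $\Omega_2$ on $\Gamma$. Let $\rho>0$. All functions are complex-valued, and $\langle\cdot,\cdot\rangle_{L^2(\Omega_j)}$ is linear in the first argument. Let $$X(\Omega):=\{(u_1,u_2)\in H^2(\Omega_1)\times H^2(\Omega_2):\ u_1=\partial_\nu u_1=0 \text{ on }\Gamma_1,\ u_1=u_2 \text{ and } \partial_\nu u_1=\partial_\nu u_2\text{ on }\Gamma\}$$ (boundary values in the sense of traces), with $\|(u_1,u_2)\|_{X(\Omega)}^2:=\|\Delta u_1\|_{L^2(\Omega_1)}^2+\|\Delta u_2\|_{L^2(\Omega_2)}^2$, and let $\mathcal H:=X(\Omega)\times L^2(\Omega_1)\times L^2(\Omega_2)$ with $$\|(u_1,u_2,v_1,v_2)\|_{\mathcal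 H}^2=\|(u_1,u_2)\|_{X(\Omega)}^2+\|v_1\|_{L^2(\Omega_1)}^2+\|v_2\|_{L^2(\Omega_2)}^2$$ and the corresponding inner product. Let $D(\mathcal A)$ be the set of all $(u_1,u_2,v_1,v_2)$ with $(u_1,u_2)\in X(\Omega)$, $(v_1,v_2)\in X(\Omega)$, $\Delta^2u_1\in L^2(\Omega_1)$, $\Delta^2u_2\in L^2(\Omega_2)$ (in the sense of distributions), such that the transmission conditions $\Delta u_1=\Delta u_2$ and $-\rho\,\partial_\nu v_1+\partial_\nu\Delta u_1=\partial_\nu\Delta u_2$ on $\Gamma$ hold weakly, i.e. $$\langle\Delta^2u_1-\rho\Delta v_1,\phi_1\rangle_{L^2(\Omega_1)}+\langle\Delta^2u_2,\phi_2\rangle_{L^2(\Omega_2)}=\langle\Delta u_1,\Delta\phi_1\rangle_{L^2(\Omega_1)}+\langle\Delta u_2,\Delta\phi_2\rangle_{L^2(\Omega_2)}+\rho\langle\nabla v_1,\nabla\phi_1\rangle_{L^2(\Omega_1)}$$ for all $(\phi_1,\phi_2)\in X(\Omega)$, and let $$\mathcal A(u_1,u_2,v_1,v_2):=(v_1,\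 v_2,\ -\Delta^2u_1+\rho\Delta v_1,\ -\Delta^2u_2).$$ Then $\mathcal H$ is a Hilbert space, and $\mathcal A$ is the generator of a $C_0$-semigroup of contractions on $\mathcal H$. Moreover, for every $U_0\in D(\mathcal A)$ the Cauchy problem $\partial_tU(t)-\mathcal AU(t)=0$ $(t>0)$, $U(0)=U_0$, has a unique classical solution $U\in C^1([0,\infty),\mathcal H)$ with $U(t)\in D(\mathcal A)$ for all $t\ge0$. -/

import Mathlib

open Set Filter Topology MeasureTheory TopologicalSpace
open scoped ENNReal NNReal ContDiff Laplacian

noncomputable section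

namespace PlateTransmission

/-- The Euclidean space `ℝⁿ`. -/
abbrev Eu (n : ℕ) : Type := EuclideanSpace ℝ (Fin n)

/-- The `i`-th unit vector of `ℝⁿ`. -/
abbrev unitVec {n : ℕ} (i : Fin n) : Eu n := EuclideanSpace.single i (1 : ℝ)

/-- The complex Hilbert space `L²(G)` with respect to Lebesgue measure. -/
abbrev L2 {n : ℕ} (G : Opens (Eu n)) : Type := Lp ℂ 2 (volume.restrict (G : Set (Eu n)))

/-! ### Domains of class `C^k` and outer normals -/

/-- `G` has a boundary of class `C^k`: near every boundary point `x₀`, up to relabelling and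
reorienting the coordinate axes, `G` is the region below the graph of a `C^k` function `γ` of the
remaining `n - 1` variables. The sign `s` gives the orientation of the `i`-th axis; a function of
the other variables is a function on `ℝⁿ` which is invariant in the direction of the `i`-th axis. -/
def HasCkBoundary {n : ℕ} (k : ℕ∞) (G : Set (Eu n)) : Prop :=
  ∀ x₀ ∈ frontier G, ∃ r > (0 : ℝ), ∃ (i : Fin n) (s : ℝ) (γ : Eu n → ℝ),
    (s = 1 ∨ s = -1) ∧ ContDiff ℝ k γ ∧ (∀ (x : Eu n) (t : ℝ), γ (x + t • unitVec i) = γ x) ∧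
    ∀ x ∈ Metric.ball x₀ r, x ∈ G ↔ s * x i < γ x

/-- `ν` is the outer unit normal of `G` at `x`: to first order at `x`, the set `G` is the half
space `{y | ⟪y - x, ν⟫ < 0}`. For a set with `C¹` boundary and a boundary point `x` there is exactly
one such vector. -/
def IsOuterUnitNormal {n : ℕ} (G : Set (Eu n)) (x ν : Eu n) : Prop :=
  ‖ν‖ = 1 ∧ ∀ ε > (0 : ℝ), ∀ᶠ y in 𝓝 x,
    (y ∈ G → inner ℝ (y - x) ν ≤ ε * ‖y - x‖) ∧ (y ∉ G → -(ε * ‖y - x‖) ≤ inner ℝ (y - x) ν)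

open Classical in
/-- The outer unit normal field of `G` (and `0` at points where there is none). -/
def outerNormal {n : ℕ} (G : Set (Eu n)) (x : Eu n) : Eu n :=
  if h : ∃ ν, IsOuterUnitNormal G x ν then h.choose else 0

/-- Surface measure on the boundary of `G`, i.e. `(n-1)`-dimensional Hausdorff measure. -/
def surfaceMeasure {n : ℕ} (G : Set (Eu n)) : Measure (Eu n) :=
  (Measure.hausdorffMeasure ((n : ℝ) - 1)).restrict (frontier G)

/-! ### Weak derivatives and Sobolev spaces -/

/-- `φ` is a real test function on `G`, i.e. `φ ∈ C_c^∞(G)`. -/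
def IsTest {n : ℕ} (G : Set (Eu n)) (φ : Eu n → ℝ) : Prop :=
  ContDiff ℝ ∞ φ ∧ HasCompactSupport φ ∧ tsupport φ ⊆ G

/-- `f ∈ L²(G)` is the weak derivative `∂ᵢ u` on `G`. -/
def IsWeakPartial {n : ℕ} (G : Opens (Eu n)) (i : Fin n) (u f : L2 G) : Prop :=
  ∀ φ, IsTest (G : Set (Eu n)) φ →
    ∫ x in (G : Set (Eu n)), fderiv ℝ φ x (unitVec i) • u x
      = -∫ x in (G : Set (Eu n)), φ x • f x

/-- `f ∈ L²(G)` is the distributional Laplacian of `u` on `G`. -/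
def IsWeakLaplacian {n : ℕ} (G : Opens (Eu n)) (u f : L2 G) : Prop :=
  ∀ φ, IsTest (G : Set (Eu n)) φ →
    ∫ x in (G : Set (Eu n)), (Δ φ) x • u x = ∫ x in (G : Set (Eu n)), φ x • f x

open Classical in
/-- The weak derivative `∂ᵢ u ∈ L²(G)`, if there is one (it is then unique). -/
def wPartial {n : ℕ} (G : Opens (Eu n)) (i : Fin n) (u : L2 G) : L2 G :=
  if h : ∃ f, IsWeakPartial G i u f then h.choose else 0

open Classical in
/-- The distributional Laplacian of `u` if it belongs to `L²(G)` (it is then unique). -/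
def wLaplacian {n : ℕ} (G : Opens (Eu n)) (u : L2 G) : L2 G :=
  if h : ∃ f, IsWeakLaplacian G u f then h.choose else 0

/-- `u ∈ H¹(G)`. -/
def MemH1 {n : ℕ} (G : Opens (Eu n)) (u : L2 G) : Prop :=
  ∀ i, ∃ f, IsWeakPartial G i u f

/-- `u ∈ H²(G)`. -/
def MemH2 {n : ℕ} (G : Opens (Eu n)) (u : L2 G) : Prop :=
  MemH1 G u ∧ ∀ i, MemH1 G (wPartial G i u)

/-- The Laplacian `Δ u = ∑ᵢ ∂ᵢ ∂ᵢ u` of a function `u ∈ H²(G)`. -/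
def lap {n : ℕ} (G : Opens (Eu n)) (u : L2 G) : L2 G :=
  ∑ i, wPartial G i (wPartial G i u)

/-- For `u ∈ H²(G)`: the distribution `Δ² u` belongs to `L²(G)`. -/
def BilapInL2 {n : ℕ} (G : Opens (Eu n)) (u : L2 G) : Prop :=
  ∃ f, IsWeakLaplacian G (lap G u) f

/-- The function `Δ² u ∈ L²(G)`. -/
def bilap {n : ℕ} (G : Opens (Eu n)) (u : L2 G) : L2 G :=
  wLaplacian G (lap G u)

/-- The inner product `⟨∇ u, ∇ φ⟩` of `L²(G)ⁿ`, linear in `u` and conjugate linear in `φ`. -/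
def gradInner {n : ℕ} (G : Opens (Eu n)) (u φ : L2 G) : ℂ :=
  ∑ i, inner ℂ (wPartial G i φ) (wPartial G i u)

/-! ### Traces -/

/-- `f k → g` in `L²(μ)`. -/
def ConvL2 {n : ℕ} (μ : Measure (Eu n)) (f : ℕ → Eu n → ℂ) (g : Eu n → ℂ) : Prop :=
  Tendsto (fun k => eLpNorm (f k - g) 2 μ) atTop (𝓝 0)

/-- `g ∈ L²(∂G)` is the boundary trace of `w ∈ H¹(G)`: there are functions `φ_k ∈ C_c^∞(ℝⁿ)` with
`φ_k → w` in `H¹(G)` and `φ_k → g` in `L²(∂G)`. This is the graph of the continuous extension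
to `H¹(G)` of the restriction map `φ ↦ φ|_{∂G}`. -/
def IsTrace {n : ℕ} (G : Opens (Eu n)) (w : L2 G) (g : Eu n → ℂ) : Prop :=
  MemH1 G w ∧ MemLp g 2 (surfaceMeasure (G : Set (Eu n))) ∧
  ∃ φ : ℕ → Eu n → ℂ,
    (∀ k, ContDiff ℝ ∞ (φ k) ∧ HasCompactSupport (φ k)) ∧
    ConvL2 (volume.restrict (G : Set (Eu n))) φ w ∧
    (∀ i, ConvL2 (volume.restrict (G : Set (Eu n)))
      (fun k x => fderiv ℝ (φ k) x (unitVec i)) (wPartial G i w)) ∧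
    ConvL2 (surfaceMeasure (G : Set (Eu n))) φ g

/-- For a vector field `d` on the boundary (the trace of a gradient) and a field of normals `ν`, the
function `∑ᵢ νᵢ dᵢ`. -/
def normalPart {n : ℕ} (ν : Eu n → Eu n) (d : Fin n → Eu n → ℂ) (x : Eu n) : ℂ :=
  ∑ i, ((ν x i : ℝ) : ℂ) * d i x

/-! ### Linearity -/

section linearity

variable {n : ℕ} {G : Opens (Eu n)}

lemma integrable_smul_L2 (u : L2 G) {ψ : Eu n → ℝ} (hc : Continuous ψ)
    (hs : HasCompactSupport ψ) :
    Integrable (fun x => ψ x • u x) (volume.restrict (G : Set (Eu n))) :=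
  ((Lp.memLp u).locallyIntegrable (by norm_num)).integrable_smul_left_of_hasCompactSupport hc hs

lemma IsTest.continuous {φ : Eu n → ℝ} (h : IsTest (G : Set (Eu n)) φ) : Continuous φ :=
  h.1.continuous

lemma IsTest.fderiv_continuous {φ : Eu n → ℝ} (h : IsTest (G : Set (Eu n)) φ) (v : Eu n) :
    Continuous (fun x => fderiv ℝ φ x v) :=
  (h.1.continuous_fderiv (by simp)).clm_apply continuous_const

lemma IsTest.fderiv_compact {φ : Eu n → ℝ} (h : IsTest (G : Set (Eu n)) φ) (v : Eu n) :
    HasCompactSupport (fun x => fderiv ℝ φ x v) :=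
  h.2.1.fderiv_apply (𝕜 := ℝ) v

lemma IsTest.laplacian_eq {φ : Eu n → ℝ} (h : IsTest (G : Set (Eu n)) φ) :
    (Δ φ) = fun x => ∑ i, fderiv ℝ (fun y => fderiv ℝ φ y (unitVec i)) x (unitVec i) := by
  funext x
  rw [InnerProductSpace.laplacian_eq_iteratedFDeriv_orthonormalBasis φ
    (EuclideanSpace.basisFun (Fin n) ℝ)]
  refine Finset.sum_congr rfl fun i _ => ?_
  have hd : DifferentiableAt ℝ (fderiv ℝ φ) x :=
    (h.1.fderiv_right (m := 1) (by norm_cast)).differentiable (by norm_num) x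
  rw [iteratedFDeriv_two_apply, fderiv_clm_apply hd (differentiableAt_const _)]
  simp

lemma IsTest.partial {φ : Eu n → ℝ} (h : IsTest (G : Set (Eu n)) φ) (v : Eu n) :
    IsTest (G : Set (Eu n)) (fun x => fderiv ℝ φ x v) :=
  ⟨(h.1.fderiv_right (m := ∞) (by norm_cast)).clm_apply contDiff_const, h.fderiv_compact v,
    (tsupport_fderiv_apply_subset ℝ v).trans h.2.2⟩

lemma IsTest.laplacian_continuous {φ : Eu n → ℝ} (h : IsTest (G : Set (Eu n)) φ) :
    Continuous (Δ φ) := by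
  rw [h.laplacian_eq]
  exact continuous_finsetSum _ fun i _ => (h.partial (unitVec i)).fderiv_continuous _

lemma IsTest.laplacian_compact {φ : Eu n → ℝ} (h : IsTest (G : Set (Eu n)) φ) :
    HasCompactSupport (Δ φ) := by
  rw [h.laplacian_eq]
  have hsub : tsupport (fun x => ∑ i, fderiv ℝ (fun y => fderiv ℝ φ y (unitVec i)) x (unitVec i))
      ⊆ tsupport φ := by
    refine closure_minimal (fun x hx => ?_) (isClosed_tsupport φ)
    by_contra hn
    refine hx (Finset.sum_eq_zero fun i _ => ?_)
    by_contra h0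
    exact hn (((tsupport_fderiv_apply_subset ℝ (unitVec i)).trans
      (tsupport_fderiv_apply_subset ℝ (unitVec i))) (subset_tsupport _ h0))
  exact h.2.1.of_isClosed_subset (isClosed_tsupport _) hsub

/-- The fundamental lemma of the calculus of variations in `L²(G)`. -/
lemma L2_eq_of_test (f g : L2 G)
    (h : ∀ φ, IsTest (G : Set (Eu n)) φ → ∫ x in (G : Set (Eu n)), φ x • f x
      = ∫ x in (G : Set (Eu n)), φ x • g x) : f = g := by
  have key := G.isOpen.ae_eq_zero_of_integral_contDiff_smul_eq_zero
    (μ := volume.restrict (G : Set (Eu n))) (f := fun x => f x - g x)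
    (((((Lp.memLp f).locallyIntegrable (by norm_num)).sub
      ((Lp.memLp g).locallyIntegrable (by norm_num))).locallyIntegrableOn _)) ?_
  · have hm := ae_restrict_mem (μ := volume) G.isOpen.measurableSet
    refine Lp.ext ?_
    filter_upwards [key, hm] with x hx hxG
    exact sub_eq_zero.1 (hx hxG)
  · intro φ h1 h2 h3
    have ht : IsTest (G : Set (Eu n)) φ := ⟨h1, h2, h3⟩
    simp only [smul_sub]
    rw [integral_sub (integrable_smul_L2 f ht.continuous h2)
      (integrable_smul_L2 g ht.continuous h2), h φ ht, sub_self]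

lemma integral_smul_add (u v : L2 G) {ψ : Eu n → ℝ} (hc : Continuous ψ)
    (hs : HasCompactSupport ψ) :
    ∫ x in (G : Set (Eu n)), ψ x • (u + v : L2 G) x
      = (∫ x in (G : Set (Eu n)), ψ x • u x) + ∫ x in (G : Set (Eu n)), ψ x • v x := by
  rw [← integral_add (integrable_smul_L2 u hc hs) (integrable_smul_L2 v hc hs)]
  refine integral_congr_ae ?_
  filter_upwards [Lp.coeFn_add u v] with x hx
  rw [hx, Pi.add_apply, smul_add]

lemma integral_smul_smul (c : ℂ) (u : L2 G) (ψ : Eu n → ℝ) :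
    ∫ x in (G : Set (Eu n)), ψ x • (c • u : L2 G) x
      = c * ∫ x in (G : Set (Eu n)), ψ x • u x := by
  rw [← integral_const_mul]
  refine integral_congr_ae ?_
  filter_upwards [Lp.coeFn_smul c u] with x hx
  rw [hx, Pi.smul_apply, smul_eq_mul, mul_smul_comm]

lemma IsWeakPartial.unique {i : Fin n} {u f g : L2 G} (hf : IsWeakPartial G i u f)
    (hg : IsWeakPartial G i u g) : f = g :=
  L2_eq_of_test f g fun φ hφ => neg_injective ((hf φ hφ).symm.trans (hg φ hφ))

lemma IsWeakLaplacian.unique {u f g : L2 G} (hf : IsWeakLaplacian G u f)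
    (hg : IsWeakLaplacian G u g) : f = g :=
  L2_eq_of_test f g fun φ hφ => (hf φ hφ).symm.trans (hg φ hφ)

lemma IsWeakPartial.wPartial_eq {i : Fin n} {u f : L2 G} (hf : IsWeakPartial G i u f) :
    wPartial G i u = f := by
  have h : ∃ f, IsWeakPartial G i u f := ⟨f, hf⟩
  rw [wPartial, dif_pos h]
  exact h.choose_spec.unique hf

lemma IsWeakLaplacian.wLaplacian_eq {u f : L2 G} (hf : IsWeakLaplacian G u f) :
    wLaplacian G u = f := by
  have h : ∃ f, IsWeakLaplacian G u f := ⟨f, hf⟩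
  rw [wLaplacian, dif_pos h]
  exact h.choose_spec.unique hf

lemma IsWeakPartial.add {i : Fin n} {u v f g : L2 G} (hf : IsWeakPartial G i u f)
    (hg : IsWeakPartial G i v g) : IsWeakPartial G i (u + v) (f + g) := by
  intro φ hφ
  rw [integral_smul_add u v (hφ.fderiv_continuous _) (hφ.fderiv_compact _),
    integral_smul_add f g hφ.continuous hφ.2.1, hf φ hφ, hg φ hφ, neg_add]

lemma IsWeakPartial.smul {i : Fin n} (c : ℂ) {u f : L2 G} (hf : IsWeakPartial G i u f) :
    IsWeakPartial G i (c • u) (c • f) := by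
  intro φ hφ
  rw [integral_smul_smul c u, integral_smul_smul c f, hf φ hφ, mul_neg]

lemma IsWeakLaplacian.add {u v f g : L2 G} (hf : IsWeakLaplacian G u f)
    (hg : IsWeakLaplacian G v g) : IsWeakLaplacian G (u + v) (f + g) := by
  intro φ hφ
  rw [integral_smul_add u v hφ.laplacian_continuous hφ.laplacian_compact,
    integral_smul_add f g hφ.continuous hφ.2.1, hf φ hφ, hg φ hφ]

lemma IsWeakLaplacian.smul (c : ℂ) {u f : L2 G} (hf : IsWeakLaplacian G u f) :
    IsWeakLaplacian G (c • u) (c • f) := by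
  intro φ hφ
  rw [integral_smul_smul c u, integral_smul_smul c f, hf φ hφ]

lemma MemH1.spec {u : L2 G} (hu : MemH1 G u) (i : Fin n) :
    IsWeakPartial G i u (wPartial G i u) := by
  obtain ⟨f, hf⟩ := hu i
  rwa [hf.wPartial_eq]

lemma MemH1.add {u v : L2 G} (hu : MemH1 G u) (hv : MemH1 G v) : MemH1 G (u + v) :=
  fun i => ⟨_, (hu.spec i).add (hv.spec i)⟩

lemma MemH1.smul (c : ℂ) {u : L2 G} (hu : MemH1 G u) : MemH1 G (c • u) :=
  fun i => ⟨_, (hu.spec i).smul c⟩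

lemma MemH1.wPartial_add {u v : L2 G} (hu : MemH1 G u) (hv : MemH1 G v) (i : Fin n) :
    wPartial G i (u + v) = wPartial G i u + wPartial G i v :=
  ((hu.spec i).add (hv.spec i)).wPartial_eq

lemma MemH1.wPartial_smul (c : ℂ) {u : L2 G} (hu : MemH1 G u) (i : Fin n) :
    wPartial G i (c • u) = c • wPartial G i u :=
  ((hu.spec i).smul c).wPartial_eq

lemma MemH2.add {u v : L2 G} (hu : MemH2 G u) (hv : MemH2 G v) : MemH2 G (u + v) :=
  ⟨hu.1.add hv.1, fun i => by rw [hu.1.wPartial_add hv.1]; exact (hu.2 i).add (hv.2 i)⟩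

lemma MemH2.smul (c : ℂ) {u : L2 G} (hu : MemH2 G u) : MemH2 G (c • u) :=
  ⟨hu.1.smul c, fun i => by rw [hu.1.wPartial_smul c]; exact (hu.2 i).smul c⟩

lemma MemH2.lap_add {u v : L2 G} (hu : MemH2 G u) (hv : MemH2 G v) :
    lap G (u + v) = lap G u + lap G v := by
  simp only [lap, hu.1.wPartial_add hv.1, fun i => (hu.2 i).wPartial_add (hv.2 i),
    Finset.sum_add_distrib]

lemma MemH2.lap_smul (c : ℂ) {u : L2 G} (hu : MemH2 G u) :
    lap G (c • u) = c • lap G u := by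
  simp only [lap, hu.1.wPartial_smul c, fun i => (hu.2 i).wPartial_smul c, Finset.smul_sum]

lemma isWeakPartial_zero (i : Fin n) : IsWeakPartial G i 0 0 := by
  intro φ _
  have e : ∀ ψ : Eu n → ℝ, ∫ x in (G : Set (Eu n)), ψ x • (0 : L2 G) x = 0 := by
    intro ψ
    have := integral_smul_smul (0 : ℂ) (0 : L2 G) ψ
    simpa using this
  rw [e, e, neg_zero]

lemma memH1_zero : MemH1 G 0 := fun i => ⟨0, isWeakPartial_zero i⟩

lemma wPartial_zero (i : Fin n) : wPartial G i 0 = 0 := (isWeakPartial_zero i).wPartial_eq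

lemma memH2_zero : MemH2 G 0 :=
  ⟨memH1_zero, fun i => by rw [wPartial_zero]; exact memH1_zero⟩

lemma lap_zero : lap G 0 = 0 := by simp [lap, wPartial_zero]

lemma bilap_zero_mem : BilapInL2 G 0 := by
  refine ⟨0, fun φ _ => ?_⟩
  rw [lap_zero]
  have e : ∀ ψ : Eu n → ℝ, ∫ x in (G : Set (Eu n)), ψ x • (0 : L2 G) x = 0 := by
    intro ψ
    have := integral_smul_smul (0 : ℂ) (0 : L2 G) ψ
    simpa using this
  rw [e, e]

lemma BilapInL2.spec {u : L2 G} (hu : BilapInL2 G u) :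
    IsWeakLaplacian G (lap G u) (bilap G u) := by
  obtain ⟨f, hf⟩ := hu
  rwa [bilap, hf.wLaplacian_eq]

lemma isWeakLaplacian_lap_add {u v : L2 G} (hu : MemH2 G u) (hv : MemH2 G v)
    (bu : BilapInL2 G u) (bv : BilapInL2 G v) :
    IsWeakLaplacian G (lap G (u + v)) (bilap G u + bilap G v) := by
  rw [hu.lap_add hv]
  exact bu.spec.add bv.spec

lemma isWeakLaplacian_lap_smul (c : ℂ) {u : L2 G} (hu : MemH2 G u) (bu : BilapInL2 G u) :
    IsWeakLaplacian G (lap G (c • u)) (c • bilap G u) := by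
  rw [hu.lap_smul c]
  exact bu.spec.smul c

lemma bilap_add {u v : L2 G} (hu : MemH2 G u) (hv : MemH2 G v)
    (bu : BilapInL2 G u) (bv : BilapInL2 G v) :
    bilap G (u + v) = bilap G u + bilap G v :=
  (isWeakLaplacian_lap_add hu hv bu bv).wLaplacian_eq

lemma bilap_smul (c : ℂ) {u : L2 G} (hu : MemH2 G u) (bu : BilapInL2 G u) :
    bilap G (c • u) = c • bilap G u :=
  (isWeakLaplacian_lap_smul c hu bu).wLaplacian_eq

lemma gradInner_add {u v : L2 G} (hu : MemH1 G u) (hv : MemH1 G v) (φ : L2 G) :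
    gradInner G (u + v) φ = gradInner G u φ + gradInner G v φ := by
  simp only [gradInner, hu.wPartial_add hv, inner_add_right, Finset.sum_add_distrib]

lemma gradInner_smul (c : ℂ) {u : L2 G} (hu : MemH1 G u) (φ : L2 G) :
    gradInner G (c • u) φ = c * gradInner G u φ := by
  simp only [gradInner, hu.wPartial_smul c, inner_smul_right, Finset.mul_sum]

lemma ConvL2.congr {μ : Measure (Eu n)} {f : ℕ → Eu n → ℂ} {g g' : Eu n → ℂ}
    (h : ConvL2 μ f g) (hg : g =ᵐ[μ] g') : ConvL2 μ f g' := by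
  refine Tendsto.congr (fun k => eLpNorm_congr_ae ?_) h
  filter_upwards [hg] with x hx
  simp [hx]

lemma ConvL2.add {μ : Measure (Eu n)} {f f' : ℕ → Eu n → ℂ} {g g' : Eu n → ℂ}
    (h : ConvL2 μ f g) (h' : ConvL2 μ f' g') (hf : ∀ k, AEStronglyMeasurable (f k) μ)
    (hf' : ∀ k, AEStronglyMeasurable (f' k) μ) (hg : AEStronglyMeasurable g μ)
    (hg' : AEStronglyMeasurable g' μ) : ConvL2 μ (fun k => f k + f' k) (g + g') := by
  have hs : Tendsto (fun k => eLpNorm (f k - g) 2 μ + eLpNorm (f' k - g') 2 μ) atTop (𝓝 0) := by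
    simpa using Tendsto.add h h'
  refine tendsto_of_tendsto_of_tendsto_of_le_of_le tendsto_const_nhds hs
    (fun _ => by simp) fun k => ?_
  have e : f k + f' k - (g + g') = (f k - g) + (f' k - g') := by abel
  simp only [e]
  exact eLpNorm_add_le ((hf k).sub hg) ((hf' k).sub hg') (by norm_num)

lemma ConvL2.smul (c : ℂ) {μ : Measure (Eu n)} {f : ℕ → Eu n → ℂ} {g : Eu n → ℂ}
    (h : ConvL2 μ f g) : ConvL2 μ (fun k => c • f k) (c • g) := by
  have hs : Tendsto (fun k => ‖c‖ₑ * eLpNorm (f k - g) 2 μ) atTop (𝓝 0) := by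
    simpa using ENNReal.Tendsto.const_mul h (Or.inr (by simp))
  refine Tendsto.congr (fun k => ?_) hs
  rw [← smul_sub, eLpNorm_const_smul]

lemma isTrace_zero : IsTrace G 0 0 := by
  refine ⟨memH1_zero, MemLp.zero, fun _ => 0, fun _ => ⟨contDiff_const, HasCompactSupport.zero⟩,
    ?_, fun i => ?_, by simp [ConvL2]⟩
  · refine ConvL2.congr (g := 0) (by simp [ConvL2]) ?_
    filter_upwards [Lp.coeFn_zero ℂ 2 (volume.restrict (G : Set (Eu n)))] with x hx
    exact hx.symm
  · rw [wPartial_zero]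
    refine ConvL2.congr (g := 0) ?_ ?_
    · simp [ConvL2]
    · filter_upwards [Lp.coeFn_zero ℂ 2 (volume.restrict (G : Set (Eu n)))] with x hx
      exact hx.symm

lemma smooth_partial_continuous {φ : Eu n → ℂ} (h : ContDiff ℝ ∞ φ) (v : Eu n) :
    Continuous (fun x => fderiv ℝ φ x v) :=
  (h.continuous_fderiv (by simp)).clm_apply continuous_const

lemma IsTrace.add {w w' : L2 G} {g g' : Eu n → ℂ} (h : IsTrace G w g) (h' : IsTrace G w' g') :
    IsTrace G (w + w') (g + g') := by
  obtain ⟨hw, hg, φ, hφ, h1, h2, h3⟩ := h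
  obtain ⟨hw', hg', ψ, hψ, h1', h2', h3'⟩ := h'
  refine ⟨hw.add hw', hg.add hg', fun k => φ k + ψ k,
    fun k => ⟨(hφ k).1.add (hψ k).1, (hφ k).2.add (hψ k).2⟩, ?_, fun i => ?_, ?_⟩
  · exact (h1.add h1' (fun k => (hφ k).1.continuous.aestronglyMeasurable)
      (fun k => (hψ k).1.continuous.aestronglyMeasurable) (Lp.aestronglyMeasurable _)
      (Lp.aestronglyMeasurable _)).congr (Lp.coeFn_add w w').symm
  · rw [hw.wPartial_add hw']
    have := ((h2 i).add (h2' i)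
      (fun k => (smooth_partial_continuous (hφ k).1 _).aestronglyMeasurable)
      (fun k => (smooth_partial_continuous (hψ k).1 _).aestronglyMeasurable)
      (Lp.aestronglyMeasurable _) (Lp.aestronglyMeasurable _)).congr
      (Lp.coeFn_add (wPartial G i w) (wPartial G i w')).symm
    convert this using 3 with k x
    change fderiv ℝ (φ k + ψ k) x (unitVec i) = _
    rw [fderiv_add ((hφ k).1.differentiable (by simp) x) ((hψ k).1.differentiable (by simp) x)]
    rfl
  · exact h3.add h3' (fun k => (hφ k).1.continuous.aestronglyMeasurable)
      (fun k => (hψ k).1.continuous.aestronglyMeasurable) hg.1 hg'.1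

lemma IsTrace.smul (c : ℂ) {w : L2 G} {g : Eu n → ℂ} (h : IsTrace G w g) :
    IsTrace G (c • w) (c • g) := by
  obtain ⟨hw, hg, φ, hφ, h1, h2, h3⟩ := h
  refine ⟨hw.smul c, hg.const_smul c, fun k => c • φ k,
    fun k => ⟨(hφ k).1.const_smul c, (hφ k).2.smul_left (f := fun _ => c)⟩, ?_, fun i => ?_,
    h3.smul c⟩
  · exact (h1.smul c).congr (Lp.coeFn_smul c w).symm
  · rw [hw.wPartial_smul c]
    have := ((h2 i).smul c).congr (Lp.coeFn_smul c (wPartial G i w)).symm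
    convert this using 3 with k x
    change fderiv ℝ (c • φ k) x (unitVec i) = _
    rw [fderiv_const_smul ((hφ k).1.differentiable (by simp) x)]
    rfl

lemma normalPart_add (ν : Eu n → Eu n) (d d' : Fin n → Eu n → ℂ) :
    normalPart ν (fun i => d i + d' i) = normalPart ν d + normalPart ν d' := by
  funext x
  simp [normalPart, mul_add, Finset.sum_add_distrib]

lemma normalPart_smul (c : ℂ) (ν : Eu n → Eu n) (d : Fin n → Eu n → ℂ) :
    normalPart ν (fun i => c • d i) = c • normalPart ν d := by
  funext x
  simp [normalPart, Finset.mul_sum, mul_left_comm]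

end linearity

/-! ### The transmission problem -/

/-- The damped region `Ω₁ = Ω \ closure Ω₂`. -/
def outerPart {n : ℕ} (Ω Ω₂ : Opens (Eu n)) : Opens (Eu n) :=
  ⟨(Ω : Set (Eu n)) \ closure (Ω₂ : Set (Eu n)), Ω.isOpen.sdiff isClosed_closure⟩

/-- `(u₁, u₂) ∈ X(Ω)`: `u₁ ∈ H²(Ω₁)` and `u₂ ∈ H²(Ω₂)`, in the sense of traces
`u₁ = ∂_ν u₁ = 0` on `Γ₁ = ∂Ω`, and `u₁ = u₂`, `∂_ν u₁ = ∂_ν u₂` on `Γ = ∂Ω₂`, where `ν` is the outer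
unit normal with respect to `Ω` on `Γ₁` and with respect to `Ω₂` on `Γ`. Here `g₁`, `g₂` are
the traces of `u₁`, `u₂`, and `d₁`, `d₂` are the traces of `∇ u₁`, `∇ u₂`. -/
def MemX {n : ℕ} (Ω Ω₂ : Opens (Eu n)) (u₁ : L2 (outerPart Ω Ω₂)) (u₂ : L2 Ω₂) : Prop :=
  MemH2 (outerPart Ω Ω₂) u₁ ∧ MemH2 Ω₂ u₂ ∧
  ∃ (g₁ g₂ : Eu n → ℂ) (d₁ d₂ : Fin n → Eu n → ℂ),
    IsTrace (outerPart Ω Ω₂) u₁ g₁ ∧ IsTrace Ω₂ u₂ g₂ ∧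
    (∀ i, IsTrace (outerPart Ω Ω₂) (wPartial (outerPart Ω Ω₂) i u₁) (d₁ i)) ∧
    (∀ i, IsTrace Ω₂ (wPartial Ω₂ i u₂) (d₂ i)) ∧
    g₁ =ᵐ[surfaceMeasure (Ω : Set (Eu n))] 0 ∧
    normalPart (outerNormal (Ω : Set (Eu n))) d₁ =ᵐ[surfaceMeasure (Ω : Set (Eu n))] 0 ∧
    g₁ =ᵐ[surfaceMeasure (Ω₂ : Set (Eu n))] g₂ ∧
    normalPart (outerNormal (Ω₂ : Set (Eu n))) d₁
      =ᵐ[surfaceMeasure (Ω₂ : Set (Eu n))] normalPart (outerNormal (Ω₂ : Set (Eu n))) d₂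

/-- The space `X(Ω)`. -/
def XSpace {n : ℕ} (Ω Ω₂ : Opens (Eu n)) : Submodule ℂ (L2 (outerPart Ω Ω₂) × L2 Ω₂) where
  carrier := {u | MemX Ω Ω₂ u.1 u.2}
  zero_mem' := by
    refine ⟨memH2_zero, memH2_zero, 0, 0, fun _ => 0, fun _ => 0, isTrace_zero, isTrace_zero,
      fun i => ?_, fun i => ?_, ?_, ?_, ?_, ?_⟩
    · rw [Prod.fst_zero, wPartial_zero]; exact isTrace_zero
    · rw [Prod.snd_zero, wPartial_zero]; exact isTrace_zero
    · rfl
    · refine Eventually.of_forall fun x => ?_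
      simp [normalPart]
    · rfl
    · rfl
  add_mem' := by
    rintro u v ⟨hu₁, hu₂, g₁, g₂, d₁, d₂, t₁, t₂, s₁, s₂, a, b, c, d⟩
      ⟨hv₁, hv₂, g₁', g₂', d₁', d₂', t₁', t₂', s₁', s₂', a', b', c', d'⟩
    refine ⟨hu₁.add hv₁, hu₂.add hv₂, g₁ + g₁', g₂ + g₂', fun i => d₁ i + d₁' i,
      fun i => d₂ i + d₂' i, t₁.add t₁', t₂.add t₂', fun i => ?_, fun i => ?_, ?_, ?_, ?_, ?_⟩
    · rw [Prod.fst_add, hu₁.1.wPartial_add hv₁.1]; exact (s₁ i).add (s₁' i)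
    · rw [Prod.snd_add, hu₂.1.wPartial_add hv₂.1]; exact (s₂ i).add (s₂' i)
    · simpa using a.add a'
    · rw [normalPart_add]; simpa using b.add b'
    · exact c.add c'
    · rw [normalPart_add, normalPart_add]; exact d.add d'
  smul_mem' := by
    rintro z u ⟨hu₁, hu₂, g₁, g₂, d₁, d₂, t₁, t₂, s₁, s₂, a, b, c, d⟩
    refine ⟨hu₁.smul z, hu₂.smul z, z • g₁, z • g₂, fun i => z • d₁ i,
      fun i => z • d₂ i, t₁.smul z, t₂.smul z, fun i => ?_, fun i => ?_, ?_, ?_, ?_, ?_⟩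
    · rw [Prod.smul_fst, hu₁.1.wPartial_smul z]; exact (s₁ i).smul z
    · rw [Prod.smul_snd, hu₂.1.wPartial_smul z]; exact (s₂ i).smul z
    · simpa using a.const_smul z
    · rw [normalPart_smul]; simpa using b.const_smul z
    · exact c.const_smul z
    · rw [normalPart_smul, normalPart_smul]; exact d.const_smul z

/-- The state space `ℋ = X(Ω) × L²(Ω₁) × L²(Ω₂)` of all `U = ((u₁, u₂), v₁, v₂)`. -/
def HSpace {n : ℕ} (Ω Ω₂ : Opens (Eu n)) : Type :=
  XSpace Ω Ω₂ × L2 (outerPart Ω Ω₂) × L2 Ω₂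

namespace HSpace

variable {n : ℕ} {Ω Ω₂ : Opens (Eu n)}

instance : AddCommGroup (HSpace Ω Ω₂) :=
  inferInstanceAs (AddCommGroup (XSpace Ω Ω₂ × L2 (outerPart Ω Ω₂) × L2 Ω₂))

instance : Module ℂ (HSpace Ω Ω₂) :=
  inferInstanceAs (Module ℂ (XSpace Ω Ω₂ × L2 (outerPart Ω Ω₂) × L2 Ω₂))

/-- The component `u₁` of `U`. -/
def u₁ (U : HSpace Ω Ω₂) : L2 (outerPart Ω Ω₂) := U.1.1.1

/-- The component `u₂` of `U`. -/
def u₂ (U : HSpace Ω Ω₂) : L2 Ω₂ := U.1.1.2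

/-- The component `v₁` of `U`. -/
def v₁ (U : HSpace Ω Ω₂) : L2 (outerPart Ω Ω₂) := U.2.1

/-- The component `v₂` of `U`. -/
def v₂ (U : HSpace Ω Ω₂) : L2 Ω₂ := U.2.2

lemma memX (U : HSpace Ω Ω₂) : MemX Ω Ω₂ U.u₁ U.u₂ := U.1.2

lemma u₁_add (U V : HSpace Ω Ω₂) : (U + V).u₁ = U.u₁ + V.u₁ := rfl

lemma u₂_add (U V : HSpace Ω Ω₂) : (U + V).u₂ = U.u₂ + V.u₂ := rfl

lemma v₁_add (U V : HSpace Ω Ω₂) : (U + V).v₁ = U.v₁ + V.v₁ := rfl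

lemma v₂_add (U V : HSpace Ω Ω₂) : (U + V).v₂ = U.v₂ + V.v₂ := rfl

lemma u₁_smul (c : ℂ) (U : HSpace Ω Ω₂) : (c • U).u₁ = c • U.u₁ := rfl

lemma u₂_smul (c : ℂ) (U : HSpace Ω Ω₂) : (c • U).u₂ = c • U.u₂ := rfl

lemma v₁_smul (c : ℂ) (U : HSpace Ω Ω₂) : (c • U).v₁ = c • U.v₁ := rfl

lemma v₂_smul (c : ℂ) (U : HSpace Ω Ω₂) : (c • U).v₂ = c • U.v₂ := rfl

/-- The inner product of `ℋ`:
`⟨Δu₁, Δũ₁⟩ + ⟨Δu₂, Δũ₂⟩ + ⟨v₁, ṽ₁⟩ + ⟨v₂, ṽ₂⟩`, with the inner products of `L²(Ω₁)`, `L²(Ω₂)`.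
Accordingly `‖U‖² = ‖Δu₁‖² + ‖Δu₂‖² + ‖v₁‖² + ‖v₂‖²`. Definiteness is not part of this
structure. -/
abbrev innerCore (Ω Ω₂ : Opens (Eu n)) : PreInnerProductSpace.Core ℂ (HSpace Ω Ω₂) where
  inner U V := inner ℂ (lap _ U.u₁) (lap _ V.u₁) + inner ℂ (lap _ U.u₂) (lap _ V.u₂)
    + inner ℂ U.v₁ V.v₁ + inner ℂ U.v₂ V.v₂
  conj_inner_symm U V := by simp only [map_add, inner_conj_symm]
  re_inner_nonneg U := by
    simp only [map_add]
    have h1 := inner_self_nonneg (𝕜 := ℂ) (x := lap _ U.u₁)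
    have h2 := inner_self_nonneg (𝕜 := ℂ) (x := lap _ U.u₂)
    have h3 := inner_self_nonneg (𝕜 := ℂ) (x := U.v₁)
    have h4 := inner_self_nonneg (𝕜 := ℂ) (x := U.v₂)
    linarith
  add_left U V W := by
    rw [u₁_add, u₂_add, v₁_add, v₂_add, U.memX.1.lap_add V.memX.1, U.memX.2.1.lap_add V.memX.2.1]
    simp only [inner_add_left]
    ring
  smul_left U V c := by
    rw [u₁_smul, u₂_smul, v₁_smul, v₂_smul, U.memX.1.lap_smul c, U.memX.2.1.lap_smul c]
    simp only [inner_smul_left]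
    ring

instance : SeminormedAddCommGroup (HSpace Ω Ω₂) :=
  @InnerProductSpace.Core.toSeminormedAddCommGroup ℂ (HSpace Ω Ω₂) _ _ _ (innerCore Ω Ω₂)

instance : InnerProductSpace ℂ (HSpace Ω Ω₂) := InnerProductSpace.ofCore (innerCore Ω Ω₂)

lemma norm_sq (U : HSpace Ω Ω₂) :
    ‖U‖ ^ 2 = ‖lap _ U.u₁‖ ^ 2 + ‖lap _ U.u₂‖ ^ 2 + ‖U.v₁‖ ^ 2 + ‖U.v₂‖ ^ 2 := by
  have h : inner ℂ U U = inner ℂ (lap _ U.u₁) (lap _ U.u₁) + inner ℂ (lap _ U.u₂) (lap _ U.u₂)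
    + inner ℂ U.v₁ U.v₁ + inner ℂ U.v₂ U.v₂ := rfl
  rw [← inner_self_eq_norm_sq (𝕜 := ℂ) U, h]
  simp only [map_add, inner_self_eq_norm_sq]

end HSpace

/-- The conditions `Δu₁ = Δu₂` and `-ρ ∂_ν v₁ + ∂_ν Δu₁ = ∂_ν Δu₂` on `Γ` are weakly satisfied. -/
def WeakTransmission {n : ℕ} (Ω Ω₂ : Opens (Eu n)) (ρ : ℝ) (u₁ : L2 (outerPart Ω Ω₂)) (u₂ : L2 Ω₂)
    (v₁ : L2 (outerPart Ω Ω₂)) : Prop :=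
  ∀ (φ₁ : L2 (outerPart Ω Ω₂)) (φ₂ : L2 Ω₂), MemX Ω Ω₂ φ₁ φ₂ →
    inner ℂ φ₁ (bilap _ u₁ - (ρ : ℂ) • lap _ v₁) + inner ℂ φ₂ (bilap _ u₂)
      = inner ℂ (lap _ φ₁) (lap _ u₁) + inner ℂ (lap _ φ₂) (lap _ u₂)
        + (ρ : ℂ) * gradInner _ v₁ φ₁

/-- The domain `D(𝒜)`. -/
def domainA {n : ℕ} (Ω Ω₂ : Opens (Eu n)) (ρ : ℝ) : Submodule ℂ (HSpace Ω Ω₂) where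
  carrier := {U | MemX Ω Ω₂ U.v₁ U.v₂ ∧ BilapInL2 _ U.u₁ ∧ BilapInL2 _ U.u₂ ∧
    WeakTransmission Ω Ω₂ ρ U.u₁ U.u₂ U.v₁}
  zero_mem' := by
    have h0 : MemX Ω Ω₂ (0 : L2 (outerPart Ω Ω₂)) (0 : L2 Ω₂) := (XSpace Ω Ω₂).zero_mem
    refine ⟨h0, bilap_zero_mem, bilap_zero_mem, fun φ₁ φ₂ _ => ?_⟩
    have b : ∀ G : Opens (Eu n), bilap G (0 : L2 G) = 0 := fun G => by
      have h := isWeakLaplacian_lap_smul (0 : ℂ) (memH2_zero (G := G)) bilap_zero_mem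
      rw [zero_smul, zero_smul] at h
      exact h.wLaplacian_eq
    change inner ℂ φ₁ (bilap _ (0 : L2 (outerPart Ω Ω₂)) - (ρ : ℂ) • lap _ (0 : L2 (outerPart Ω Ω₂)))
      + inner ℂ φ₂ (bilap _ (0 : L2 Ω₂)) = inner ℂ (lap _ φ₁) (lap _ (0 : L2 (outerPart Ω Ω₂)))
        + inner ℂ (lap _ φ₂) (lap _ (0 : L2 Ω₂))
        + (ρ : ℂ) * gradInner _ (0 : L2 (outerPart Ω Ω₂)) φ₁
    simp [b, lap_zero, gradInner, wPartial_zero]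
  add_mem' := by
    rintro U V ⟨a, b, c, d⟩ ⟨a', b', c', d'⟩
    have e₁ := isWeakLaplacian_lap_add U.memX.1 V.memX.1 b b'
    have e₂ := isWeakLaplacian_lap_add U.memX.2.1 V.memX.2.1 c c'
    refine ⟨(XSpace Ω Ω₂).add_mem (x := (U.v₁, U.v₂)) (y := (V.v₁, V.v₂)) a a', ⟨_, e₁⟩, ⟨_, e₂⟩,
      fun φ₁ φ₂ hφ => ?_⟩
    have h := d φ₁ φ₂ hφ
    have h' := d' φ₁ φ₂ hφ
    rw [HSpace.u₁_add, HSpace.u₂_add, HSpace.v₁_add, bilap_add U.memX.1 V.memX.1 b b',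
      bilap_add U.memX.2.1 V.memX.2.1 c c', a.1.lap_add a'.1, U.memX.1.lap_add V.memX.1,
      U.memX.2.1.lap_add V.memX.2.1, gradInner_add a.1.1 a'.1.1]
    simp only [inner_add_right, inner_sub_right, smul_add] at h h' ⊢
    linear_combination h + h'
  smul_mem' := by
    rintro z U ⟨a, b, c, d⟩
    have e₁ := isWeakLaplacian_lap_smul z U.memX.1 b
    have e₂ := isWeakLaplacian_lap_smul z U.memX.2.1 c
    refine ⟨(XSpace Ω Ω₂).smul_mem z (x := (U.v₁, U.v₂)) a, ⟨_, e₁⟩, ⟨_, e₂⟩, fun φ₁ φ₂ hφ => ?_⟩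
    have h := d φ₁ φ₂ hφ
    rw [HSpace.u₁_smul, HSpace.u₂_smul, HSpace.v₁_smul, bilap_smul z U.memX.1 b,
      bilap_smul z U.memX.2.1 c, a.1.lap_smul z, U.memX.1.lap_smul z,
      U.memX.2.1.lap_smul z, gradInner_smul z a.1.1]
    simp only [inner_sub_right, inner_smul_right] at h ⊢
    linear_combination z * h

/-- The operator `𝒜 : ℋ ⊇ D(𝒜) → ℋ`,
`𝒜 (u₁, u₂, v₁, v₂) = (v₁, v₂, -Δ² u₁ + ρ Δ v₁, -Δ² u₂)`. -/
def opA {n : ℕ} (Ω Ω₂ : Opens (Eu n)) (ρ : ℝ) : HSpace Ω Ω₂ →ₗ.[ℂ] HSpace Ω Ω₂ where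
  domain := domainA Ω Ω₂ ρ
  toFun :=
    { toFun := fun U => (⟨(U.1.v₁, U.1.v₂), U.2.1⟩,
        -bilap _ U.1.u₁ + (ρ : ℂ) • lap _ U.1.v₁, -bilap _ U.1.u₂)
      map_add' := by
        rintro ⟨U, a, b, c, d⟩ ⟨V, a', b', c', d'⟩
        refine Prod.ext rfl (Prod.ext ?_ ?_)
        · change -bilap _ (U.u₁ + V.u₁) + (ρ : ℂ) • lap _ (U.v₁ + V.v₁)
            = (-bilap _ U.u₁ + (ρ : ℂ) • lap _ U.v₁) + (-bilap _ V.u₁ + (ρ : ℂ) • lap _ V.v₁)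
          rw [bilap_add U.memX.1 V.memX.1 b b', a.1.lap_add a'.1, smul_add]
          abel
        · change -bilap _ (U.u₂ + V.u₂) = -bilap _ U.u₂ + -bilap _ V.u₂
          rw [bilap_add U.memX.2.1 V.memX.2.1 c c']
          abel
      map_smul' := by
        rintro z ⟨U, a, b, c, d⟩
        refine Prod.ext rfl (Prod.ext ?_ ?_)
        · change -bilap _ (z • U.u₁) + (ρ : ℂ) • lap _ (z • U.v₁)
            = z • (-bilap _ U.u₁ + (ρ : ℂ) • lap _ U.v₁)
          rw [bilap_smul z U.memX.1 b, a.1.lap_smul z, smul_add, smul_neg, smul_comm z (ρ : ℂ)]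
        · change -bilap _ (z • U.u₂) = z • -bilap _ U.u₂
          rw [bilap_smul z U.memX.2.1 c, smul_neg] }

/-! ### Semigroups and the Cauchy problem -/

/-- `T` is a `C₀`-semigroup. -/
structure IsC0Semigroup {H : Type*} [SeminormedAddCommGroup H] [NormedSpace ℂ H]
    (T : ℝ≥0 → H →L[ℂ] H) : Prop where
  map_zero : T 0 = ContinuousLinearMap.id ℂ H
  map_add : ∀ s t, T (s + t) = (T s).comp (T t)
  tendsto_zero : ∀ x, Tendsto (fun t => T t x) (𝓝 0) (𝓝 x)

/-- `A` is the generator of `T`: `x ∈ D(A)` and `A x = y` if and only if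
`(T t x - x) / t → y` as `t → 0`, `t > 0`. -/
def IsGenerator {H : Type*} [SeminormedAddCommGroup H] [NormedSpace ℂ H]
    (T : ℝ≥0 → H →L[ℂ] H) (A : H →ₗ.[ℂ] H) : Prop :=
  ∀ x y, (x, y) ∈ A.graph ↔
    Tendsto (fun t : ℝ≥0 => (((t : ℝ)⁻¹ : ℝ) : ℂ) • (T t x - x)) (𝓝[>] 0) (𝓝 y)

/-- `U : [0, ∞) → H` (with values at negative times disregarded) belongs to `C¹([0, ∞), H)`,
satisfies `U t ∈ D(A)` for all `t ≥ 0`, `U' t = A (U t)` for `t > 0`, and `U 0 = U₀`. -/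
def IsClassicalSolution {H : Type*} [SeminormedAddCommGroup H] [NormedSpace ℂ H]
    (A : H →ₗ.[ℂ] H) (U₀ : H) (U : ℝ → H) : Prop :=
  (∃ U' : ℝ → H, ContinuousOn U' (Ici 0) ∧
    (∀ t, 0 ≤ t → HasDerivWithinAt U (U' t) (Ici 0) t) ∧
    (∀ t, 0 < t → (U t, U' t) ∈ A.graph)) ∧
  (∀ t, 0 ≤ t → U t ∈ A.domain) ∧ U 0 = U₀

end PlateTransmission

end

/-! The generation statement is the Lumer–Phillips theorem in a Hilbert space: it suffices that `ℋ`
is complete, that `𝒜` is dissipative and that `l - 𝒜` is onto for every `l > 0`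
(`IsMaxDissipative`). Density of the domain is then automatic, and the semigroup is the strong limit
of the exponentials of the Yosida approximations (`IsMaxDissipative.exists_semigroup`). Uniqueness
of classical solutions follows from dissipativity, since the norm of the difference of two solutions
decreases.

Dissipativity is the weak transmission identity tested with `(v₁, v₂)` itself: the terms in `Δu` and
`Δv` form a skew-Hermitian expression, and what remains is `-ρ ‖∇v₁‖²` (`re_inner_opA_le`).

The analytic core is a description of `X(Ω)` that does not mention traces. Extend `(u₁, u₂)` to one
function `U` on `ℝⁿ`, zero outside `Ω`. Its distributional Laplacian is a function in `L²(ℝⁿ)`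
exactly when the pair lies in `X(Ω)`, because the boundary and transmission conditions say that no
layers are created on `∂Ω` and `∂Ω₂`. One direction is Green's formula on both sides of each
boundary (`MemX.isGluedLaplacian`); it rests on a divergence theorem below graphs, localized by
smooth cut-offs. For the other direction (`IsGluedLaplacian.memX`), mollify `U`. Test functions
supported in a fixed ball have their full `H²` norm controlled by the `L²` norm of their Laplacian,
so the mollifications are Cauchy in `H²(ℝⁿ)`. Restricting the same sequence to both sides of `∂Ω₂`
gives equal traces there. On `∂Ω` the traces vanish, because the sequence tends to zero in `H²`
outside `Ω` and the trace inequality is proved from the outside. No elliptic regularity up to the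
boundary is needed.

This description yields the rest. The estimate for test functions passes to the limit and bounds `u`
by `Δu` on `X(Ω)`, so the seminorm of `ℋ` is a norm. The condition is closed in `L²`, so `ℋ` is
complete, and so is the range of `v ↦ (Δv, a v, b ∇v₁)`. Eliminating `u` from the resolvent equation
leaves a coercive Hermitian variational problem for `v`, which is solved by orthogonal projection
onto that range. Test functions on either side, extended by zero, belong to `X(Ω)`; inserting them
recovers the equations for `Δ²u₁` and `Δ²u₂`, and the remaining content of the variational problem
is the weak transmission identity (`IsPlateGeometry.surj`). -/

noncomputable section

namespace PlateTransmission

/-! ### Generation of contraction semigroups on Hilbert spaces -/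

section semigroup

variable {H : Type*} [NormedAddCommGroup H] [InnerProductSpace ℂ H]

/-- `A` is dissipative and `l - A` is onto for all `l > 0`. -/
structure IsMaxDissipative (A : H →ₗ.[ℂ] H) : Prop where
  re_inner_le : ∀ x : A.domain, (inner ℂ (x : H) (A x)).re ≤ 0
  surj : ∀ l : ℝ, 0 < l → ∀ y, ∃ x : A.domain, (l : ℂ) • (x : H) - A x = y

variable {A : H →ₗ.[ℂ] H}

/-- Dissipativity gives `Re ⟨x, l x - A x⟩ ≥ l ‖x‖²`, and Cauchy–Schwarz bounds the left side. For
`l > 0` this is injectivity of `l - A` together with the resolvent bound `1 / l`. -/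
lemma IsMaxDissipative.mul_norm_le (hA : IsMaxDissipative A) (l : ℝ) (x : A.domain) :
    l * ‖(x : H)‖ ≤ ‖(l : ℂ) • (x : H) - A x‖ := by
  rcases eq_or_ne (‖(x : H)‖) 0 with h | h
  · simp [h]
  have hp : 0 < ‖(x : H)‖ := lt_of_le_of_ne (norm_nonneg _) (Ne.symm h)
  have h1 := re_inner_le_norm (𝕜 := ℂ) (x : H) ((l : ℂ) • (x : H) - A x)
  have h2 : RCLike.re (inner ℂ (x : H) ((l : ℂ) • (x : H) - A x))
      = l * ‖(x : H)‖ ^ 2 - (inner ℂ (x : H) (A x)).re := by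
    rw [inner_sub_right, inner_smul_right, inner_self_eq_norm_sq_to_K]
    simp [← Complex.ofReal_pow]
  have h3 := hA.re_inner_le x
  rw [h2] at h1
  nlinarith

lemma IsMaxDissipative.eq_of_sub_eq (hA : IsMaxDissipative A) {l : ℝ} (hl : 0 < l)
    {x x' : A.domain} (h : (l : ℂ) • (x : H) - A x = (l : ℂ) • (x' : H) - A x') : x = x' := by
  have h1 := hA.mul_norm_le l (x - x')
  have h2 : (l : ℂ) • ((x - x' : A.domain) : H) - A (x - x') = 0 := by
    rw [A.map_sub, Submodule.coe_sub, smul_sub, ← sub_eq_zero.2 h]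
    abel
  rw [h2, norm_zero] at h1
  have h3 : ‖((x - x' : A.domain) : H)‖ = 0 :=
    le_antisymm (nonpos_of_mul_nonpos_right h1 hl) (norm_nonneg _)
  rw [norm_eq_zero, Submodule.coe_sub, sub_eq_zero] at h3
  exact Subtype.ext h3

/-- The last two clauses say that `R` is a two-sided inverse of `l - A`. The variable `x` with `x =
R y` keeps the proof of membership in the domain out of the statement. -/
lemma IsMaxDissipative.exists_resolvent (hA : IsMaxDissipative A) {l : ℝ} (hl : 0 < l) :
    ∃ R : H →L[ℂ] H, (∀ y, ‖R y‖ ≤ l⁻¹ * ‖y‖) ∧ (∀ y, R y ∈ A.domain) ∧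
      (∀ (y : H) (x : A.domain), (x : H) = R y → (l : ℂ) • (x : H) - A x = y) ∧
      ∀ x : A.domain, R ((l : ℂ) • (x : H) - A x) = x := by
  choose r hr using hA.surj l hl
  have hb : ∀ y, ‖(r y : H)‖ ≤ l⁻¹ * ‖y‖ := fun y => by
    have h := hA.mul_norm_le l (r y)
    rw [hr] at h
    rw [inv_mul_eq_div, le_div_iff₀ hl, mul_comm]
    exact h
  refine ⟨LinearMap.mkContinuous
    { toFun := fun y => (r y : H)
      map_add' := fun y z => ?_
      map_smul' := fun c y => ?_ } l⁻¹ hb, hb, fun y => (r y).2, ?_, ?_⟩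
  · rw [← Submodule.coe_add]
    congr 1
    refine hA.eq_of_sub_eq hl ?_
    rw [hr, A.map_add, Submodule.coe_add, smul_add, add_sub_add_comm, hr, hr]
  · rw [RingHom.id_apply, ← Submodule.coe_smul]
    congr 1
    refine hA.eq_of_sub_eq hl ?_
    rw [hr, A.map_smul, Submodule.coe_smul, smul_comm, ← smul_sub, hr]
  · intro y x hx
    have : x = r y := Subtype.ext hx
    rw [this, hr]
  · intro x
    exact congrArg Subtype.val (hA.eq_of_sub_eq hl (hr _))

variable [CompleteSpace H]

/-- If `z` is orthogonal to the domain, write `z = x - A x` with `x` in the domain. Then `0 = ⟨x,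
z⟩` gives `‖x‖² = Re ⟨x, A x⟩ ≤ 0`, so `x` and `z` vanish. -/
lemma IsMaxDissipative.dense (hA : IsMaxDissipative A) : Dense (A.domain : Set H) := by
  rw [Submodule.dense_iff_topologicalClosure_eq_top, Submodule.topologicalClosure_eq_top_iff,
    Submodule.eq_bot_iff]
  intro z hz
  obtain ⟨x, hx⟩ := hA.surj 1 one_pos z
  have h1 : inner ℂ (x : H) z = 0 := (Submodule.mem_orthogonal _ _).1 hz x x.2
  have h2 := hA.re_inner_le x
  rw [← hx, inner_sub_right, inner_smul_right, sub_eq_zero] at h1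
  rw [← h1, inner_self_eq_norm_sq_to_K] at h2
  have h3 : ‖(x : H)‖ ^ 2 ≤ 0 := by simpa [← Complex.ofReal_pow] using h2
  have h4 : (x : H) = 0 := by
    rw [← norm_eq_zero]
    exact pow_eq_zero_iff (two_ne_zero) |>.1 (le_antisymm h3 (sq_nonneg _))
  have h5 : x = 0 := Subtype.ext h4
  rw [← hx, h5, A.map_zero]
  simp

/-- The exponentials of the Yosida approximations. -/
lemma IsMaxDissipative.exists_approx (hA : IsMaxDissipative A) :
    ∃ B : ℕ → H →L[ℂ] H, (∀ k y, (inner ℂ y (B k y)).re ≤ 0) ∧ (∀ j k, Commute (B j) (B k)) ∧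
      ∀ x : A.domain, Tendsto (fun k => B k x) atTop (𝓝 (A x)) := by
  -- The Yosida parameter is `k + 1`, so that it is positive at `k = 0` as well.
  have hpos : ∀ k : ℕ, (0 : ℝ) < (k : ℝ) + 1 := fun k => by positivity
  choose R hRn hRm hR1 hR2 using fun k : ℕ => hA.exists_resolvent (hpos k)
  set l : ℕ → ℂ := fun k => (((k : ℝ) + 1 : ℝ) : ℂ) with hl
  have hl0 : ∀ k, l k ≠ 0 := fun k => by
    rw [hl]; exact Complex.ofReal_ne_zero.2 (hpos k).ne'
  have hRA : ∀ k (x : A.domain), R k (A x) = l k • R k x - x := fun k x => by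
    have := hR2 k x
    rw [map_sub, map_smul] at this
    exact eq_sub_of_add_eq ((add_comm _ _).trans (sub_eq_iff_eq_add.1 this).symm)
  -- The resolvent identity. Read in both orders and divided by `l k - l j`, it shows that the
  -- resolvents commute.
  have hres : ∀ j k y, R j y - R k y = (l k - l j) • R j (R k y) := fun j k y => by
    have h1 := hR1 k y ⟨_, hRm k y⟩ rfl
    have h2 := hR2 j ⟨_, hRm k y⟩
    change l k • R k y - _ = y at h1
    change R j (l j • R k y - _) = R k y at h2
    have h3 : R j y = R j ((l k - l j) • R k y + (l j • R k y - A ⟨_, hRm k y⟩)) := by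
      congr 1
      rw [sub_smul]
      nth_rw 1 [← h1]
      abel
    rw [h3, map_add, h2, map_smul, add_sub_cancel_right]
  have hcomm : ∀ j k, Commute (R j) (R k) := fun j k => by
    ext y
    change R j (R k y) = R k (R j y)
    rcases eq_or_ne j k with h | h
    · rw [h]
    have h1 := hres j k y
    have h2 := hres k j y
    have h3 : l k - l j ≠ 0 := by
      rw [sub_ne_zero, hl]
      simpa using fun h' => h h'.symm
    have h4 : (l k - l j) • R j (R k y) = (l k - l j) • R k (R j y) := by
      rw [← h1, ← neg_sub (l j), neg_smul, ← h2, neg_sub]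
    exact smul_right_injective _ h3 h4
  -- On the domain, `l R x - x = R A x` has norm at most `‖A x‖ / (k + 1)`. The operators `l R` are
  -- contractions, so density extends the convergence to all of `H`.
  have hlim : ∀ y, Tendsto (fun k => l k • R k y) atTop (𝓝 y) := by
    have hb : ∀ k y, ‖l k • R k y‖ ≤ ‖y‖ := fun k y => by
      have hlk : ‖l k‖ = (k : ℝ) + 1 := by
        rw [hl, Complex.norm_real, Real.norm_of_nonneg (hpos k).le]
      rw [norm_smul, hlk]
      calc _ ≤ ((k : ℝ) + 1) * (((k : ℝ) + 1)⁻¹ * ‖y‖) := by gcongr; exact hRn k y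
        _ = ‖y‖ := by rw [mul_inv_cancel_left₀ (hpos k).ne']
    intro y
    rw [Metric.tendsto_atTop]
    intro ε hε
    obtain ⟨x, hx, hxy⟩ := Metric.mem_closure_iff.1 (hA.dense y) (ε / 3) (by positivity)
    obtain ⟨N, hN⟩ := exists_nat_gt (‖A ⟨x, hx⟩‖ / (ε / 3))
    refine ⟨N, fun k hk => ?_⟩
    have e1 : l k • R k y - y = l k • R k (y - x) + (l k • R k x - x) - (y - x) := by
      rw [map_sub, smul_sub]; abel
    have e2 : ‖l k • R k x - x‖ < ε / 3 := by
      rw [← hRA k ⟨x, hx⟩]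
      refine (hRn k _).trans_lt ?_
      rw [inv_mul_eq_div, div_lt_iff₀ (hpos k)]
      rw [div_lt_iff₀ (by positivity)] at hN
      have : (N : ℝ) ≤ k := by exact_mod_cast hk
      nlinarith
    rw [dist_eq_norm] at hxy ⊢
    rw [e1]
    have := hb k (y - x)
    calc _ ≤ ‖l k • R k (y - x)‖ + ‖l k • R k x - x‖ + ‖y - x‖ :=
          (norm_sub_le _ _).trans (by gcongr; exact norm_add_le _ _)
      _ < ε := by linarith
  -- This operator is `l A R`, written in a form that is visibly bounded; on the domain it is `l R A
  -- x`, so `hlim` applied to `A x` gives the limit.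
  refine ⟨fun k => l k • (l k • R k - 1), fun k y => ?_, fun j k => ?_, fun x => ?_⟩
  -- With `z = A R y` one has `y = l R y - z` and `B y = l z`, so `Re ⟨y, B y⟩ = l (l Re ⟨R y, A R
  -- y⟩ - ‖z‖²) ≤ 0`.
  · have h1 := hR1 k y ⟨_, hRm k y⟩ rfl
    have h2 := hA.re_inner_le ⟨_, hRm k y⟩
    set z := A ⟨_, hRm k y⟩ with hz
    change l k • R k y - z = y at h1
    change (inner ℂ (R k y) z).re ≤ 0 at h2
    have h3 : (l k • (l k • R k - 1)) y = l k • z := by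
      change l k • (l k • R k y - y) = _
      nth_rw 2 [← h1]
      rw [sub_sub_cancel]
    rw [h3]
    nth_rw 1 [← h1]
    rw [inner_smul_right, inner_sub_left, inner_smul_left, inner_self_eq_norm_sq_to_K]
    have hlk : l k = (((k : ℝ) + 1 : ℝ) : ℂ) := rfl
    rw [hlk, Complex.conj_ofReal, Complex.re_ofReal_mul, Complex.sub_re, Complex.re_ofReal_mul]
    have h5 : (((‖z‖ : ℂ)) ^ 2).re = ‖z‖ ^ 2 := by rw [← Complex.ofReal_pow, Complex.ofReal_re]
    have h6 : (((RCLike.ofReal ‖z‖ : ℂ)) ^ 2).re = ‖z‖ ^ 2 := h5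
    rw [h6]
    have h7 := hpos k
    have h8 : ((k : ℝ) + 1) * (inner ℂ (R k y) z).re ≤ 0 :=
      mul_nonpos_of_nonneg_of_nonpos h7.le h2
    exact mul_nonpos_of_nonneg_of_nonpos h7.le (by nlinarith [sq_nonneg ‖z‖])
  · exact ((((hcomm j k).smul_left _).smul_right _ |>.sub_left (Commute.one_left _)
      |>.sub_right (Commute.one_right _)).smul_left _).smul_right _
  · have := hlim (A x)
    refine this.congr fun k => ?_
    rw [hRA]
    rfl

/-- The one-parameter group generated by a bounded operator. -/
lemma exists_expGroup (B : H →L[ℂ] H) (hB : ∀ y, (inner ℂ y (B y)).re ≤ 0) :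
    ∃ E : ℝ → H →L[ℂ] H, E 0 = 1 ∧ (∀ s t, E (s + t) = E s * E t) ∧
      (∀ t, 0 ≤ t → ∀ x, ‖E t x‖ ≤ ‖x‖) ∧ (∀ t, HasDerivAt E (E t * B) t) ∧
      (∀ t C, Commute B C → Commute (E t) C) := by
  have hder : ∀ x t, HasDerivAt (fun s : ℝ => NormedSpace.exp (s • B) x)
      (NormedSpace.exp (t • B) (B x)) t := fun x t =>
    ((ContinuousLinearMap.apply ℂ H x).restrictScalars ℝ).hasFDerivAt.comp_hasDerivAt t
      (hasDerivAt_exp_smul_const B t)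
  have hcom : ∀ (t : ℝ) C, Commute B C → Commute (NormedSpace.exp (t • B)) C := fun t C h =>
    (h.smul_left t).exp_left
  refine ⟨fun t => NormedSpace.exp (t • B), by simp, fun s t => ?_, fun t ht x => ?_,
    fun t => hasDerivAt_exp_smul_const B t, hcom⟩
  · let _ : NormedAlgebra ℚ (H →L[ℂ] H) := NormedAlgebra.restrictScalars ℚ ℂ _
    simp only [add_smul]
    exact NormedSpace.exp_add_of_commute ((Commute.refl B).smul_left s |>.smul_right t)
  · have h2 : ∀ s, HasDerivAt (fun s : ℝ => ‖NormedSpace.exp (s • B) x‖ ^ 2)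
        (2 * (inner ℂ (NormedSpace.exp (s • B) x) (B (NormedSpace.exp (s • B) x))).re) s := by
      intro s
      let _ : InnerProductSpace ℝ H := InnerProductSpace.complexToReal
      have h3 := (hder x s).norm_sq (F := H)
      have h4 : NormedSpace.exp (s • B) (B x) = B (NormedSpace.exp (s • B) x) :=
        congrArg (fun T : H →L[ℂ] H => T x) (hcom s B (Commute.refl B))
      rw [h4] at h3
      exact h3
    have h5 : Antitone (fun s : ℝ => ‖NormedSpace.exp (s • B) x‖ ^ 2) :=
      antitone_of_deriv_nonpos (fun s => (h2 s).differentiableAt) fun s => by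
        rw [(h2 s).deriv]
        have := hB (NormedSpace.exp (s • B) x)
        linarith
    have h6 := h5 ht
    simp only [zero_smul, NormedSpace.exp_zero] at h6
    exact (sq_le_sq₀ (norm_nonneg _) (norm_nonneg _)).1 h6

end semigroup

/-! ### Uniqueness of solutions and the limit of the Yosida exponentials. -/

section semigroup

variable {H : Type*} [NormedAddCommGroup H] [InnerProductSpace ℂ H]
variable {A : H →ₗ.[ℂ] H}

/-- Classical solutions are unique. -/
lemma IsMaxDissipative.classicalSolution_unique (hA : IsMaxDissipative A) {x : H} {U V : ℝ → H}
    (hU : IsClassicalSolution A x U) (hV : IsClassicalSolution A x V) (t : ℝ) (ht : 0 ≤ t) :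
    V t = U t := by
  obtain ⟨⟨U', -, hU1, hU2⟩, -, hU0⟩ := hU
  obtain ⟨⟨V', -, hV1, hV2⟩, -, hV0⟩ := hV
  let _ : InnerProductSpace ℝ H := InnerProductSpace.complexToReal
  have hd : ∀ s, 0 ≤ s → HasDerivWithinAt (fun s => ‖V s - U s‖ ^ 2)
      (2 * (inner ℂ (V s - U s) (V' s - U' s)).re) (Ici 0) s := fun s hs =>
    ((hV1 s hs).sub (hU1 s hs)).norm_sq
  have hanti : AntitoneOn (fun s => ‖V s - U s‖ ^ 2) (Ici 0) := by
    refine antitoneOn_of_deriv_nonpos (convex_Ici 0) (fun s hs => (hd s hs).continuousWithinAt)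
      (fun s hs => ?_) fun s hs => ?_
    · rw [interior_Ici] at hs
      exact ((hd s (le_of_lt hs)).differentiableWithinAt).mono interior_subset
    · rw [interior_Ici] at hs
      have h1 := (hd s (le_of_lt hs)).hasDerivAt (Ici_mem_nhds hs)
      rw [h1.deriv]
      obtain ⟨z, hz, hz'⟩ := (LinearPMap.mem_graph_iff A).1 (hV2 s hs)
      obtain ⟨w, hw, hw'⟩ := (LinearPMap.mem_graph_iff A).1 (hU2 s hs)
      have h2 := hA.re_inner_le (z - w)
      rw [A.map_sub, Submodule.coe_sub, hz, hw, hz', hw'] at h2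
      simp only at h2
      linarith
  have h1 := hanti (mem_Ici.2 le_rfl) ht ht
  simp only [hU0, hV0, sub_self, norm_zero] at h1
  rw [← sub_eq_zero, ← norm_eq_zero]
  refine pow_eq_zero_iff two_ne_zero |>.1 (le_antisymm ?_ (sq_nonneg _))
  simpa using h1

variable [CompleteSpace H]

/-- Contractions which converge on a dense set converge everywhere. -/
lemma exists_tendsto_of_dense {E : ℕ → H →L[ℂ] H} (hE : ∀ k x, ‖E k x‖ ≤ ‖x‖) {D : Set H}
    (hD : Dense D) (h : ∀ x ∈ D, CauchySeq fun k => E k x) (x : H) :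
    ∃ y, Tendsto (fun k => E k x) atTop (𝓝 y) := by
  refine cauchySeq_tendsto_of_complete (Metric.cauchySeq_iff.2 fun ε hε => ?_)
  obtain ⟨z, hz, hxz⟩ := Metric.mem_closure_iff.1 (hD x) (ε / 3) (by positivity)
  obtain ⟨N, hN⟩ := Metric.cauchySeq_iff.1 (h z hz) (ε / 3) (by positivity)
  refine ⟨N, fun m hm n hn => ?_⟩
  have h1 := hN m hm n hn
  rw [dist_eq_norm] at h1 hxz ⊢
  have e : E m x - E n x = E m (x - z) + (E m z - E n z) - E n (x - z) := by
    simp only [map_sub]; abel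
  rw [e]
  have h2 := hE m (x - z)
  have h3 := hE n (x - z)
  calc _ ≤ ‖E m (x - z)‖ + ‖E m z - E n z‖ + ‖E n (x - z)‖ :=
        (norm_sub_le _ _).trans (by gcongr; exact norm_add_le _ _)
    _ < ε := by linarith

/-- The exponentials of the Yosida approximations are contractions and converge strongly. The
integral identity for `x` in the domain is the form in which differentiability of orbits survives
the limit, by dominated convergence. -/
lemma IsMaxDissipative.exists_semigroup_aux (hA : IsMaxDissipative A) :
    ∃ T : ℝ≥0 → H →L[ℂ] H, T 0 = ContinuousLinearMap.id ℂ H ∧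
      (∀ s t, T (s + t) = (T s).comp (T t)) ∧ (∀ t x, ‖T t x‖ ≤ ‖x‖) ∧
      (∀ x, Continuous fun t => T t x) ∧
      ∀ (x : A.domain) (t : ℝ), 0 ≤ t →
        T t.toNNReal (x : H) = x + ∫ s in (0 : ℝ)..t, T s.toNNReal (A x) := by
  obtain ⟨B, hB, hBc, hBA⟩ := hA.exists_approx
  choose E hE0 hEadd hEn hEd hEc using fun k => exists_expGroup (B k) (hB k)
  -- The path `s ↦ E j (t - s) (E k s x)` joins `E j t x` to `E k t x`. Since the operators commute,
  -- its derivative is a product of contractions applied to `B k x - B j x`.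
  have hdiff : ∀ j k t x, 0 ≤ t → ‖E k t x - E j t x‖ ≤ ‖B k x - B j x‖ * t := by
    intro j k t x ht
    have h1 : ∀ s ∈ Icc 0 t, HasDerivWithinAt (fun s => (E j (t - s) * E k s) x)
        ((E j (t - s) * E k s) (B k x - B j x)) (Icc 0 t) s := by
      intro s _
      have e1 : HasDerivAt (fun s => E j (t - s)) (-(E j (t - s) * B j)) s := by
        exact (hEd j (t - s)).comp_const_sub t s
      have e2 := e1.mul (hEd k s)
      have e3 := ((ContinuousLinearMap.apply ℂ H x).restrictScalars ℝ).hasFDerivAt.comp_hasDerivAt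
        s e2
      refine (e3.congr_deriv ?_).hasDerivWithinAt
      change (-(E j (t - s) * B j) * E k s + E j (t - s) * (E k s * B k)) x = _
      rw [neg_mul, mul_assoc, ((hEc k s (B j) (hBc k j)).symm : Commute (B j) (E k s)).eq]
      simp only [add_apply, neg_apply, mul_apply_eq_comp, map_sub]
      abel
    have h2 : ∀ s ∈ Ico 0 t, ‖(E j (t - s) * E k s) (B k x - B j x)‖ ≤ ‖B k x - B j x‖ :=
      fun s hs => (hEn j _ (sub_nonneg.2 hs.2.le) _).trans (hEn k _ hs.1 _)
    have h3 := norm_image_sub_le_of_norm_deriv_le_segment' h1 h2 t (right_mem_Icc.2 ht)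
    simpa [hE0] using h3
  have hconv : ∀ (t : ℝ≥0) (x : H), ∃ y, Tendsto (fun k => E k t x) atTop (𝓝 y) := by
    intro t
    refine exists_tendsto_of_dense (fun k x => hEn k t t.2 x) hA.dense fun x hx => ?_
    have hc := (hBA ⟨x, hx⟩).cauchySeq
    rw [Metric.cauchySeq_iff] at hc ⊢
    intro ε hε
    -- Dividing by `t + 1` rather than `t` covers `t = 0`.
    obtain ⟨N, hN⟩ := hc (ε / (t + 1)) (by positivity)
    refine ⟨N, fun m hm n hn => ?_⟩
    have h1 := hN m hm n hn
    rw [dist_eq_norm, lt_div_iff₀ (by positivity)] at h1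
    rw [dist_eq_norm]
    refine (hdiff n m t x t.2).trans_lt ?_
    nlinarith [norm_nonneg (B m x - B n x)]
  choose T0 hT0 using hconv
  have hT0n : ∀ t x, ‖T0 t x‖ ≤ ‖x‖ := fun t x =>
    le_of_tendsto (hT0 t x).norm (Eventually.of_forall fun k => hEn k t t.2 x)
  let T : ℝ≥0 → H →L[ℂ] H := fun t => LinearMap.mkContinuous
    { toFun := T0 t
      map_add' := fun x y => tendsto_nhds_unique (hT0 t (x + y))
        (((hT0 t x).add (hT0 t y)).congr fun k => (map_add _ _ _).symm)
      map_smul' := fun c x => tendsto_nhds_unique (hT0 t (c • x))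
        (((hT0 t x).const_smul c).congr fun k => (map_smul _ _ _).symm) } 1
    fun x => by simpa using hT0n t x
  have hT : ∀ (t : ℝ≥0) x, Tendsto (fun k => E k t x) atTop (𝓝 (T t x)) := hT0
  have hTn : ∀ t x, ‖T t x‖ ≤ ‖x‖ := hT0n
  -- Orbits starting in the domain are Lipschitz with constant `‖A x‖`; a general orbit is a uniform
  -- limit of such orbits, because every `T t` is a contraction.
  have hTcont : ∀ x, Continuous fun t : ℝ≥0 => T t x := by
    have hD : ∀ x : A.domain, Continuous fun t : ℝ≥0 => T t x := by
      intro x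
      have hlip : ∀ s t : ℝ≥0, s ≤ t → ‖T t x - T s x‖ ≤ ‖A x‖ * (t - s) := by
        intro s t hst
        refine le_of_tendsto_of_tendsto ((hT t x).sub (hT s x)).norm
          ((hBA x).norm.mul_const _) (Eventually.of_forall fun k => ?_)
        have h1 : ∀ r ∈ Icc (s : ℝ) t, HasDerivWithinAt (fun r => E k r x)
            ((E k r * B k) x) (Icc (s : ℝ) t) r := fun r _ =>
          (((ContinuousLinearMap.apply ℂ H (x : H)).restrictScalars ℝ).hasFDerivAt.comp_hasDerivAt
            r (hEd k r)).hasDerivWithinAt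
        exact norm_image_sub_le_of_norm_deriv_le_segment' h1
          (fun r hr => hEn k r (s.2.trans hr.1) _) t (right_mem_Icc.2 (by exact_mod_cast hst))
      refine (LipschitzWith.of_dist_le_mul (K := ‖A x‖₊) fun s t => ?_).continuous
      rw [dist_eq_norm, NNReal.dist_eq, coe_nnnorm]
      rcases le_total s t with h | h
      · rw [norm_sub_rev, abs_sub_comm, abs_of_nonneg (sub_nonneg.2 (by exact_mod_cast h))]
        exact hlip s t h
      · rw [abs_of_nonneg (sub_nonneg.2 (by exact_mod_cast h))]
        exact hlip t s h
    intro x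
    refine continuous_of_uniform_approx_of_continuous fun u hu => ?_
    obtain ⟨ε, hε, hεu⟩ := Metric.mem_uniformity_dist.1 hu
    obtain ⟨z, hz, hxz⟩ := Metric.mem_closure_iff.1 (hA.dense x) ε hε
    refine ⟨fun t => T t z, hD ⟨z, hz⟩, fun t => hεu ?_⟩
    rw [dist_eq_norm] at hxz ⊢
    rw [← map_sub]
    exact (hTn t _).trans_lt hxz
  refine ⟨T, ?_, fun s t => ?_, hTn, hTcont, fun x t ht => ?_⟩
  · ext x
    refine tendsto_nhds_unique (hT 0 x) ?_
    simp [hE0]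
  · ext x
    refine tendsto_nhds_unique (hT (s + t) x) ?_
    have h1 : Tendsto (fun k => E k s (E k t x - T t x)) atTop (𝓝 0) :=
      squeeze_zero_norm (fun k => hEn k s s.2 _)
        (by simpa using ((hT t x).sub_const (T t x)).norm)
    have h2 := h1.add (hT s (T t x))
    rw [zero_add] at h2
    refine h2.congr fun k => ?_
    rw [NNReal.coe_add, hEadd, map_sub, sub_add_cancel]
    rfl
  · have hint : ∀ k, E k t x = x + ∫ s in (0 : ℝ)..t, E k s (B k x) := fun k => by
      have hd : ∀ s, HasDerivAt (fun s => E k s x) (E k s (B k x)) s := fun s =>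
        ((ContinuousLinearMap.apply ℂ H (x : H)).restrictScalars ℝ).hasFDerivAt.comp_hasDerivAt
          s (hEd k s)
      have hc : Continuous fun s => E k s (B k x) :=
        continuous_iff_continuousAt.2 fun s => (((ContinuousLinearMap.apply ℂ H
          (B k x)).restrictScalars ℝ).hasFDerivAt.comp_hasDerivAt s (hEd k s)).continuousAt
      rw [intervalIntegral.integral_eq_sub_of_hasDerivAt (fun s _ => hd s)
        (hc.intervalIntegrable _ _), hE0]
      simp
    obtain ⟨C, hC⟩ := (hBA x).norm.bddAbove_range
    have hlim : Tendsto (fun k => ∫ s in (0 : ℝ)..t, E k s (B k x)) atTop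
        (𝓝 (∫ s in (0 : ℝ)..t, T s.toNNReal (A x))) := by
      refine intervalIntegral.tendsto_integral_filter_of_dominated_convergence (fun _ => C)
        (Eventually.of_forall fun k => ?_) (Eventually.of_forall fun k => ?_)
        intervalIntegrable_const (Eventually.of_forall fun s hs => ?_)
      · exact (continuous_iff_continuousAt.2 fun s => (((ContinuousLinearMap.apply ℂ H
          (B k x)).restrictScalars ℝ).hasFDerivAt.comp_hasDerivAt s
          (hEd k s)).continuousAt).aestronglyMeasurable
      · refine Eventually.of_forall fun s hs => ?_
        rw [uIoc_of_le ht] at hs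
        exact (hEn k s hs.1.le _).trans (hC ⟨k, rfl⟩)
      · rw [uIoc_of_le ht] at hs
        have h1 : Tendsto (fun k => E k s (B k x - A x)) atTop (𝓝 0) :=
          squeeze_zero_norm (fun k => hEn k s hs.1.le _)
            (by simpa using ((hBA x).sub_const (A x)).norm)
        have h2 := h1.add (hT s.toNNReal (A x))
        rw [zero_add] at h2
        refine h2.congr fun k => ?_
        rw [Real.coe_toNNReal _ hs.1.le, map_sub, sub_add_cancel]
    have h3 := hT t.toNNReal x
    rw [Real.coe_toNNReal _ ht] at h3
    refine tendsto_nhds_unique h3 ?_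
    simp only [hint]
    exact hlim.const_add _

/-- The Hille–Yosida theorem for maximal dissipative operators, with the solutions of the
Cauchy problem. -/
lemma IsMaxDissipative.exists_semigroup (hA : IsMaxDissipative A) :
    ∃ T : ℝ≥0 → H →L[ℂ] H, IsC0Semigroup T ∧ (∀ t, ‖T t‖ ≤ 1) ∧ IsGenerator T A ∧
      ∀ x ∈ A.domain, IsClassicalSolution A x fun t => T t.toNNReal x := by
  obtain ⟨T, h0, hadd, hn, hc, hint⟩ := hA.exists_semigroup_aux
  have hder : ∀ (x : A.domain) (t : ℝ), 0 ≤ t → HasDerivWithinAt (fun s => T s.toNNReal (x : H))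
      (T t.toNNReal (A x)) (Ici 0) t := by
    intro x t ht
    have hcc : Continuous fun s : ℝ => T s.toNNReal (A x) :=
      (hc (A x)).comp continuous_real_toNNReal
    have h1 := (intervalIntegral.integral_hasDerivAt_right (hcc.intervalIntegrable 0 t)
      (hcc.stronglyMeasurableAtFilter _ _) hcc.continuousAt).const_add (x : H)
    exact h1.hasDerivWithinAt.congr (fun s hs => hint x s hs) (hint x t ht)
  have hcoe : Tendsto (fun t : ℝ≥0 => (t : ℝ)) (𝓝[>] 0) (𝓝[>] 0) := by
    refine tendsto_nhdsWithin_iff.2 ⟨?_, ?_⟩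
    · exact (NNReal.continuous_coe.tendsto' 0 0 rfl).mono_left nhdsWithin_le_nhds
    · filter_upwards [self_mem_nhdsWithin] with t ht
      exact_mod_cast ht
  have hfwd : ∀ x : A.domain,
      Tendsto (fun t : ℝ≥0 => (((t : ℝ)⁻¹ : ℝ) : ℂ) • (T t x - x)) (𝓝[>] 0) (𝓝 (A x)) := by
    intro x
    have h1 := (hasDerivWithinAt_iff_tendsto_slope.1 (hder x 0 le_rfl))
    rw [Ici_sdiff_left] at h1
    have h2 := h1.comp hcoe
    simp only [Real.toNNReal_zero, h0, ContinuousLinearMap.id_apply] at h2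
    refine h2.congr fun t => ?_
    simp only [slope, Function.comp_apply, vsub_eq_sub, sub_zero, Real.toNNReal_coe,
      Real.toNNReal_zero, h0, ContinuousLinearMap.id_apply]
    rw [Complex.coe_smul]
  have hne : (𝓝[>] (0 : ℝ≥0)).NeBot := nhdsGT_neBot_of_exists_gt ⟨1, one_pos⟩
  have hgen : IsGenerator T A := by
    intro x y
    constructor
    · intro h
      obtain ⟨z, rfl, rfl⟩ := (LinearPMap.mem_graph_iff A).1 h
      exact hfwd z
    · intro h
      -- It must be shown that `x` lies in the domain. Let `z` solve `z - A z = x - y`, so `y - A z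
      -- = x - z`. Then the difference quotients of `x - z` tend to `x - z`, while contractivity
      -- makes their inner product with `x - z` have nonpositive real part. Hence `‖x - z‖² ≤ 0`.
      obtain ⟨z, hz⟩ := hA.surj 1 one_pos (x - y)
      have h1 := h.sub (hfwd z)
      have h2 : y - A z = x - z := by
        rw [Complex.ofReal_one, one_smul] at hz
        rw [sub_eq_sub_iff_add_eq_add] at hz ⊢
        rw [add_comm y, hz, add_comm]
      rw [h2] at h1
      have h3 : ∀ t : ℝ≥0, (inner ℂ (x - z) ((((t : ℝ)⁻¹ : ℝ) : ℂ) • (T t x - x)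
          - (((t : ℝ)⁻¹ : ℝ) : ℂ) • (T t z - z))).re ≤ 0 := by
        intro t
        rw [← smul_sub, sub_sub_sub_comm, ← map_sub, inner_smul_right, Complex.re_ofReal_mul]
        refine mul_nonpos_of_nonneg_of_nonpos (inv_nonneg.2 t.2) ?_
        rw [inner_sub_right, Complex.sub_re, sub_nonpos]
        have h4 := re_inner_le_norm (𝕜 := ℂ) (x - z) (T t (x - z))
        have h5 := inner_self_eq_norm_sq (𝕜 := ℂ) (x - (z : H))
        have h6 := hn t (x - z)
        change (inner ℂ (x - (z : H)) _).re ≤ _ at h4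
        change (inner ℂ (x - (z : H)) _).re = _ at h5
        nlinarith [norm_nonneg (x - (z : H))]
      have h7 := le_of_tendsto ((Complex.continuous_re.tendsto _).comp
        ((tendsto_const_nhds (x := x - (z : H))).inner h1)) (Eventually.of_forall h3)
      have h8 := inner_self_eq_norm_sq (𝕜 := ℂ) (x - (z : H))
      change (inner ℂ (x - (z : H)) _).re = _ at h8
      rw [h8] at h7
      have h9 : x - (z : H) = 0 := by
        rw [← norm_eq_zero]
        exact pow_eq_zero_iff two_ne_zero |>.1 (le_antisymm h7 (sq_nonneg _))
      rw [h9, sub_eq_zero] at h2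
      rw [sub_eq_zero] at h9
      exact (LinearPMap.mem_graph_iff A).2 ⟨z, h9.symm, h2.symm⟩
  -- The operators `T t` and `T s` commute, so applying `T t` to the difference quotients of `x`
  -- gives those of `T t x`: the domain is invariant and `A` commutes with the semigroup.
  have hgraph : ∀ (x : A.domain) t, (T t (x : H), T t (A x)) ∈ A.graph := by
    intro x t
    rw [hgen]
    refine (((T t).continuous.tendsto _).comp (hfwd x)).congr fun s => ?_
    have h1 : T s (T t x) = T t (T s x) := by
      have h2 := hadd s t
      rw [add_comm, hadd] at h2
      exact (congrArg (fun S : H →L[ℂ] H => S x) h2).symm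
    simp only [Function.comp_apply, map_smul, map_sub, h1]
  refine ⟨T, ⟨h0, hadd, fun x => ?_⟩, fun t => ?_, hgen, fun x hx => ⟨⟨fun t => T t.toNNReal
    (A ⟨x, hx⟩), ?_, fun t ht => hder ⟨x, hx⟩ t ht, fun t _ => hgraph ⟨x, hx⟩ _⟩, fun t _ => ?_, ?_⟩⟩
  · exact (hc x).tendsto' 0 x (by rw [h0]; rfl)
  · exact ContinuousLinearMap.opNorm_le_bound _ zero_le_one fun x => by simpa using hn t x
  · exact ((hc _).comp continuous_real_toNNReal).continuousOn
  · obtain ⟨z, hz, -⟩ := (LinearPMap.mem_graph_iff A).1 (hgraph ⟨x, hx⟩ t.toNNReal)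
    change T t.toNNReal x ∈ A.domain
    change (z : H) = T t.toNNReal x at hz
    rw [← hz]
    exact z.2
  · simp [h0]

end semigroup

/-! ### Estimates for smooth functions with compact support -/

section smooth

open scoped ComplexConjugate

variable {n : ℕ}

lemma norm_integral_conj_mul_le {α : Type*} [MeasurableSpace α] {μ : Measure α} {f g : α → ℂ}
    (hf : MemLp f 2 μ) (hg : MemLp g 2 μ) :
    ‖∫ x, conj (f x) * g x ∂μ‖ ≤ (eLpNorm f 2 μ).toReal * (eLpNorm g 2 μ).toReal := by
  have h1 := norm_inner_le_norm (𝕜 := ℂ) (hf.toLp f) (hg.toLp g)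
  rw [Lp.norm_toLp, Lp.norm_toLp, L2.inner_def] at h1
  have h2 : ∫ x, inner ℂ (hf.toLp f x) (hg.toLp g x) ∂μ = ∫ x, conj (f x) * g x ∂μ := by
    refine integral_congr_ae ?_
    filter_upwards [hf.coeFn_toLp, hg.coeFn_toLp] with x hx hx'
    rw [hx, hx', RCLike.inner_apply, mul_comm]
  rwa [h2] at h1

lemma integral_conj_mul_self {α : Type*} [MeasurableSpace α] {μ : Measure α} {f : α → ℂ}
    (hf : MemLp f 2 μ) :
    ∫ x, conj (f x) * f x ∂μ = (((eLpNorm f 2 μ).toReal ^ 2 : ℝ) : ℂ) := by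
  have h1 := inner_self_eq_norm_sq_to_K (𝕜 := ℂ) (hf.toLp f)
  rw [Lp.norm_toLp, L2.inner_def] at h1
  have h2 : ∫ x, inner ℂ (hf.toLp f x) (hf.toLp f x) ∂μ = ∫ x, conj (f x) * f x ∂μ := by
    refine integral_congr_ae ?_
    filter_upwards [hf.coeFn_toLp] with x hx
    rw [hx, RCLike.inner_apply, mul_comm]
  rw [h2] at h1
  simpa using h1

/-- The partial derivative `∂ᵢ f`. -/
def pd {F : Type*} [NormedAddCommGroup F] [NormedSpace ℝ F] (i : Fin n) (f : Eu n → F) :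
    Eu n → F := fun x => fderiv ℝ f x (unitVec i)

/-- `f ∈ C_c^∞(ℝⁿ)`. -/
def IsSmoothCompact {F : Type*} [NormedAddCommGroup F] [NormedSpace ℝ F] (f : Eu n → F) : Prop :=
  ContDiff ℝ ∞ f ∧ HasCompactSupport f

variable {F : Type*} [NormedAddCommGroup F] [NormedSpace ℝ F]

lemma tsupport_pd_subset (i : Fin n) (f : Eu n → F) : tsupport (pd i f) ⊆ tsupport f :=
  tsupport_fderiv_apply_subset ℝ (unitVec i)

lemma IsSmoothCompact.pd {f : Eu n → F} (hf : IsSmoothCompact f) (i : Fin n) :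
    IsSmoothCompact (pd i f) :=
  ⟨(hf.1.fderiv_right (m := ∞) (by norm_cast)).clm_apply contDiff_const,
    hf.2.fderiv_apply (𝕜 := ℝ) (unitVec i)⟩

lemma IsSmoothCompact.add {f g : Eu n → F} (hf : IsSmoothCompact f) (hg : IsSmoothCompact g) :
    IsSmoothCompact (f + g) := ⟨hf.1.add hg.1, hf.2.add hg.2⟩

lemma IsSmoothCompact.sub {f g : Eu n → F} (hf : IsSmoothCompact f) (hg : IsSmoothCompact g) :
    IsSmoothCompact (f - g) := by
  refine ⟨hf.1.sub hg.1, ?_⟩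
  rw [sub_eq_add_neg]
  exact hf.2.add hg.2.neg

lemma IsSmoothCompact.continuous {f : Eu n → F} (hf : IsSmoothCompact f) : Continuous f :=
  hf.1.continuous

lemma IsSmoothCompact.memLp {f : Eu n → F} (hf : IsSmoothCompact f) (p : ℝ≥0∞) (μ : Measure (Eu n))
    [IsFiniteMeasureOnCompacts μ] : MemLp f p μ :=
  hf.continuous.memLp_of_hasCompactSupport hf.2

lemma IsSmoothCompact.differentiable {f : Eu n → F} (hf : IsSmoothCompact f) :
    Differentiable ℝ f := hf.1.differentiable (by simp)

lemma IsSmoothCompact.pd_sub {f g : Eu n → F} (hf : IsSmoothCompact f) (hg : IsSmoothCompact g)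
    (i : Fin n) : PlateTransmission.pd i (f - g) = PlateTransmission.pd i f
      - PlateTransmission.pd i g := by
  funext x
  simp only [PlateTransmission.pd, Pi.sub_apply]
  rw [fderiv_sub (hf.differentiable x) (hg.differentiable x)]
  rfl

lemma IsSmoothCompact.pd_comm {f : Eu n → F} (hf : IsSmoothCompact f) (i j : Fin n) :
    PlateTransmission.pd i (PlateTransmission.pd j f)
      = PlateTransmission.pd j (PlateTransmission.pd i f) := by
  funext x
  have hd : DifferentiableAt ℝ (fderiv ℝ f) x :=
    (hf.1.fderiv_right (m := 1) (by norm_cast)).differentiable (by norm_num) x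
  have hs : IsSymmSndFDerivAt ℝ f x := (hf.1.contDiffAt (x := x)).isSymmSndFDerivAt (by simp; norm_cast)
  have e : ∀ k l : Fin n, PlateTransmission.pd k (PlateTransmission.pd l f) x
      = fderiv ℝ (fderiv ℝ f) x (unitVec k) (unitVec l) := by
    intro k l
    change fderiv ℝ (fun y => fderiv ℝ f y (unitVec l)) x (unitVec k) = _
    rw [fderiv_clm_apply hd (differentiableAt_const _)]
    simp
  rw [e, e, hs.eq]

lemma IsSmoothCompact.smul {f : Eu n → F} (hf : IsSmoothCompact f) {ζ : Eu n → ℝ}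
    (hζ : ContDiff ℝ ∞ ζ) : IsSmoothCompact (fun x => ζ x • f x) :=
  ⟨hζ.smul hf.1, hf.2.smul_left (f := ζ)⟩

lemma pd_smul {f : Eu n → F} {ζ : Eu n → ℝ} (hf : Differentiable ℝ f) (hζ : Differentiable ℝ ζ)
    (i : Fin n) (x : Eu n) : pd i (fun x => ζ x • f x) x = pd i ζ x • f x + ζ x • pd i f x := by
  simp only [pd]
  rw [fderiv_fun_smul (hζ x) (hf x)]
  simp [add_comm]

lemma pd_conj {f : Eu n → ℂ} (hf : Differentiable ℝ f) (i : Fin n) (x : Eu n) :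
    pd i (fun x => conj (f x)) x = conj (pd i f x) := by
  have h := (Complex.conjCLE : ℂ →L[ℝ] ℂ).hasFDerivAt.comp x (hf x).hasFDerivAt
  have h2 : fderiv ℝ (fun x => conj (f x)) x = _ := h.fderiv
  simp only [pd, h2]
  rfl

lemma integral_conj_pd_mul {f g : Eu n → ℂ} (hf : IsSmoothCompact f) (hg : IsSmoothCompact g)
    (i : Fin n) :
    ∫ x, conj (pd i f x) * g x = -∫ x, conj (f x) * pd i g x := by
  have hc : ∀ {u v : Eu n → ℂ}, IsSmoothCompact u → IsSmoothCompact v →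
      Integrable fun x => conj (u x) * v x := fun {u v} hu hv =>
    ((Complex.continuous_conj.comp hu.continuous).mul hv.continuous).integrable_of_hasCompactSupport
      (hv.2.mul_left (f := fun x => conj (u x)))
  have h := integral_mul_fderiv_eq_neg_fderiv_mul_of_integrable (μ := volume)
    (f := fun x => conj (f x)) (g := g) (v := unitVec i) ?_ (hc hf (hg.pd i)) (hc hf hg)
    (fun x _ => (Complex.conjCLE : ℂ →L[ℝ] ℂ).differentiableAt.comp x (hf.differentiable x))
    (fun x _ => hg.differentiable x)
  · change ∫ x, conj (f x) * pd i g x = -∫ x, pd i (fun x => conj (f x)) x * g x at h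
    simp only [pd_conj hf.differentiable] at h
    rw [h, neg_neg]
  · change Integrable fun x => pd i (fun x => conj (f x)) x * g x
    simp only [pd_conj hf.differentiable]
    exact hc (hf.pd i) hg

/-- The Laplacian as the sum of the second partial derivatives. -/
def lapl (f : Eu n → F) : Eu n → F := ∑ i, pd i (pd i f)

lemma IsSmoothCompact.lapl {f : Eu n → F} (hf : IsSmoothCompact f) : IsSmoothCompact (lapl f) := by
  unfold PlateTransmission.lapl
  refine Finset.sum_induction _ IsSmoothCompact (fun _ _ => IsSmoothCompact.add) ?_
    fun i _ => (hf.pd i).pd i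
  exact ⟨contDiff_const, HasCompactSupport.zero⟩

lemma IsSmoothCompact.lapl_sub {f g : Eu n → F} (hf : IsSmoothCompact f) (hg : IsSmoothCompact g) :
    PlateTransmission.lapl (f - g) = PlateTransmission.lapl f - PlateTransmission.lapl g := by
  simp only [PlateTransmission.lapl, hf.pd_sub hg, fun i => (hf.pd i).pd_sub (hg.pd i),
    Finset.sum_sub_distrib]

lemma integrable_conj_mul {f g : Eu n → ℂ} (hf : IsSmoothCompact f) (hg : IsSmoothCompact g) :
    Integrable fun x => conj (f x) * g x :=
  ((Complex.continuous_conj.comp hf.continuous).mul hg.continuous).integrable_of_hasCompactSupport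
      (hg.2.mul_left (f := fun x => conj (f x)))

/-- The Poincaré inequality. -/
lemma eLpNorm_le_pd {f : Eu n → ℂ} (hf : IsSmoothCompact f) {R : ℝ} (hR : 0 ≤ R)
    (hs : tsupport f ⊆ Metric.closedBall 0 R) (i : Fin n) :
    (eLpNorm f 2 volume).toReal ≤ 2 * R * (eLpNorm (pd i f) 2 volume).toReal := by
  set a := (eLpNorm f 2 volume).toReal
  set b := (eLpNorm (pd i f) 2 volume).toReal
  have ha : 0 ≤ a := ENNReal.toReal_nonneg
  have hb : 0 ≤ b := ENNReal.toReal_nonneg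
  have hζ : ContDiff ℝ ∞ (fun x : Eu n => x i) :=
    (EuclideanSpace.proj (𝕜 := ℝ) i : Eu n →L[ℝ] ℝ).contDiff
  -- Since `∂ᵢ (xᵢ f) = f + xᵢ ∂ᵢ f`, integrating by parts against `f` expresses `‖f‖²` by two
  -- integrals of `xᵢ f` against `∂ᵢ f`. Each is at most `R ‖f‖ ‖∂ᵢ f‖`, whence the factor `2 R`.
  have hg : IsSmoothCompact (fun x => (x i : ℝ) • f x) := hf.smul hζ
  have hpd : ∀ x, pd i (fun x => (x i : ℝ) • f x) x = f x + (x i : ℝ) • pd i f x := by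
    intro x
    rw [pd_smul hf.differentiable (hζ.differentiable (by simp))]
    congr 1
    have : fderiv ℝ (fun x : Eu n => x i) x = (EuclideanSpace.proj (𝕜 := ℝ) i : Eu n →L[ℝ] ℝ) :=
      (EuclideanSpace.proj (𝕜 := ℝ) i : Eu n →L[ℝ] ℝ).fderiv
    simp only [pd, this]
    simp
  have hgn : (eLpNorm (fun x => (x i : ℝ) • f x) 2 volume).toReal ≤ R * a := by
    have h1 : eLpNorm (fun x => (x i : ℝ) • f x) 2 volume ≤ ENNReal.ofReal R * eLpNorm f 2 volume := by
      refine eLpNorm_le_mul_eLpNorm_of_ae_le_mul (Eventually.of_forall fun x => ?_) 2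
      rw [norm_smul]
      by_cases hx : x ∈ tsupport f
      · gcongr
        have h2 := hs hx
        rw [mem_closedBall_zero_iff] at h2
        exact (PiLp.norm_apply_le x i).trans h2
      · rw [image_eq_zero_of_notMem_tsupport hx]; simp
    refine (ENNReal.toReal_mono (ENNReal.mul_ne_top ENNReal.ofReal_ne_top
      (hf.memLp 2 volume).eLpNorm_ne_top) h1).trans_eq ?_
    rw [ENNReal.toReal_mul, ENNReal.toReal_ofReal hR]
  have h1 := integral_conj_pd_mul hg hf i
  simp only [hpd] at h1
  have h2 : ∫ x, conj (f x + (x i : ℝ) • pd i f x) * f x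
      = (∫ x, conj (f x) * f x) + ∫ x, conj (pd i f x) * ((x i : ℝ) • f x) := by
    rw [← integral_add (integrable_conj_mul hf hf) (integrable_conj_mul (hf.pd i) hg)]
    refine integral_congr_ae (Eventually.of_forall fun x => ?_)
    simp only [map_add, Complex.real_smul, map_mul, Complex.conj_ofReal]
    ring
  rw [h2, integral_conj_mul_self (hf.memLp 2 _)] at h1
  have h3 := norm_integral_conj_mul_le ((hf.pd i).memLp 2 volume) (hg.memLp 2 volume)
  have h4 := norm_integral_conj_mul_le (hg.memLp 2 volume) ((hf.pd i).memLp 2 volume)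
  have h5 : a ^ 2 ≤ 2 * (R * a * b) := by
    have h6 : ‖((a ^ 2 : ℝ) : ℂ)‖ ≤ 2 * (R * a * b) := by
      rw [eq_sub_of_add_eq h1]
      refine (norm_sub_le _ _).trans ?_
      rw [norm_neg]
      have h7 : b * (eLpNorm (fun x => (x i : ℝ) • f x) 2 volume).toReal ≤ b * (R * a) := by gcongr
      have h8 : (eLpNorm (fun x => (x i : ℝ) • f x) 2 volume).toReal * b ≤ R * a * b := by gcongr
      linarith
    rwa [Complex.norm_real, Real.norm_of_nonneg (sq_nonneg a)] at h6
  rcases ha.eq_or_lt with h | h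
  · rw [← h]; positivity
  · nlinarith

/-- Integration by parts gives `∑ ‖∂ᵢ f‖² = -⟨f, Δf⟩`. -/
lemma eLpNorm_pd_sq_le {f : Eu n → ℂ} (hf : IsSmoothCompact f) (i : Fin n) :
    (eLpNorm (pd i f) 2 volume).toReal ^ 2
      ≤ (eLpNorm f 2 volume).toReal * (eLpNorm (lapl f) 2 volume).toReal := by
  have h1 : ((∑ i, (eLpNorm (pd i f) 2 volume).toReal ^ 2 : ℝ) : ℂ)
      = -∫ x, conj (f x) * lapl f x := by
    rw [Complex.ofReal_sum]
    simp only [← integral_conj_mul_self ((hf.pd _).memLp 2 volume), lapl, Finset.sum_apply,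
      Finset.mul_sum]
    rw [integral_finsetSum _ fun i _ => integrable_conj_mul hf ((hf.pd i).pd i),
      ← Finset.sum_neg_distrib]
    exact Finset.sum_congr rfl fun i _ => integral_conj_pd_mul hf (hf.pd i) i
  have h2 := norm_integral_conj_mul_le (hf.memLp 2 volume) (hf.lapl.memLp 2 volume)
  rw [← norm_neg, ← h1, Complex.norm_real, Real.norm_of_nonneg (by positivity)] at h2
  exact (Finset.single_le_sum (f := fun i => (eLpNorm (pd i f) 2 volume).toReal ^ 2)
    (fun i _ => sq_nonneg _) (Finset.mem_univ i)).trans h2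

/-- With the Poincaré inequality the previous bound becomes `‖∂ᵢ f‖² ≤ 2 R ‖∂ᵢ f‖ ‖Δf‖`, and one
factor cancels. -/
lemma eLpNorm_pd_le_lapl {f : Eu n → ℂ} (hf : IsSmoothCompact f) {R : ℝ} (hR : 0 ≤ R)
    (hs : tsupport f ⊆ Metric.closedBall 0 R) (i : Fin n) :
    (eLpNorm (pd i f) 2 volume).toReal ≤ 2 * R * (eLpNorm (lapl f) 2 volume).toReal := by
  have h1 := eLpNorm_le_pd hf hR hs i
  have h2 := eLpNorm_pd_sq_le hf i
  set a := (eLpNorm f 2 volume).toReal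
  set b := (eLpNorm (pd i f) 2 volume).toReal with hb'
  set c := (eLpNorm (lapl f) 2 volume).toReal with hc'
  have hb : 0 ≤ b := ENNReal.toReal_nonneg
  have hc : 0 ≤ c := ENNReal.toReal_nonneg
  have h3 : a * c ≤ 2 * R * b * c := by gcongr
  rcases hb.eq_or_lt with h | h
  · rw [← h]; positivity
  · nlinarith

lemma eLpNorm_le_lapl {f : Eu n → ℂ} (hf : IsSmoothCompact f) {R : ℝ} (hR : 0 ≤ R)
    (hs : tsupport f ⊆ Metric.closedBall 0 R) (i : Fin n) :
    (eLpNorm f 2 volume).toReal ≤ (2 * R) ^ 2 * (eLpNorm (lapl f) 2 volume).toReal := by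
  refine (eLpNorm_le_pd hf hR hs i).trans ?_
  rw [sq, mul_assoc (2 * R)]
  gcongr
  exact eLpNorm_pd_le_lapl hf hR hs i

/-- Two integrations by parts turn `‖∂ⱼ∂ᵢ f‖²` into `⟨∂ᵢ∂ᵢ f, ∂ⱼ∂ⱼ f⟩`, and the sum over `i` and `j`
is `‖Δf‖²`. On the whole space this replaces elliptic regularity. -/
lemma eLpNorm_pd_pd_le {f : Eu n → ℂ} (hf : IsSmoothCompact f) (i j : Fin n) :
    (eLpNorm (pd j (pd i f)) 2 volume).toReal ≤ (eLpNorm (lapl f) 2 volume).toReal := by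
  have h1 : ∀ i j, (((eLpNorm (pd j (pd i f)) 2 volume).toReal ^ 2 : ℝ) : ℂ)
      = ∫ x, conj (pd i (pd i f) x) * pd j (pd j f) x := by
    intro i j
    rw [← integral_conj_mul_self (((hf.pd i).pd j).memLp 2 volume),
      integral_conj_pd_mul (hf.pd i) ((hf.pd i).pd j) j, hf.pd_comm j i,
      (hf.pd j).pd_comm j i, integral_conj_pd_mul (hf.pd i) ((hf.pd j).pd j) i]
  have h2 : ((∑ i, ∑ j, (eLpNorm (pd j (pd i f)) 2 volume).toReal ^ 2 : ℝ) : ℂ)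
      = (((eLpNorm (lapl f) 2 volume).toReal ^ 2 : ℝ) : ℂ) := by
    rw [← integral_conj_mul_self (hf.lapl.memLp 2 volume), Complex.ofReal_sum]
    simp only [lapl, Finset.sum_apply, map_sum, Finset.sum_mul, Finset.mul_sum, Complex.ofReal_sum]
    rw [Finset.sum_comm, integral_finsetSum _ fun j _ => integrable_finsetSum _ fun i _ =>
      integrable_conj_mul ((hf.pd i).pd i) ((hf.pd j).pd j)]
    refine Finset.sum_congr rfl fun j _ => ?_
    rw [integral_finsetSum _ fun i _ => integrable_conj_mul ((hf.pd i).pd i) ((hf.pd j).pd j)]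
    exact Finset.sum_congr rfl fun i _ => h1 i j
  rw [Complex.ofReal_inj] at h2
  refine abs_le_of_sq_le_sq' ?_ ENNReal.toReal_nonneg |>.2
  rw [← h2]
  refine le_trans ?_ (Finset.single_le_sum (fun i _ => Finset.sum_nonneg fun j _ => sq_nonneg _)
    (Finset.mem_univ i))
  exact Finset.single_le_sum (f := fun j => (eLpNorm (pd j (pd i f)) 2 volume).toReal ^ 2)
    (fun j _ => sq_nonneg _) (Finset.mem_univ j)

end smooth

/-! ### Mollification -/

section mollify

open scoped Convolution

variable {n : ℕ}

lemma eLpNorm_two_sq {α E : Type*} [MeasurableSpace α] [NormedAddCommGroup E] (μ : Measure α)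
    (f : α → E) : eLpNorm f 2 μ ^ 2 = ∫⁻ x, ‖f x‖ₑ ^ 2 ∂μ := by
  have h := eLpNorm_nnreal_pow_eq_lintegral (μ := μ) (f := f) (p := 2) (by norm_num)
  simpa using h

/-- Translations act continuously on `L²`; here this is the continuity of the additive domain action
on `Lp`. -/
lemma tendsto_eLpNorm_translate {U : Eu n → ℂ} (hU : MemLp U 2 volume) :
    Tendsto (fun t : Eu n => eLpNorm ((fun x => U (x - t)) - U) 2 volume) (𝓝 0) (𝓝 0) := by
  have : Fact ((2 : ℝ≥0∞) ≠ ⊤) := ⟨by norm_num⟩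
  have h1 : Continuous fun t : Eu n => DomAddAct.mk (-t) +ᵥ hU.toLp U :=
    (DomAddAct.continuous_mk.comp continuous_neg).vadd continuous_const
  have h2 := (h1.tendsto 0).edist (tendsto_const_nhds (x := hU.toLp U))
  have h3 : DomAddAct.mk (-(0 : Eu n)) +ᵥ hU.toLp U = hU.toLp U := by
    rw [neg_zero, DomAddAct.mk_zero, zero_vadd]
  rw [h3, edist_self] at h2
  refine h2.congr fun t => ?_
  rw [DomAddAct.mk_vadd_toLp, Lp.edist_toLp_toLp]
  congr 2
  funext x
  rw [vadd_eq_add, sub_eq_neg_add]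

/-- Jensen's inequality for the probability measure with density `ρ`. -/
lemma enorm_integral_smul_sq_le {ρ : Eu n → ℝ} (hρ : Continuous ρ) (h0 : ∀ t, 0 ≤ ρ t)
    (hi : Integrable ρ) (h1 : ∫ t, ρ t = 1) {g : Eu n → ℂ} (hg : AEStronglyMeasurable g volume) :
    ‖∫ t, ρ t • g t‖ₑ ^ 2 ≤ ∫⁻ t, ENNReal.ofReal (ρ t) * ‖g t‖ₑ ^ 2 := by
  set ν : Measure (Eu n) := volume.withDensity fun t => ENNReal.ofReal (ρ t) with hν
  have hm : Measurable fun t => ENNReal.ofReal (ρ t) := hρ.measurable.ennreal_ofReal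
  have hp : IsProbabilityMeasure ν := ⟨by
    rw [hν, withDensity_apply _ MeasurableSet.univ, Measure.restrict_univ,
      ← ofReal_integral_eq_lintegral_ofReal hi (Eventually.of_forall h0), h1, ENNReal.ofReal_one]⟩
  have e1 : ∫ t, ρ t • g t = ∫ t, g t ∂ν := by
    rw [hν, integral_withDensity_eq_integral_toReal_smul₀ hm.aemeasurable
      (Eventually.of_forall fun _ => ENNReal.ofReal_lt_top)]
    simp only [ENNReal.toReal_ofReal (h0 _)]
  have hg' : AEStronglyMeasurable g ν := hg.mono_ac (withDensity_absolutelyContinuous _ _)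
  have h2 : ‖∫ t, g t ∂ν‖ₑ ≤ eLpNorm g 2 ν := by
    refine (enorm_integral_le_lintegral_enorm _).trans ?_
    rw [← eLpNorm_one_eq_lintegral_enorm]
    exact eLpNorm_le_eLpNorm_of_exponent_le (by norm_num) hg'
  rw [e1]
  calc _ ≤ eLpNorm g 2 ν ^ 2 := by gcongr
    _ = _ := by
      rw [eLpNorm_two_sq, hν, lintegral_withDensity_eq_lintegral_mul₀ hm.aemeasurable
        (hg.enorm.pow_const 2)]
      rfl

/-- As `ρ` has integral one, the difference is the `ρ`-average of `U (x - t) - U x`. Jensen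
pointwise in `x` and Tonelli reduce it to the translates with `ρ t ≠ 0`. -/
lemma eLpNorm_convolution_sub_le {ρ : Eu n → ℝ} (hρ : Continuous ρ) (hc : HasCompactSupport ρ)
    (h0 : ∀ t, 0 ≤ ρ t) (h1 : ∫ t, ρ t = 1) {U : Eu n → ℂ} (hU : MemLp U 2 volume) {ε : ℝ≥0∞}
    (hε : ∀ t, ρ t ≠ 0 → eLpNorm ((fun x => U (x - t)) - U) 2 volume ≤ ε) :
    eLpNorm (ρ ⋆[ContinuousLinearMap.lsmul ℝ ℝ, volume] U - U) 2 volume ≤ ε := by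
  have hi : Integrable ρ := hρ.integrable_of_hasCompactSupport hc
  have hloc : LocallyIntegrable U volume := hU.locallyIntegrable (by norm_num)
  have hconv : ∀ x, (ρ ⋆[ContinuousLinearMap.lsmul ℝ ℝ, volume] U - U) x
      = ∫ t, ρ t • (U (x - t) - U x) := by
    intro x
    have hex : Integrable fun t => ρ t • U (x - t) :=
      hc.convolutionExists_left (ContinuousLinearMap.lsmul ℝ ℝ) hρ hloc x
    simp only [smul_sub]
    rw [integral_sub hex (hi.smul_const _), integral_smul_const, h1, one_smul]
    rfl
  have hmeas : AEMeasurable (fun p : Eu n × Eu n => ENNReal.ofReal (ρ p.2)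
      * ‖U (p.1 - p.2) - U p.1‖ₑ ^ 2) (volume.prod volume) := by
    refine AEMeasurable.mul ?_ (AEMeasurable.pow_const (AEStronglyMeasurable.enorm
      (AEStronglyMeasurable.sub ?_ hU.1.comp_fst)) 2)
    · exact (hρ.measurable.comp measurable_snd).ennreal_ofReal.aemeasurable
    · exact hU.1.comp_quasiMeasurePreserving
        (quasiMeasurePreserving_sub_of_right_invariant volume volume)
  have hsq : eLpNorm (ρ ⋆[ContinuousLinearMap.lsmul ℝ ℝ, volume] U - U) 2 volume ^ 2 ≤ ε ^ 2 := by
    rw [eLpNorm_two_sq]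
    calc _ ≤ ∫⁻ x, ∫⁻ t, ENNReal.ofReal (ρ t) * ‖U (x - t) - U x‖ₑ ^ 2 := by
          refine lintegral_mono fun x => ?_
          rw [hconv x]
          refine enorm_integral_smul_sq_le hρ h0 hi h1 (AEStronglyMeasurable.sub ?_
            aestronglyMeasurable_const)
          exact hU.1.comp_measurePreserving (Measure.measurePreserving_sub_left volume x)
      _ = ∫⁻ t, ∫⁻ x, ENNReal.ofReal (ρ t) * ‖U (x - t) - U x‖ₑ ^ 2 :=
          lintegral_lintegral_swap hmeas
      _ ≤ ∫⁻ t, ENNReal.ofReal (ρ t) * ε ^ 2 := by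
          refine lintegral_mono fun t => ?_
          by_cases ht : ρ t = 0
          · simp [ht]
          · change ∫⁻ x, ENNReal.ofReal (ρ t) * ‖U (x - t) - U x‖ₑ ^ 2 ≤ _
            rw [lintegral_const_mul' _ _ ENNReal.ofReal_ne_top]
            gcongr
            have h2 := eLpNorm_two_sq volume ((fun x => U (x - t)) - U)
            simp only [Pi.sub_apply] at h2
            rw [← h2]
            gcongr
            exact hε t ht
      _ = ε ^ 2 := by
          rw [lintegral_mul_const _ hρ.measurable.ennreal_ofReal,
            ← ofReal_integral_eq_lintegral_ofReal hi (Eventually.of_forall h0), h1,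
            ENNReal.ofReal_one, one_mul]
  exact (ENNReal.pow_le_pow_left_iff two_ne_zero).1 hsq

lemma pd_comp_const_sub (ρ : Eu n → ℝ) (hρ : Differentiable ℝ ρ) (i : Fin n) (x y : Eu n) :
    pd i (fun y => ρ (x - y)) y = -pd i ρ (x - y) := by
  have h := (hρ (x - y)).hasFDerivAt.comp y ((hasFDerivAt_id y).const_sub x)
  have h2 : fderiv ℝ (fun y => ρ (x - y)) y = _ := h.fderiv
  simp [pd, h2]

lemma pd_convolution {ρ : Eu n → ℝ} (hρ : IsSmoothCompact ρ) {U : Eu n → ℂ}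
    (hU : LocallyIntegrable U volume) (i : Fin n) :
    pd i (ρ ⋆[ContinuousLinearMap.lsmul ℝ ℝ, volume] U)
      = pd i ρ ⋆[ContinuousLinearMap.lsmul ℝ ℝ, volume] U := by
  funext x
  have h := hρ.2.hasFDerivAt_convolution_left (ContinuousLinearMap.lsmul ℝ ℝ)
    (hρ.1.of_le (by norm_cast)) hU x
  have hi := (hρ.2.fderiv (𝕜 := ℝ)).convolutionExists_left
    ((ContinuousLinearMap.lsmul ℝ ℝ : ℝ →L[ℝ] ℂ →L[ℝ] ℂ).precompL (Eu n))
    (hρ.1.continuous_fderiv (by simp)) hU x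
  rw [pd, h.fderiv]
  exact ContinuousLinearMap.integral_apply hi (unitVec i)

/-- At a fixed `x` the hypothesis is tested with `y ↦ ρ (x - y)`; the two signs from differentiating
in `y` cancel. -/
lemma lapl_convolution {ρ : Eu n → ℝ} (hρ : IsSmoothCompact ρ) {U F : Eu n → ℂ}
    (hU : LocallyIntegrable U volume)
    (h : ∀ φ : Eu n → ℝ, IsSmoothCompact φ → ∫ x, lapl φ x • U x = ∫ x, φ x • F x) :
    lapl (ρ ⋆[ContinuousLinearMap.lsmul ℝ ℝ, volume] U)
      = ρ ⋆[ContinuousLinearMap.lsmul ℝ ℝ, volume] F := by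
  funext x
  have hφ : IsSmoothCompact fun y => ρ (x - y) :=
    ⟨hρ.1.comp (contDiff_const.sub contDiff_id), hρ.2.comp_homeomorph (Homeomorph.subLeft x)⟩
  have h2 : ∀ i y, pd i (pd i fun y => ρ (x - y)) y = pd i (pd i ρ) (x - y) := by
    intro i y
    have : pd i (fun y => ρ (x - y)) = fun y => -pd i ρ (x - y) :=
      funext fun y => pd_comp_const_sub ρ hρ.differentiable i x y
    rw [this]
    have h3 := pd_comp_const_sub (pd i ρ) (hρ.pd i).differentiable i x y
    rw [pd] at h3 ⊢
    rw [fderiv_fun_neg, neg_apply, h3, neg_neg]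
  have h4 : ∀ g : Eu n → ℝ, ∀ V : Eu n → ℂ, (g ⋆[ContinuousLinearMap.lsmul ℝ ℝ, volume] V) x
      = ∫ y, g (x - y) • V y := fun g V => by rw [convolution_eq_swap]; rfl
  have h5 : lapl (ρ ⋆[ContinuousLinearMap.lsmul ℝ ℝ, volume] U) x
      = ∑ i, ∫ y, pd i (pd i ρ) (x - y) • U y := by
    rw [lapl, Finset.sum_apply]
    refine Finset.sum_congr rfl fun i _ => ?_
    rw [pd_convolution hρ hU, pd_convolution (hρ.pd i) hU, h4]
  rw [h5, h4, ← h _ hφ, ← integral_finsetSum]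
  · refine integral_congr_ae (Eventually.of_forall fun y => ?_)
    simp only [lapl, Finset.sum_apply, h2, Finset.sum_smul]
  · intro i _
    have hs := ((hφ.pd i).pd i)
    have h6 := hU.integrable_smul_left_of_hasCompactSupport hs.continuous hs.2
    simpa only [h2] using h6

/-- A compactly supported function in `L²(ℝⁿ)` with distributional Laplacian in `L²(ℝⁿ)` is the
limit of test functions, together with its Laplacian. -/
lemma exists_smooth_approx {U F : Eu n → ℂ} (hU : MemLp U 2 volume) (hF : MemLp F 2 volume)
    {R : ℝ} (hUR : ∀ x, x ∉ Metric.closedBall (0 : Eu n) R → U x = 0)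
    (h : ∀ φ : Eu n → ℝ, IsSmoothCompact φ → ∫ x, lapl φ x • U x = ∫ x, φ x • F x) :
    ∃ φ : ℕ → Eu n → ℂ, (∀ k, IsSmoothCompact (φ k)) ∧
      (∀ k, tsupport (φ k) ⊆ Metric.closedBall 0 (R + 1)) ∧
      ConvL2 volume φ U ∧ ConvL2 volume (fun k => lapl (φ k)) F := by
  have hr : ∀ k : ℕ, (0 : ℝ) < 1 / ((k : ℝ) + 1) := fun k => by positivity
  -- The outer radii are at most `1`, so mollification enlarges the support by at most `1`; this is
  -- the radius `R + 1` of the statement.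
  let b : ∀ k : ℕ, ContDiffBump (0 : Eu n) := fun k =>
    ⟨1 / ((k : ℝ) + 1) / 2, 1 / ((k : ℝ) + 1), by have := hr k; positivity, half_lt_self (hr k)⟩
  set ρ : ℕ → Eu n → ℝ := fun k => (b k).normed volume with hρ
  have hρs : ∀ k, IsSmoothCompact (ρ k) := fun k =>
    ⟨(b k).contDiff_normed, (b k).hasCompactSupport_normed⟩
  have hρb : ∀ k t, ρ k t ≠ 0 → ‖t‖ < 1 / ((k : ℝ) + 1) := fun k t ht => by
    have : t ∈ Function.support ((b k).normed volume) := ht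
    rw [ContDiffBump.support_normed_eq] at this
    have h1 : ‖t‖ < (b k).rOut := by simpa using this
    exact h1
  have hconv : ∀ V : Eu n → ℂ, MemLp V 2 volume →
      ConvL2 volume (fun k => ρ k ⋆[ContinuousLinearMap.lsmul ℝ ℝ, volume] V) V := by
    intro V hV
    refine ENNReal.tendsto_nhds_zero.2 fun ε hε => ?_
    have h1 := ENNReal.tendsto_nhds_zero.1 (tendsto_eLpNorm_translate hV) ε hε
    obtain ⟨δ, hδ, hb⟩ := Metric.eventually_nhds_iff.1 h1
    have h2 : Tendsto (fun k : ℕ => 1 / ((k : ℝ) + 1)) atTop (𝓝 0) :=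
      tendsto_one_div_add_atTop_nhds_zero_nat
    filter_upwards [h2.eventually_lt_const hδ] with k hk
    refine eLpNorm_convolution_sub_le (hρs k).continuous (hρs k).2 (b k).nonneg_normed
      (b k).integral_normed hV fun t ht => hb ?_
    rw [dist_zero_right]
    exact (hρb k t ht).trans hk
  have hUl : LocallyIntegrable U volume := hU.locallyIntegrable (by norm_num)
  have hsupp : ∀ k, tsupport (ρ k ⋆[ContinuousLinearMap.lsmul ℝ ℝ, volume] U)
      ⊆ Metric.closedBall 0 (R + 1) := by
    refine fun k => closure_minimal (fun x hx => ?_) Metric.isClosed_closedBall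
    by_contra hn
    refine hx (integral_eq_zero_of_ae (Eventually.of_forall fun t => ?_))
    change ρ k t • U (x - t) = 0
    by_cases ht : ρ k t = 0
    · rw [ht, zero_smul]
    · rw [hUR, smul_zero]
      have h1 := (hρb k t ht).trans_le
        ((div_le_one (by positivity)).2 (by linarith [k.cast_nonneg (α := ℝ)]))
      rw [mem_closedBall_zero_iff, not_le] at hn ⊢
      have h2 := norm_sub_norm_le x t
      linarith
  refine ⟨fun k => ρ k ⋆[ContinuousLinearMap.lsmul ℝ ℝ, volume] U, fun k =>
    ⟨(hρs k).2.contDiff_convolution_left _ (hρs k).1 hUl,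
      (isCompact_closedBall (0 : Eu n) (R + 1)).of_isClosed_subset (isClosed_tsupport _) (hsupp k)⟩,
    hsupp, hconv U hU, ?_⟩
  · simp only [fun k => lapl_convolution (hρs k) hUl h]
    exact hconv F hF

end mollify

/-! ### The divergence theorem below a graph -/

section graph

variable {m : ℕ}

/-- The point of `ℝ^{m+1}` with `i`-th coordinate `t` and remaining coordinates `y`. -/
def ins (i : Fin (m + 1)) (t : ℝ) (y : Fin m → ℝ) : Eu (m + 1) :=
  t • unitVec i + ∑ k, y k • unitVec (i.succAbove k)

lemma ins_apply_same (i : Fin (m + 1)) (t : ℝ) (y : Fin m → ℝ) : ins i t y i = t := by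
  simp [ins, (Fin.succAbove_ne i _).symm]

lemma ins_apply_succAbove (i : Fin (m + 1)) (t : ℝ) (y : Fin m → ℝ) (k : Fin m) :
    ins i t y (i.succAbove k) = y k := by
  simp [ins, Fin.succAbove_ne, Pi.single_apply]

lemma ins_eq (i : Fin (m + 1)) (t : ℝ) (y : Fin m → ℝ) :
    ins i t y = WithLp.toLp 2 (i.insertNth (α := fun _ => ℝ) t y) := by
  ext k
  rcases Fin.eq_self_or_eq_succAbove i k with rfl | ⟨j, rfl⟩
  · rw [ins_apply_same]; simp
  · rw [ins_apply_succAbove]; simp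

lemma ins_eq_add (i : Fin (m + 1)) (t : ℝ) (y : Fin m → ℝ) :
    ins i t y = ins i 0 y + t • unitVec i := by
  simp [ins, add_comm]

/-- The coordinates of `x` other than the `i`-th one. -/
def rem (i : Fin (m + 1)) (x : Eu (m + 1)) : Fin m → ℝ := fun k => x (i.succAbove k)

lemma ins_rem (i : Fin (m + 1)) (x : Eu (m + 1)) : ins i (x i) (rem i x) = x := by
  ext k
  rcases Fin.eq_self_or_eq_succAbove i k with rfl | ⟨j, rfl⟩
  · rw [ins_apply_same]
  · rw [ins_apply_succAbove]; rfl

lemma rem_ins (i : Fin (m + 1)) (t : ℝ) (y : Fin m → ℝ) : rem i (ins i t y) = y :=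
  funext fun k => ins_apply_succAbove i t y k

lemma lipschitzWith_rem (i : Fin (m + 1)) : LipschitzWith 1 (rem i) := by
  refine LipschitzWith.of_dist_le_mul fun x y => ?_
  rw [NNReal.coe_one, one_mul, dist_pi_le_iff dist_nonneg]
  intro k
  rw [dist_eq_norm, dist_eq_norm]
  exact PiLp.norm_apply_le (x - y) (i.succAbove k)

lemma measurePreserving_ins (i : Fin (m + 1)) :
    MeasurePreserving (fun p : ℝ × (Fin m → ℝ) => ins i p.1 p.2) volume volume := by
  have h := (PiLp.volume_preserving_toLp (Fin (m + 1))).comp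
    (volume_preserving_piFinSuccAbove (fun _ : Fin (m + 1) => ℝ) i).symm
  have e : (fun p : ℝ × (Fin m → ℝ) => ins i p.1 p.2) = WithLp.toLp 2 ∘
      (MeasurableEquiv.piFinSuccAbove (fun _ : Fin (m + 1) => ℝ) i).symm :=
    funext fun p => ins_eq i p.1 p.2
  rw [e]
  exact h

variable {F : Type*} [NormedAddCommGroup F] [NormedSpace ℝ F]

lemma integral_ins (i : Fin (m + 1)) {f : Eu (m + 1) → F} (hf : Integrable f) :
    ∫ x, f x = ∫ y, ∫ t, f (ins i t y) := by
  have hemb : MeasurableEmbedding (fun p : ℝ × (Fin m → ℝ) => ins i p.1 p.2) := by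
    simp only [ins_eq]
    exact ((MeasurableEquiv.piFinSuccAbove (fun _ : Fin (m + 1) => ℝ) i).symm.trans
      (MeasurableEquiv.toLp 2 _)).measurableEmbedding
  rw [← (measurePreserving_ins i).integral_comp hemb, Measure.volume_eq_prod, integral_prod_symm]
  exact ((measurePreserving_ins i).integrable_comp_emb hemb).2 hf

lemma integral_pd_eq_zero {f : Eu m → F} (hf : ContDiff ℝ 1 f) (hc : HasCompactSupport f)
    (j : Fin m) : ∫ x, pd j f x = 0 := by
  have h := integral_smul_fderiv_eq_neg_fderiv_smul_of_integrable (μ := volume) (𝕜 := ℝ)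
    (f := fun _ : Eu m => (1 : ℝ)) (g := f) (v := unitVec j) (by simp) ?_ ?_
    (fun x _ => differentiableAt_const _) (fun x _ => hf.differentiable one_ne_zero x)
  · simpa [pd] using h
  · simp only [one_smul]
    exact ((hf.continuous_fderiv one_ne_zero).clm_apply
      continuous_const).integrable_of_hasCompactSupport (hc.fderiv_apply (𝕜 := ℝ) _)
  · simp only [one_smul]
    exact hf.continuous.integrable_of_hasCompactSupport hc

/-- A `C⁴` function `γ` of the coordinates other than the `i`-th one, and an orientation `s` of
the `i`-th axis. -/
structure GraphChart (m : ℕ) where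
  /-- the vertical axis -/
  i : Fin (m + 1)
  /-- the orientation -/
  s : ℝ
  /-- the function -/
  γ : Eu (m + 1) → ℝ
  hs : s = 1 ∨ s = -1
  hγ : ContDiff ℝ 4 γ
  hinv : ∀ (x : Eu (m + 1)) (t : ℝ), γ (x + t • unitVec i) = γ x

namespace GraphChart

variable (g : GraphChart m)

/-- The region below the graph. -/
def below : Set (Eu (m + 1)) := {x | g.s * x g.i < g.γ x}

/-- The graph. -/
def surf : Set (Eu (m + 1)) := {x | g.s * x g.i = g.γ x}

/-- The same graph with the opposite orientation. -/
def flip : GraphChart m where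
  i := g.i
  s := -g.s
  γ := fun x => -g.γ x
  hs := by rcases g.hs with h | h <;> simp [h]
  hγ := g.hγ.neg
  hinv := fun x t => by rw [g.hinv]

/-- The parametrization of the graph. -/
def param (y : Fin m → ℝ) : Eu (m + 1) := ins g.i (g.s * g.γ (ins g.i 0 y)) y

/-- The push-forward of Lebesgue measure to the graph. -/
def meas : Measure (Eu (m + 1)) := Measure.map g.param volume

/-- The downward normal field `s eᵢ - ∇ γ`, not normalized. -/
def nrm (x : Eu (m + 1)) (j : Fin (m + 1)) : ℝ := g.s * (unitVec g.i : Eu (m + 1)) j - pd j g.γ x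

lemma s_mul_s : g.s * g.s = 1 := by rcases g.hs with h | h <;> simp [h]

lemma γ_ins (t : ℝ) (y : Fin m → ℝ) : g.γ (ins g.i t y) = g.γ (ins g.i 0 y) := by
  rw [ins_eq_add, g.hinv]

lemma pd_i_γ (x : Eu (m + 1)) : pd g.i g.γ x = 0 := by
  have h1 : HasDerivAt (fun t : ℝ => g.γ (x + t • unitVec g.i)) (pd g.i g.γ x) 0 :=
    ((g.hγ.differentiable (by simp) x).hasFDerivAt.hasLineDerivAt (unitVec g.i))
  simp only [g.hinv] at h1
  exact h1.unique (hasDerivAt_const _ _)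

lemma pd_γ_inv (j : Fin (m + 1)) (x : Eu (m + 1)) (t : ℝ) :
    pd j g.γ (x + t • unitVec g.i) = pd j g.γ x := by
  have h : g.γ = fun x => g.γ (x + t • unitVec g.i) := funext fun x => (g.hinv x t).symm
  conv_rhs => rw [h]
  simp only [pd]
  rw [fderiv_comp_add_right]

lemma contDiff_pd_γ (j : Fin (m + 1)) : ContDiff ℝ 3 (pd j g.γ) :=
  (g.hγ.fderiv_right (m := 3) (by norm_num)).clm_apply contDiff_const

lemma pd_i_pd_γ (j : Fin (m + 1)) (x : Eu (m + 1)) : pd g.i (pd j g.γ) x = 0 := by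
  have h1 : HasDerivAt (fun t : ℝ => pd j g.γ (x + t • unitVec g.i)) (pd g.i (pd j g.γ) x) 0 :=
    (((g.contDiff_pd_γ j).differentiable (by simp) x).hasFDerivAt.hasLineDerivAt (unitVec g.i))
  simp only [g.pd_γ_inv] at h1
  exact h1.unique (hasDerivAt_const _ _)

lemma contDiff_param : ContDiff ℝ 4 g.param := by
  unfold param ins
  have h := g.hγ
  fun_prop

lemma param_mem (y : Fin m → ℝ) : g.param y ∈ g.surf := by
  change g.s * ins _ _ _ g.i = g.γ (ins _ _ _)
  rw [ins_apply_same, ← mul_assoc, g.s_mul_s, one_mul, g.γ_ins (g.s * g.γ (ins g.i 0 y))]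

lemma param_rem {x : Eu (m + 1)} (hx : x ∈ g.surf) : g.param (rem g.i x) = x := by
  have h1 : g.γ (ins g.i 0 (rem g.i x)) = g.γ x := by
    rw [← g.γ_ins (x g.i), ins_rem]
  have h2 : g.s * x g.i = g.γ x := hx
  rw [param, h1, ← h2, ← mul_assoc, g.s_mul_s, one_mul, ins_rem]

lemma rem_param (y : Fin m → ℝ) : rem g.i (g.param y) = y := rem_ins _ _ _

lemma isOpen_below : IsOpen g.below :=
  isOpen_lt (continuous_const.mul (EuclideanSpace.proj (𝕜 := ℝ) g.i : Eu (m + 1) →L[ℝ] ℝ).continuous)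
    g.hγ.continuous

lemma isClosed_surf : IsClosed g.surf :=
  isClosed_eq (continuous_const.mul
    (EuclideanSpace.proj (𝕜 := ℝ) g.i : Eu (m + 1) →L[ℝ] ℝ).continuous) g.hγ.continuous

lemma hasCompactSupport_comp_param {E : Type*} [Zero E] {f : Eu (m + 1) → E}
    (hc : HasCompactSupport f) : HasCompactSupport fun y => f (g.param y) := by
  refine HasCompactSupport.of_support_subset_isCompact
    (hc.isCompact.image (lipschitzWith_rem g.i).continuous) fun y hy => ?_
  exact ⟨g.param y, subset_tsupport _ hy, g.rem_param y⟩

lemma integral_meas {f : Eu (m + 1) → F} (hf : Continuous f) :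
    ∫ x, f x ∂g.meas = ∫ y, f (g.param y) :=
  integral_map g.contDiff_param.continuous.aemeasurable
    hf.aestronglyMeasurable

/-- Fubini with the `i`-th variable innermost and the fundamental theorem of calculus on the
half-line below the graph. For `s = -1` the half-line is unbounded above, which produces the sign
`s`. -/
lemma integral_below_pd_i [CompleteSpace F] {f : Eu (m + 1) → F} (hf : ContDiff ℝ 1 f)
    (hc : HasCompactSupport f) :
    ∫ x in g.below, pd g.i f x = g.s • ∫ y, f (g.param y) := by
  have hi : Integrable (pd g.i f) := ((hf.continuous_fderiv one_ne_zero).clm_apply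
      continuous_const).integrable_of_hasCompactSupport (hc.fderiv_apply (𝕜 := ℝ) _)
  rw [← integral_indicator g.isOpen_below.measurableSet,
    integral_ins g.i (hi.indicator g.isOpen_below.measurableSet), ← integral_smul]
  refine integral_congr_ae (Eventually.of_forall fun y => ?_)
  set c := g.γ (ins g.i 0 y) with hcdef
  have hins : ContDiff ℝ 1 fun t => ins g.i t y := by unfold ins; fun_prop
  have hderiv : ∀ t, deriv (fun t => f (ins g.i t y)) t = pd g.i f (ins g.i t y) := by
    intro t
    have h1 : HasDerivAt (fun t => ins g.i t y) (unitVec g.i) t := by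
      unfold ins
      simpa using ((hasDerivAt_id t).smul_const (unitVec g.i : Eu (m + 1))).add_const
        (∑ k, y k • unitVec (g.i.succAbove k))
    exact ((hf.differentiable one_ne_zero _).hasFDerivAt.comp_hasDerivAt t h1).deriv
  have hfi : ContDiff ℝ 1 fun t => f (ins g.i t y) := hf.comp hins
  have hcs : HasCompactSupport fun t => f (ins g.i t y) := by
    refine HasCompactSupport.of_support_subset_isCompact (hc.isCompact.image
      (EuclideanSpace.proj (𝕜 := ℝ) g.i : Eu (m + 1) →L[ℝ] ℝ).continuous) fun t ht => ?_
    exact ⟨ins g.i t y, subset_tsupport _ ht, ins_apply_same _ _ _⟩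
  have hmem : ∀ t, ins g.i t y ∈ g.below ↔ g.s * t < c := by
    intro t
    change g.s * ins _ _ _ g.i < g.γ (ins _ _ _) ↔ _
    rw [ins_apply_same, g.γ_ins]
  have hset : ∀ t, g.below.indicator (pd g.i f) (ins g.i t y)
      = {t | g.s * t < c}.indicator (fun t => deriv (fun t => f (ins g.i t y)) t) t := by
    intro t
    by_cases h : g.s * t < c
    · rw [indicator_of_mem ((hmem t).2 h), indicator_of_mem (by exact h), hderiv]
    · rw [indicator_of_notMem (fun h' => h ((hmem t).1 h')), indicator_of_notMem (by exact h)]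
  simp only [hset]
  rcases g.hs with h | h
  · have e : {t : ℝ | g.s * t < c} = Iio c := by ext t; simp [h]
    rw [e, integral_indicator measurableSet_Iio, ← integral_Iic_eq_integral_Iio,
      hcs.integral_Iic_deriv_eq hfi, h, one_smul, param, ← hcdef, h, one_mul]
  · have e : {t : ℝ | g.s * t < c} = Ioi (-c) := by ext t; simp [h, neg_lt]
    rw [e, integral_indicator measurableSet_Ioi,
      hcs.integral_Ioi_deriv_eq hfi, h, neg_one_smul, param, ← hcdef, h, neg_one_mul]

/-- The cut-off functions which approximate the indicator function of the region below the graph. -/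
def cut (k : ℕ) (x : Eu (m + 1)) : ℝ := Real.smoothTransition (k * (g.γ x - g.s * x g.i))

lemma contDiff_cut (k : ℕ) : ContDiff ℝ 1 (g.cut k) := by
  have h1 : ContDiff ℝ 1 g.γ := g.hγ.of_le (by norm_num)
  have h2 : ContDiff ℝ 1 (fun x : Eu (m + 1) => x g.i) :=
    (EuclideanSpace.proj (𝕜 := ℝ) g.i : Eu (m + 1) →L[ℝ] ℝ).contDiff
  exact (Real.smoothTransition.contDiff (n := 1)).comp
    (contDiff_const.mul (h1.sub (contDiff_const.mul h2)))

lemma tendsto_cut (x : Eu (m + 1)) :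
    Tendsto (fun k => g.cut k x) atTop (𝓝 (g.below.indicator (fun _ => 1) x)) := by
  by_cases h : x ∈ g.below
  · rw [indicator_of_mem h]
    have h1 : 0 < g.γ x - g.s * x g.i := sub_pos.2 h
    obtain ⟨N, hN⟩ := exists_nat_gt (1 / (g.γ x - g.s * x g.i))
    refine tendsto_const_nhds.congr' ?_
    filter_upwards [eventually_ge_atTop N] with k hk
    refine (Real.smoothTransition.one_of_one_le ?_).symm
    rw [div_lt_iff₀ h1] at hN
    have : (N : ℝ) ≤ k := by exact_mod_cast hk
    nlinarith
  · rw [indicator_of_notMem h]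
    refine tendsto_const_nhds.congr fun k => ?_
    refine (Real.smoothTransition.zero_of_nonpos ?_).symm
    exact mul_nonpos_of_nonneg_of_nonpos k.cast_nonneg (sub_nonpos.2 (not_lt.1 h))

/-- The field `∂ⱼ + s (∂ⱼγ) ∂ᵢ` is tangent to the level sets of `γ - s xᵢ` when `j ≠ i`, so it
annihilates every function of that difference. -/
lemma pd_cut (k : ℕ) (j : Fin (m + 1)) (x : Eu (m + 1)) :
    pd j (g.cut k) x + g.s * pd j g.γ x * pd g.i (g.cut k) x
      = -(deriv Real.smoothTransition (k * (g.γ x - g.s * x g.i)) * k * g.s)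
        * (if j = g.i then 1 else 0) := by
  have h1 : HasFDerivAt (fun x : Eu (m + 1) => (k : ℝ) * (g.γ x - g.s * x g.i))
      ((k : ℝ) • (fderiv ℝ g.γ x - g.s • (EuclideanSpace.proj (𝕜 := ℝ) g.i :
        Eu (m + 1) →L[ℝ] ℝ))) x :=
    ((g.hγ.differentiable (by simp) x).hasFDerivAt.sub
      ((EuclideanSpace.proj (𝕜 := ℝ) g.i : Eu (m + 1) →L[ℝ] ℝ).hasFDerivAt.const_smul g.s)).const_smul
      (k : ℝ)
  have h2 := ((Real.smoothTransition.contDiff (n := 1)).differentiable (by simp)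
    (k * (g.γ x - g.s * x g.i))).hasDerivAt.comp_hasFDerivAt x h1
  have h3 : ∀ j, pd j (g.cut k) x = deriv Real.smoothTransition (k * (g.γ x - g.s * x g.i))
      * (k * (pd j g.γ x - g.s * (if j = g.i then 1 else 0))) := by
    intro j
    have h4 : fderiv ℝ (g.cut k) x = _ := h2.fderiv
    simp [pd, h4, eq_comm]
  rw [h3, h3, g.pd_i_γ, if_pos rfl]
  have := g.s_mul_s
  linear_combination (-(deriv Real.smoothTransition (k * (g.γ x - g.s * x g.i)) * k
    * pd j g.γ x)) * this

/-- Multiply by the cut-offs. Since the tangential field kills them and its coefficient does not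
depend on `xᵢ`, the integrand becomes a sum of derivatives of compactly supported functions and
integrates to zero over the whole space. Dominated convergence then replaces the cut-offs by the
indicator function. This avoids straightening the graph by a change of variables. -/
lemma integral_below_tangential {f : Eu (m + 1) → F} (hf : ContDiff ℝ 1 f)
    (hc : HasCompactSupport f) {j : Fin (m + 1)} (hj : j ≠ g.i) :
    ∫ x in g.below, (pd j f x + (g.s * pd j g.γ x) • pd g.i f x) = 0 := by
  set T : Eu (m + 1) → F := fun x => pd j f x + (g.s * pd j g.γ x) • pd g.i f x with hT
  have hpc : ∀ i, Continuous (pd i f) := fun i =>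
    (hf.continuous_fderiv one_ne_zero).clm_apply continuous_const
  have hps : ∀ i, HasCompactSupport (pd i f) := fun i => hc.fderiv_apply (𝕜 := ℝ) _
  have hγc : Continuous fun x => g.s * pd j g.γ x := continuous_const.mul (g.contDiff_pd_γ j).continuous
  have hTi : Integrable T := ((hpc j).integrable_of_hasCompactSupport (hps j)).add
    ((hγc.smul (hpc g.i)).integrable_of_hasCompactSupport (hps g.i).smul_left)
  have hk : ∀ k, ∫ x, g.cut k x • T x = 0 := by
    intro k
    have hcd := g.contDiff_cut k
    have hg1 : ContDiff ℝ 1 fun x => g.cut k x • f x := hcd.smul hf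
    have hγ1 : ContDiff ℝ 1 fun x => g.s * pd j g.γ x :=
      contDiff_const.mul ((g.contDiff_pd_γ j).of_le (by norm_num))
    have hg2 : ContDiff ℝ 1 fun x => (g.s * pd j g.γ x) • (g.cut k x • f x) := hγ1.smul hg1
    have hs1 : HasCompactSupport fun x => g.cut k x • f x := hc.smul_left (f := g.cut k)
    have hs2 : HasCompactSupport fun x => (g.s * pd j g.γ x) • (g.cut k x • f x) :=
      hs1.smul_left (f := fun x => g.s * pd j g.γ x)
    have hpt : ∀ x, g.cut k x • T x = pd j (fun x => g.cut k x • f x) x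
        + pd g.i (fun x => (g.s * pd j g.γ x) • (g.cut k x • f x)) x := by
      intro x
      have e0 : pd g.i (fun x => g.s * pd j g.γ x) x = 0 := by
        have := g.pd_i_pd_γ j x
        rw [pd] at this ⊢
        rw [fderiv_const_mul ((g.contDiff_pd_γ j).differentiable (by simp) x)]
        simp [this]
      rw [pd_smul (hg1.differentiable one_ne_zero) (hγ1.differentiable one_ne_zero), e0, zero_smul,
        zero_add, pd_smul (hf.differentiable one_ne_zero) (hcd.differentiable one_ne_zero),
        pd_smul (hf.differentiable one_ne_zero) (hcd.differentiable one_ne_zero)]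
      have e1 := g.pd_cut k j x
      rw [if_neg hj, mul_zero] at e1
      rw [eq_neg_of_add_eq_zero_left e1]
      simp only [hT, smul_add, smul_smul, neg_smul]
      rw [mul_comm (g.cut k x)]
      abel
    have hint : ∀ {u : Eu (m + 1) → F} (i), ContDiff ℝ 1 u → HasCompactSupport u →
        Integrable (pd i u) := fun i hu hs =>
      ((hu.continuous_fderiv one_ne_zero).clm_apply continuous_const).integrable_of_hasCompactSupport
        (hs.fderiv_apply (𝕜 := ℝ) _)
    simp only [hpt]
    rw [integral_add (hint j hg1 hs1) (hint g.i hg2 hs2), integral_pd_eq_zero hg1 hs1,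
      integral_pd_eq_zero hg2 hs2, add_zero]
  have hlim : Tendsto (fun k => ∫ x, g.cut k x • T x) atTop
      (𝓝 (∫ x, g.below.indicator (fun _ => (1 : ℝ)) x • T x)) := by
    refine tendsto_integral_of_dominated_convergence (fun x => ‖T x‖) (fun k => ?_) hTi.norm
      (fun k => Eventually.of_forall fun x => ?_)
      (Eventually.of_forall fun x => (g.tendsto_cut x).smul_const _)
    · exact (g.contDiff_cut k).continuous.aestronglyMeasurable.smul hTi.1
    · rw [norm_smul, cut, Real.norm_of_nonneg (Real.smoothTransition.nonneg _)]
      exact mul_le_of_le_one_left (norm_nonneg _) (Real.smoothTransition.le_one _)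
  simp only [hk] at hlim
  have h0 := tendsto_nhds_unique tendsto_const_nhds hlim
  rw [← integral_indicator g.isOpen_below.measurableSet, h0]
  refine integral_congr_ae (Eventually.of_forall fun x => ?_)
  by_cases hx : x ∈ g.below <;> simp [hx, hT]

/-- The divergence theorem in the region below a graph. -/
lemma integral_below_pd [CompleteSpace F] {f : Eu (m + 1) → F} (hf : ContDiff ℝ 1 f)
    (hc : HasCompactSupport f) (j : Fin (m + 1)) :
    ∫ x in g.below, pd j f x = ∫ y, g.nrm (g.param y) j • f (g.param y) := by
  rcases eq_or_ne j g.i with rfl | hj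
  · rw [g.integral_below_pd_i hf hc, ← integral_smul]
    simp [nrm, g.pd_i_γ]
  · have hγ1 : ContDiff ℝ 1 fun x => g.s * pd j g.γ x :=
      contDiff_const.mul ((g.contDiff_pd_γ j).of_le (by norm_num))
    have hpc : ∀ i, Continuous (pd i f) := fun i =>
      (hf.continuous_fderiv one_ne_zero).clm_apply continuous_const
    have hps : ∀ i, HasCompactSupport (pd i f) := fun i => hc.fderiv_apply (𝕜 := ℝ) _
    have h1 := g.integral_below_tangential hf hc hj
    have hi2 : Integrable fun x => (g.s * pd j g.γ x) • pd g.i f x :=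
      (hγ1.continuous.smul (hpc g.i)).integrable_of_hasCompactSupport (hps g.i).smul_left
    rw [integral_add ((hpc j).integrable_of_hasCompactSupport (hps j)).integrableOn
      hi2.integrableOn] at h1
    -- The tangential identity trades `∂ⱼ f` for `-∂ᵢ` of `s (∂ⱼγ) f`, whose integral is already
    -- known from the vertical case.
    have hγf : ContDiff ℝ 1 fun x => (g.s * pd j g.γ x) • f x := hγ1.smul hf
    have h2 := g.integral_below_pd_i hγf (hc.smul_left (f := fun x => g.s * pd j g.γ x))
    have h3 : ∀ x, pd g.i (fun x => (g.s * pd j g.γ x) • f x) x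
        = (g.s * pd j g.γ x) • pd g.i f x := by
      intro x
      have e0 : pd g.i (fun x => g.s * pd j g.γ x) x = 0 := by
        have := g.pd_i_pd_γ j x
        rw [pd] at this ⊢
        rw [fderiv_const_mul ((g.contDiff_pd_γ j).differentiable (by simp) x)]
        simp [this]
      rw [pd_smul (hf.differentiable one_ne_zero) (hγ1.differentiable one_ne_zero), e0, zero_smul,
        zero_add]
    simp only [h3] at h2
    rw [h2] at h1
    rw [eq_neg_of_add_eq_zero_left h1, ← integral_smul, ← integral_neg]
    refine integral_congr_ae (Eventually.of_forall fun y => ?_)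
    have := g.s_mul_s
    simp [nrm, smul_smul, ← mul_assoc, this, hj]

end GraphChart

end graph

/-! ### Graph measures, charts and outer normals. -/

section graph

variable {m : ℕ}

namespace GraphChart

variable (g : GraphChart m)

/-- Dropping the `i`-th coordinate is `1`-Lipschitz and inverts the parametrization, and Lebesgue
measure on `Fin m → ℝ` is `m`-dimensional Hausdorff measure. Together with the local reverse bound
below, this comparison suffices; the area formula is not needed. -/
lemma meas_le_hausdorff {A : Set (Eu (m + 1))} (hA : MeasurableSet A) :
    g.meas A ≤ Measure.hausdorffMeasure (m : ℝ) (A ∩ g.surf) := by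
  rw [meas, Measure.map_apply g.contDiff_param.continuous.measurable hA]
  have h1 : g.param ⁻¹' A ⊆ rem g.i '' (A ∩ g.surf) := fun y hy =>
    ⟨g.param y, ⟨hy, g.param_mem y⟩, g.rem_param y⟩
  have h2 := (lipschitzWith_rem g.i).hausdorffMeasure_image_le (Nat.cast_nonneg m) (A ∩ g.surf)
  rw [ENNReal.coe_one, ENNReal.one_rpow, one_mul] at h2
  refine (le_trans ?_ h2)
  have h3 : (volume : Measure (Fin m → ℝ)) = Measure.hausdorffMeasure (m : ℝ) := by
    rw [← hausdorffMeasure_pi_real, Fintype.card_fin]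
  rw [h3]
  exact measure_mono h1

/-- The parametrization is locally Lipschitz, say with constant `K`, and so increases
`m`-dimensional Hausdorff measure by at most the factor `K ^ m`. -/
lemma hausdorff_le_meas (x₀ : Eu (m + 1)) : ∃ r > 0, ∃ K : ℝ≥0,
    ∀ A : Set (Eu (m + 1)), MeasurableSet A → A ⊆ Metric.ball x₀ r → A ⊆ g.surf →
      Measure.hausdorffMeasure (m : ℝ) A ≤ K * g.meas A := by
  obtain ⟨K, t, ht, hK⟩ := ((g.contDiff_param.of_le
    (by norm_num : (1 : WithTop ℕ∞) ≤ 4)).contDiffAt (x := rem g.i x₀)).exists_lipschitzOnWith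
  obtain ⟨r, hr, hrt⟩ := Metric.mem_nhds_iff.1 ht
  refine ⟨r, hr, K ^ m, fun A hA hAr hAs => ?_⟩
  have h1 : A ⊆ g.param '' (g.param ⁻¹' A ∩ t) := fun x hx => by
    refine ⟨rem g.i x, ⟨?_, hrt ?_⟩, g.param_rem (hAs hx)⟩
    · rw [mem_preimage, g.param_rem (hAs hx)]
      exact hx
    · refine ((lipschitzWith_rem g.i).dist_le_mul x x₀).trans_lt ?_
      rw [NNReal.coe_one, one_mul]
      exact hAr hx
  have h3 : (volume : Measure (Fin m → ℝ)) = Measure.hausdorffMeasure (m : ℝ) := by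
    rw [← hausdorffMeasure_pi_real, Fintype.card_fin]
  rw [meas, Measure.map_apply g.contDiff_param.continuous.measurable hA, h3]
  refine (measure_mono h1).trans (((hK.mono inter_subset_right).hausdorffMeasure_image_le
    (Nat.cast_nonneg m)).trans ?_)
  rw [ENNReal.rpow_natCast, ENNReal.coe_pow]
  gcongr
  exact inter_subset_left

lemma mem_flip_below {x : Eu (m + 1)} : x ∈ g.flip.below ↔ g.γ x < g.s * x g.i := by
  change -g.s * x g.i < -g.γ x ↔ _
  rw [neg_mul, neg_lt_neg_iff]

lemma flip_param : g.flip.param = g.param := by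
  funext y
  change ins g.i (-g.s * -g.γ (ins g.i 0 y)) y = _
  rw [neg_mul_neg]
  rfl

lemma flip_meas : g.flip.meas = g.meas := by rw [meas, flip_param]; rfl

lemma flip_nrm (x : Eu (m + 1)) (j : Fin (m + 1)) : g.flip.nrm x j = -g.nrm x j := by
  have : pd j (fun x => -g.γ x) x = -pd j g.γ x := by simp [pd, fderiv_fun_neg]
  change -g.s * (unitVec g.i : Eu (m + 1)) j - pd j (fun x => -g.γ x) x = _
  rw [this, nrm]
  ring

/-- The point of height `t` above `x`. -/
lemma shift_height (x : Eu (m + 1)) (t : ℝ) :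
    g.s * (x + (g.s * t) • unitVec g.i : Eu (m + 1)) g.i = g.s * x g.i + t ∧
      g.γ (x + (g.s * t) • unitVec g.i) = g.γ x := by
  refine ⟨?_, g.hinv _ _⟩
  have := g.s_mul_s
  simp only [PiLp.add_apply, PiLp.smul_apply, PiLp.single_apply, if_true, smul_eq_mul,
    mul_one, mul_add, ← mul_assoc, this, one_mul]

lemma surf_subset_closure_below : g.surf ⊆ closure g.below := by
  intro x hx
  have hx' : g.s * x g.i = g.γ x := hx
  have h1 : Tendsto (fun t : ℝ => x + (g.s * t) • (unitVec g.i : Eu (m + 1))) (𝓝[<] 0) (𝓝 x) := by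
    have : Continuous fun t : ℝ => x + (g.s * t) • (unitVec g.i : Eu (m + 1)) := by fun_prop
    exact (this.tendsto' 0 x (by simp)).mono_left nhdsWithin_le_nhds
  refine mem_closure_of_tendsto h1 ?_
  filter_upwards [self_mem_nhdsWithin] with t ht
  obtain ⟨e1, e2⟩ := g.shift_height x t
  change g.s * _ < g.γ _
  rw [e1, e2, hx']
  have : t < 0 := ht
  linarith

lemma closure_below : closure g.below ⊆ {x | g.s * x g.i ≤ g.γ x} :=
  closure_minimal (fun x (hx : g.s * x g.i < g.γ x) => hx.le) (isClosed_le (continuous_const.mul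
    (EuclideanSpace.proj (𝕜 := ℝ) g.i : Eu (m + 1) →L[ℝ] ℝ).continuous) g.hγ.continuous)

/-- `G` lies below the graph `g` inside the ball. -/
def IsChart (G : Set (Eu (m + 1))) (x₀ : Eu (m + 1)) (r : ℝ) : Prop :=
  ∀ x ∈ Metric.ball x₀ r, x ∈ G ↔ x ∈ g.below

variable {g} {G : Set (Eu (m + 1))} {x₀ : Eu (m + 1)} {r : ℝ}

lemma IsChart.mono (h : g.IsChart G x₀ r) {r' : ℝ} (hr : r' ≤ r) : g.IsChart G x₀ r' :=
  fun x hx => h x (Metric.ball_subset_ball hr hx)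

lemma IsChart.mem_closure_iff (h : g.IsChart G x₀ r) {x : Eu (m + 1)}
    (hx : x ∈ Metric.ball x₀ r) : x ∈ closure G ↔ x ∈ closure g.below := by
  have hn : Metric.ball x₀ r ∈ 𝓝 x := Metric.isOpen_ball.mem_nhds hx
  rw [mem_closure_iff_frequently, mem_closure_iff_frequently]
  refine frequently_congr ?_
  filter_upwards [hn] with y hy using h y hy

lemma IsChart.mem_closure_iff_le (h : g.IsChart G x₀ r) {x : Eu (m + 1)}
    (hx : x ∈ Metric.ball x₀ r) : x ∈ closure G ↔ g.s * x g.i ≤ g.γ x := by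
  rw [h.mem_closure_iff hx]
  refine ⟨fun h' => g.closure_below h', fun h' => ?_⟩
  rcases lt_or_eq_of_le h' with h1 | h1
  · exact subset_closure h1
  · exact g.surf_subset_closure_below h1

/-- The exterior is again below a graph, the flipped one. Every statement about regions below graphs
thus becomes available on both sides of a boundary. -/
lemma IsChart.compl_closure (h : g.IsChart G x₀ r) : g.flip.IsChart (closure G)ᶜ x₀ r := by
  intro x hx
  rw [mem_compl_iff, h.mem_closure_iff_le hx, g.mem_flip_below, not_le]

lemma IsChart.mem_frontier_iff (h : g.IsChart G x₀ r) (hG : IsOpen G) {x : Eu (m + 1)}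
    (hx : x ∈ Metric.ball x₀ r) : x ∈ frontier G ↔ x ∈ g.surf := by
  rw [hG.frontier_eq, Set.mem_sdiff, h.mem_closure_iff_le hx, h x hx]
  change _ ∧ ¬ (g.s * x g.i < g.γ x) ↔ g.s * x g.i = g.γ x
  rw [not_lt]
  exact ⟨fun h' => le_antisymm h'.1 h'.2, fun h' => ⟨h'.le, h'.ge⟩⟩

lemma exists_isChart (hG : HasCkBoundary 4 G) (hx : x₀ ∈ frontier G) :
    ∃ (g : GraphChart m) (r : ℝ), 0 < r ∧ g.IsChart G x₀ r := by
  obtain ⟨r, hr, i, s, γ, hs, hγ, hinv, h⟩ := hG x₀ hx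
  exact ⟨⟨i, s, γ, hs, hγ, hinv⟩, r, hr, h⟩

end GraphChart

/-- Two different unit normals would make `w = ν' - ν` point inward for `ν` and outward for `ν'`.
For small `t > 0` the point `x + t w` then contradicts `ν'` if it lies in `G`, and `ν` if it does
not. -/
lemma IsOuterUnitNormal.unique {n : ℕ} {G : Set (Eu n)} {x ν ν' : Eu n}
    (h : IsOuterUnitNormal G x ν) (h' : IsOuterUnitNormal G x ν') : ν = ν' := by
  by_contra hne
  have hinner : inner ℝ ν' ν < 1 := by
    refine lt_of_le_of_ne ?_ fun h1 => hne ?_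
    · have := real_inner_le_norm ν' ν
      rwa [h.1, h'.1, one_mul] at this
    · exact ((inner_eq_one_iff_of_norm_eq_one h'.1 h.1).1 h1).symm
  set w := ν' - ν with hw
  have hw1 : inner ℝ w ν < 0 := by
    rw [hw, inner_sub_left, real_inner_self_eq_norm_sq, h.1]; linarith
  have hw2 : 0 < inner ℝ w ν' := by
    rw [hw, inner_sub_left, real_inner_self_eq_norm_sq, h'.1, real_inner_comm]; linarith
  have hwn : 0 < ‖w‖ := norm_pos_iff.2 (sub_ne_zero.2 (Ne.symm hne))
  have htend : Tendsto (fun t : ℝ => x + t • w) (𝓝[>] 0) (𝓝 x) := by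
    have : Continuous fun t : ℝ => x + t • w := by fun_prop
    exact (this.tendsto' 0 x (by simp)).mono_left nhdsWithin_le_nhds
  obtain ⟨t, ⟨⟨-, h1⟩, ⟨h2, -⟩⟩, ht⟩ := ((htend.eventually (h.2 (-inner ℝ w ν / (2 * ‖w‖))
    (by have := neg_pos.2 hw1; positivity))).and (htend.eventually
    (h'.2 (inner ℝ w ν' / (2 * ‖w‖)) (by positivity)))).and self_mem_nhdsWithin |>.exists
  have ht' : 0 < t := ht
  have e1 : ‖t • w‖ = t * ‖w‖ := by rw [norm_smul, Real.norm_of_nonneg ht'.le]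
  have e3 : ∀ a : ℝ, a / (2 * ‖w‖) * (t * ‖w‖) = a * t / 2 := fun a => by field_simp
  simp only [add_sub_cancel_left, e1, inner_smul_left, e3] at h1 h2
  by_cases hG : x + t • w ∈ G
  · have h3 := h2 hG
    simp at h3
    nlinarith [mul_pos ht' hw2]
  · have h3 := h1 hG
    simp at h3
    nlinarith [mul_pos ht' (neg_pos.2 hw1)]

lemma IsOuterUnitNormal.outerNormal_eq {n : ℕ} {G : Set (Eu n)} {x ν : Eu n}
    (h : IsOuterUnitNormal G x ν) : outerNormal G x = ν := by
  have h' : ∃ ν, IsOuterUnitNormal G x ν := ⟨ν, h⟩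
  rw [outerNormal, dif_pos h']
  exact h'.choose_spec.unique h

namespace GraphChart

variable {g : GraphChart m} {G : Set (Eu (m + 1))} {x₀ : Eu (m + 1)} {r : ℝ}

/-- The field `nrm` is the gradient of `s xᵢ - γ`, a defining function of `G`; it is nonzero because
its `i`-th component is `s`. Normalized, it is the outer normal, so `c` is its length. Only
proportionality is used later, because equality and vanishing of normal derivatives are unaffected
by the factor. -/
lemma IsChart.exists_nrm_eq (h : g.IsChart G x₀ r) {x : Eu (m + 1)}
    (hx : x ∈ Metric.ball x₀ r) (hxs : x ∈ g.surf) :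
    ∃ c : ℝ, ∀ j, g.nrm x j = c * outerNormal G x j := by
  set V : Eu (m + 1) := WithLp.toLp 2 (g.nrm x) with hV
  have hVi : V g.i = g.s := by
    simp [hV, nrm, g.pd_i_γ]
  have hV0 : 0 < ‖V‖ := by
    rw [norm_pos_iff]
    intro h0
    rw [h0] at hVi
    have := g.s_mul_s
    simp [← hVi] at this
  have hder : HasFDerivAt (fun y : Eu (m + 1) => g.s * y g.i - g.γ y) (innerSL ℝ V) x := by
    have h1 := ((EuclideanSpace.proj (𝕜 := ℝ) g.i : Eu (m + 1) →L[ℝ] ℝ).hasFDerivAt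
      (x := x)).const_smul g.s |>.sub (g.hγ.differentiable (by simp) x).hasFDerivAt
    refine h1.congr_fderiv ?_
    refine ContinuousLinearMap.coe_injective ((EuclideanSpace.basisFun (Fin (m + 1)) ℝ).toBasis.ext
      fun j => ?_)
    simp [hV, nrm, pd, EuclideanSpace.inner_single_right, eq_comm]
  have hnorm : IsOuterUnitNormal G x (‖V‖⁻¹ • V) := by
    refine ⟨by rw [norm_smul, norm_inv, norm_norm, inv_mul_cancel₀ hV0.ne'], fun ε hε => ?_⟩
    have h1 := (hasFDerivAt_iff_isLittleO.1 hder).def (c := ε * ‖V‖) (by positivity)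
    filter_upwards [h1, Metric.isOpen_ball.mem_nhds hx] with y hy hyb
    have hx0 : g.s * x g.i - g.γ x = 0 := sub_eq_zero.2 hxs
    rw [hx0, sub_zero, innerSL_apply_apply, Real.norm_eq_abs, abs_le] at hy
    have e : inner ℝ (y - x) (‖V‖⁻¹ • V) = ‖V‖⁻¹ * inner ℝ V (y - x) := by
      rw [inner_smul_right, real_inner_comm]
    rw [e, inv_mul_le_iff₀ hV0, h y hyb]
    constructor
    · intro hyG
      have hyG' : g.s * y g.i < g.γ y := hyG
      linarith [hy.1]
    · intro hyG
      have hyG' : ¬ g.s * y g.i < g.γ y := hyG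
      rw [inv_mul_eq_div, le_div_iff₀ hV0]
      linarith [hy.2]
  refine ⟨‖V‖, fun j => ?_⟩
  rw [hnorm.outerNormal_eq, PiLp.smul_apply, smul_eq_mul, mul_inv_cancel_left₀ hV0.ne']

end GraphChart

end graph

/-! ### The trace inequality -/

section traceInequality

variable {m : ℕ}

lemma surfaceMeasure_succ (G : Set (Eu (m + 1))) :
    surfaceMeasure G = (Measure.hausdorffMeasure (m : ℝ)).restrict (frontier G) := by
  rw [surfaceMeasure]
  congr 2
  push_cast
  ring

/-- The square of the norm of `H¹(S)`. -/
def h1sq {n : ℕ} (S : Set (Eu n)) (φ : Eu n → ℂ) : ℝ≥0∞ :=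
  (∫⁻ x in S, ‖φ x‖ₑ ^ 2) + ∑ i, ∫⁻ x in S, ‖pd i φ x‖ₑ ^ 2

namespace GraphChart

variable {g : GraphChart m} {G : Set (Eu (m + 1))} {x₀ : Eu (m + 1)} {r : ℝ}

/-- This transfers `L²` limits and almost-everywhere statements from surface measure to the graph
measure, where the divergence theorem is available. -/
lemma IsChart.meas_restrict_le (h : g.IsChart G x₀ r) (hG : IsOpen G) :
    g.meas.restrict (Metric.ball x₀ r) ≤ surfaceMeasure G := by
  rw [surfaceMeasure_succ, Measure.le_iff]
  intro A hA
  rw [Measure.restrict_apply hA, Measure.restrict_apply hA]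
  refine (g.meas_le_hausdorff (hA.inter measurableSet_ball)).trans (measure_mono ?_)
  rintro x ⟨⟨hxA, hxb⟩, hxs⟩
  exact ⟨hxA, (h.mem_frontier_iff hG hxb).2 hxs⟩

lemma IsChart.hausdorff_restrict_le (h : g.IsChart G x₀ r) (hr : 0 < r) (hG : IsOpen G) :
    ∃ r' > 0, r' ≤ r ∧ ∃ K : ℝ≥0, (Measure.hausdorffMeasure (m : ℝ)).restrict
      (Metric.ball x₀ r' ∩ frontier G) ≤ (K : ℝ≥0∞) • g.meas := by
  obtain ⟨r₁, hr₁, K, hK⟩ := g.hausdorff_le_meas x₀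
  refine ⟨min r r₁, lt_min hr hr₁, min_le_left _ _, K, ?_⟩
  rw [Measure.le_iff]
  intro A hA
  have hm : MeasurableSet (A ∩ (Metric.ball x₀ (min r r₁) ∩ frontier G)) :=
    hA.inter (measurableSet_ball.inter isClosed_frontier.measurableSet)
  rw [Measure.restrict_apply hA, Measure.smul_apply, smul_eq_mul]
  refine (hK _ hm ?_ ?_).trans (by gcongr; exact inter_subset_left)
  · exact fun x hx => Metric.ball_subset_ball (min_le_right _ _) hx.2.1
  · exact fun x hx => (h.mem_frontier_iff hG
      (Metric.ball_subset_ball (min_le_left _ _) hx.2.1)).1 hx.2.2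

/-- Apply the vertical divergence theorem to `ζ |φ|²`, with `ζ` a cut-off, in the region below the
flipped graph. The exterior side is chosen so that a sequence tending to zero in `H¹` outside `G` is
seen to have vanishing trace. -/
lemma IsChart.exists_trace_local (h : g.IsChart G x₀ r) (hr : 0 < r) (hG : IsOpen G) :
    ∃ r' > 0, ∃ C : ℝ≥0, ∀ φ : Eu (m + 1) → ℂ, IsSmoothCompact φ →
      ∫⁻ x in Metric.ball x₀ r' ∩ frontier G, ‖φ x‖ₑ ^ 2 ∂(Measure.hausdorffMeasure (m : ℝ))
        ≤ C * h1sq (closure G)ᶜ φ := by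
  obtain ⟨r₁, hr₁, hr₁r, K, hK⟩ := h.hausdorff_restrict_le hr hG
  -- The cut-off is `1` where the trace is estimated, and its closed support stays inside the chart
  -- ball.
  let ζ : ContDiffBump x₀ := ⟨r₁ / 2, 3 * r₁ / 4, by positivity, by linarith⟩
  have hζd : Differentiable ℝ ζ := ζ.contDiff.differentiable (n := 1) one_ne_zero
  have hζc : Continuous (pd g.i ζ) :=
    (ζ.contDiff.continuous_fderiv (n := 1) one_ne_zero).clm_apply continuous_const
  have hζs : HasCompactSupport (pd g.i ζ) := ζ.hasCompactSupport.fderiv_apply (𝕜 := ℝ) _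
  obtain ⟨M, hM⟩ := hζc.norm.bddAbove_range_of_hasCompactSupport hζs.norm
  have hM' : ∀ x, |pd g.i ζ x| ≤ M := fun x => hM ⟨x, rfl⟩
  have hM0 : 0 ≤ M := (abs_nonneg _).trans (hM' x₀)
  refine ⟨r₁ / 2, by positivity, K * (M + 1).toNNReal, fun φ hφ => ?_⟩
  set ψ : Eu (m + 1) → ℝ := fun x => ζ x • ‖φ x‖ ^ 2 with hψ
  have hn : ContDiff ℝ 1 fun x => ‖φ x‖ ^ 2 := (hφ.1.of_le (by norm_cast)).norm_sq ℝ
  have hψd : ContDiff ℝ 1 ψ := ζ.contDiff.smul hn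
  have hψc : HasCompactSupport ψ := ζ.hasCompactSupport.smul_right
  have hψ0 : ∀ x, 0 ≤ ψ x := fun x => mul_nonneg ζ.nonneg (sq_nonneg _)
  -- By the product rule the derivative is at most `M |φ|² + 2 |φ| |∂ᵢφ|`, and the last term is at
  -- most `|φ|² + |∂ᵢφ|²`.
  have hpd : ∀ x, |pd g.i ψ x| ≤ (M + 1) * (‖φ x‖ ^ 2 + ‖pd g.i φ x‖ ^ 2) := by
    intro x
    have e1 : pd g.i (fun x => ‖φ x‖ ^ 2) x = 2 * inner ℝ (φ x) (pd g.i φ x) := by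
      have h1 := (hφ.differentiable x).hasFDerivAt.norm_sq
      rw [pd, h1.fderiv]
      change (2 • ((innerSL ℝ) (φ x)).comp (fderiv ℝ φ x)) (unitVec g.i) = _
      rw [two_smul, two_mul]
      rfl
    rw [hψ, pd_smul (hn.differentiable one_ne_zero) hζd, e1, smul_eq_mul, smul_eq_mul]
    have e2 := abs_real_inner_le_norm (φ x) (pd g.i φ x)
    have e3 := hM' x
    have e4 : |ζ x| ≤ 1 := by rw [abs_of_nonneg ζ.nonneg]; exact ζ.le_one
    have e5 : |pd g.i ζ x * ‖φ x‖ ^ 2| ≤ M * ‖φ x‖ ^ 2 := by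
      rw [abs_mul, abs_of_nonneg (sq_nonneg ‖φ x‖)]; gcongr
    have e6 : |ζ x * (2 * inner ℝ (φ x) (pd g.i φ x))| ≤ 1 * (2 * (‖φ x‖ * ‖pd g.i φ x‖)) := by
      rw [abs_mul, abs_mul, abs_two]; gcongr
    refine (abs_add_le _ _).trans ?_
    nlinarith [sq_nonneg (‖φ x‖ - ‖pd g.i φ x‖), mul_nonneg hM0 (sq_nonneg ‖pd g.i φ x‖)]
  have hsub : ∀ x ∈ g.flip.below, pd g.i ψ x ≠ 0 → x ∈ (closure G)ᶜ := by
    intro x hx hne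
    have h1 : x ∈ tsupport ψ := tsupport_pd_subset g.i ψ (subset_tsupport _ hne)
    have h2 : x ∈ tsupport ζ := tsupport_smul_subset_left _ _ h1
    rw [ζ.tsupport_eq] at h2
    refine (h.compl_closure x (Metric.mem_ball.2 ((Metric.mem_closedBall.1 h2).trans_lt ?_))).2 hx
    change 3 * r₁ / 4 < r
    linarith
  have hdiv := g.flip.integral_below_pd_i hψd hψc
  have hparam : ENNReal.ofReal (∫ y, ψ (g.param y))
      ≤ ∫⁻ x in (closure G)ᶜ, ‖pd g.i ψ x‖ₑ := by
    have e1 : ‖∫ x in g.flip.below, pd g.i ψ x‖ₑ = ENNReal.ofReal (∫ y, ψ (g.param y)) := by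
      have e2 : |g.flip.s| = 1 := by rcases g.flip.hs with h | h <;> simp [h]
      have e3 : ∫ x in g.flip.below, pd g.i ψ x = _ := hdiv
      rw [e3, flip_param, smul_eq_mul, Real.enorm_eq_ofReal_abs, abs_mul, e2, one_mul,
        abs_of_nonneg (integral_nonneg fun y => hψ0 _)]
    rw [← e1]
    refine (enorm_integral_le_lintegral_enorm _).trans ?_
    rw [← lintegral_indicator g.flip.isOpen_below.measurableSet,
      ← lintegral_indicator isClosed_closure.measurableSet.compl]
    refine lintegral_mono fun x => ?_
    by_cases hx : x ∈ g.flip.below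
    · rw [indicator_of_mem hx]
      by_cases h0 : pd g.i ψ x = 0
      · simp [h0]
      · rw [indicator_of_mem (hsub x hx h0)]
    · rw [indicator_of_notMem hx]; exact zero_le
  have hleft : ∫⁻ x in Metric.ball x₀ (r₁ / 2) ∩ frontier G, ‖φ x‖ₑ ^ 2
      ∂(Measure.hausdorffMeasure (m : ℝ)) ≤ K * ENNReal.ofReal (∫ y, ψ (g.param y)) := by
    have hint : Integrable fun y => ψ (g.param y) :=
      (hψd.continuous.comp g.contDiff_param.continuous).integrable_of_hasCompactSupport
        (g.hasCompactSupport_comp_param hψc)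
    rw [ofReal_integral_eq_lintegral_ofReal hint (Eventually.of_forall fun y => hψ0 _),
      ← lintegral_map (f := fun x => ENNReal.ofReal (ψ x)) hψd.continuous.measurable.ennreal_ofReal
        g.contDiff_param.continuous.measurable]
    have e1 : ∫⁻ x in Metric.ball x₀ (r₁ / 2) ∩ frontier G, ‖φ x‖ₑ ^ 2
        ∂(Measure.hausdorffMeasure (m : ℝ)) ≤ ∫⁻ x in Metric.ball x₀ (r₁ / 2) ∩ frontier G,
        ENNReal.ofReal (ψ x) ∂(Measure.hausdorffMeasure (m : ℝ)) := by
      refine setLIntegral_mono' (measurableSet_ball.inter isClosed_frontier.measurableSet)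
        fun x hx => ?_
      have e2 : ζ x = 1 := ζ.one_of_mem_closedBall (Metric.ball_subset_closedBall hx.1)
      simp only [hψ, e2, one_smul]
      rw [ENNReal.ofReal_pow (norm_nonneg _), ofReal_norm]
    refine e1.trans ((lintegral_mono' ((Measure.restrict_mono (inter_subset_inter_left _
      (Metric.ball_subset_ball (by linarith))) le_rfl).trans hK) le_rfl).trans_eq ?_)
    rw [lintegral_smul_measure]
    rfl
  refine hleft.trans ?_
  rw [ENNReal.coe_mul, mul_assoc]
  gcongr
  refine hparam.trans ?_
  have e1 : ∀ x, ‖pd g.i ψ x‖ₑ ≤ ENNReal.ofReal (M + 1) * (‖φ x‖ₑ ^ 2 + ‖pd g.i φ x‖ₑ ^ 2) := by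
    intro x
    rw [Real.enorm_eq_ofReal_abs]
    refine (ENNReal.ofReal_le_ofReal (hpd x)).trans_eq ?_
    rw [ENNReal.ofReal_mul (by positivity), ENNReal.ofReal_add (sq_nonneg _) (sq_nonneg _),
      ENNReal.ofReal_pow (norm_nonneg _), ENNReal.ofReal_pow (norm_nonneg _), ofReal_norm,
      ofReal_norm]
  change _ ≤ ENNReal.ofReal (M + 1) * _
  refine (lintegral_mono e1).trans ?_
  rw [lintegral_const_mul' _ _ ENNReal.ofReal_ne_top, lintegral_add_left]
  · rw [h1sq]
    gcongr
    exact Finset.single_le_sum (f := fun i => ∫⁻ x in (closure G)ᶜ, ‖pd i φ x‖ₑ ^ 2)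
      (fun i _ => zero_le) (Finset.mem_univ g.i)
  · exact (hφ.continuous.measurable.enorm.pow_const 2)

end GraphChart

/-- The trace inequality, on the outer side of the boundary. -/
lemma exists_trace_le {G : Set (Eu (m + 1))} (hG : IsOpen G) (hGC : HasCkBoundary 4 G)
    (hGb : Bornology.IsBounded G) :
    ∃ C : ℝ≥0, ∀ φ : Eu (m + 1) → ℂ, IsSmoothCompact φ →
      eLpNorm φ 2 (surfaceMeasure G) ^ 2 ≤ C * h1sq (closure G)ᶜ φ := by
  have hc : IsCompact (frontier G) :=
    Metric.isCompact_of_isClosed_isBounded isClosed_frontier (hGb.closure.subset frontier_subset_closure)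
  have key := hc.induction_on (p := fun S => ∃ C : ℝ≥0, ∀ φ : Eu (m + 1) → ℂ, IsSmoothCompact φ →
    ∫⁻ x in S, ‖φ x‖ₑ ^ 2 ∂(Measure.hausdorffMeasure (m : ℝ)) ≤ C * h1sq (closure G)ᶜ φ)
    ⟨0, fun φ _ => by simp⟩ ?_ ?_ ?_
  · obtain ⟨C, hC⟩ := key
    refine ⟨C, fun φ hφ => ?_⟩
    rw [eLpNorm_two_sq, surfaceMeasure_succ]
    exact hC φ hφ
  · rintro S S' hSS' ⟨C, hC⟩
    exact ⟨C, fun φ hφ => (lintegral_mono_set hSS').trans (hC φ hφ)⟩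
  · rintro S S' ⟨C, hC⟩ ⟨C', hC'⟩
    refine ⟨C + C', fun φ hφ => (lintegral_union_le _ _ _).trans ?_⟩
    rw [ENNReal.coe_add, add_mul]
    exact add_le_add (hC φ hφ) (hC' φ hφ)
  · intro x hx
    obtain ⟨g, r, hr, hg⟩ := GraphChart.exists_isChart hGC hx
    obtain ⟨r', hr', C, hC⟩ := hg.exists_trace_local hr hG
    refine ⟨Metric.ball x r' ∩ frontier G, ?_, C, hC⟩
    rw [inter_comm]
    exact inter_mem_nhdsWithin _ (Metric.ball_mem_nhds x hr')

end traceInequality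

/-! ### Limits in `L²` -/

section limits

variable {n : ℕ}

lemma ConvL2.mono_measure {μ ν : Measure (Eu n)} {f : ℕ → Eu n → ℂ} {g : Eu n → ℂ}
    (h : ConvL2 μ f g) (hle : ν ≤ μ) : ConvL2 ν f g :=
  tendsto_of_tendsto_of_tendsto_of_le_of_le tendsto_const_nhds h (fun _ => zero_le)
    fun _ => eLpNorm_mono_measure _ hle

lemma eLpNorm_two_le_add_measure (μ ν : Measure (Eu n)) (f : Eu n → ℂ) :
    eLpNorm f 2 (μ + ν) ≤ eLpNorm f 2 μ + eLpNorm f 2 ν := by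
  rw [← ENNReal.pow_le_pow_left_iff two_ne_zero, eLpNorm_two_sq, lintegral_add_measure,
    ← eLpNorm_two_sq, ← eLpNorm_two_sq, add_sq]
  gcongr
  exact le_self_add

lemma ConvL2.add_measure {μ ν : Measure (Eu n)} {f : ℕ → Eu n → ℂ} {g : Eu n → ℂ}
    (h : ConvL2 μ f g) (h' : ConvL2 ν f g) : ConvL2 (μ + ν) f g := by
  have hs : Tendsto (fun k => eLpNorm (f k - g) 2 μ + eLpNorm (f k - g) 2 ν) atTop (𝓝 0) := by
    simpa using Tendsto.add h h'
  exact tendsto_of_tendsto_of_tendsto_of_le_of_le tendsto_const_nhds hs (fun _ => zero_le)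
    fun _ => eLpNorm_two_le_add_measure _ _ _

lemma memLp_two_add_measure {μ ν : Measure (Eu n)} {f : Eu n → ℂ} (h : MemLp f 2 μ)
    (h' : MemLp f 2 ν) : MemLp f 2 (μ + ν) :=
  ⟨h.1.add_measure h'.1, (eLpNorm_two_le_add_measure μ ν f).trans_lt
    (ENNReal.add_lt_top.2 ⟨h.2, h'.2⟩)⟩

lemma convL2_iff_tendsto {μ : Measure (Eu n)} {f : ℕ → Eu n → ℂ} (hf : ∀ k, MemLp (f k) 2 μ)
    (w : Lp ℂ 2 μ) : ConvL2 μ f w ↔ Tendsto (fun k => (hf k).toLp (f k)) atTop (𝓝 w) := by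
  have h := Lp.tendsto_Lp_iff_tendsto_eLpNorm'' (fi := atTop) f hf w (Lp.memLp w)
  rw [Lp.toLp_coeFn] at h
  exact h.symm

lemma ConvL2.tendsto_toLp {μ : Measure (Eu n)} {f : ℕ → Eu n → ℂ} {g : Eu n → ℂ}
    (h : ConvL2 μ f g) (hf : ∀ k, MemLp (f k) 2 μ) (hg : MemLp g 2 μ) :
    Tendsto (fun k => (hf k).toLp (f k)) atTop (𝓝 (hg.toLp g)) :=
  (Lp.tendsto_Lp_iff_tendsto_eLpNorm'' (fi := atTop) f hf g hg).2 h

lemma toLp_finset_sum {ι : Type*} {μ : Measure (Eu n)} (s : Finset ι) {f : ι → Eu n → ℂ}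
    (hf : ∀ i, MemLp (f i) 2 μ) {h : MemLp (∑ i ∈ s, f i) 2 μ} :
    h.toLp (∑ i ∈ s, f i) = ∑ i ∈ s, (hf i).toLp (f i) := by
  classical
  induction s using Finset.induction_on with
  | empty => simp only [Finset.sum_empty]; exact MemLp.toLp_zero _
  | insert a s ha ih =>
    have hs : MemLp (∑ i ∈ s, f i) 2 μ := memLp_finsetSum' s fun i _ => hf i
    rw [Finset.sum_insert (f := fun i => (hf i).toLp (f i)) ha, ← ih (h := hs), ← MemLp.toLp_add]
    simp only [Finset.sum_insert ha]

lemma dist_toLp {μ : Measure (Eu n)} {f g : Eu n → ℂ} (hf : MemLp f 2 μ) (hg : MemLp g 2 μ) :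
    dist (hf.toLp f) (hg.toLp g) = (eLpNorm (f - g) 2 μ).toReal := by
  rw [dist_eq_norm, ← MemLp.toLp_sub, Lp.norm_toLp]

/-- A sequence whose differences are dominated by those of a convergent sequence is Cauchy. This
extracts limits of derivatives and of traces from the convergence of the Laplacians alone. -/
lemma ConvL2.exists_limit {μ ν : Measure (Eu n)} {h : ℕ → Eu n → ℂ} {H : Eu n → ℂ}
    (hh : ConvL2 μ h H) (hm : ∀ k, MemLp (h k) 2 μ) (hH : MemLp H 2 μ) {f : ℕ → Eu n → ℂ}
    (hf : ∀ k, MemLp (f k) 2 ν) (C : ℝ)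
    (hle : ∀ k l, (eLpNorm (f k - f l) 2 ν).toReal ≤ C * (eLpNorm (h k - h l) 2 μ).toReal) :
    ∃ g : Lp ℂ 2 ν, ConvL2 ν f g := by
  have hc := (hh.tendsto_toLp hm hH).cauchySeq
  have hcf : CauchySeq fun k => (hf k).toLp (f k) := by
    rw [Metric.cauchySeq_iff] at hc ⊢
    intro ε hε
    -- The constant `C` is arbitrary, possibly zero or negative, so the divisor is `|C| + 1`.
    obtain ⟨N, hN⟩ := hc (ε / (|C| + 1)) (by positivity)
    refine ⟨N, fun k hk l hl => ?_⟩
    have h1 := hN k hk l hl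
    rw [dist_toLp, lt_div_iff₀ (by positivity)] at h1
    rw [dist_toLp]
    refine (hle k l).trans_lt (lt_of_le_of_lt ?_ h1)
    rw [mul_comm]
    gcongr
    exact (le_abs_self C).trans (by linarith)
  obtain ⟨g, hg⟩ := cauchySeq_tendsto_of_complete hcf
  exact ⟨g, (convL2_iff_tendsto hf g).2 hg⟩

lemma tendsto_integral_smul {μ : Measure (Eu n)} [IsFiniteMeasureOnCompacts μ]
    {f : ℕ → Eu n → ℂ} {g : Eu n → ℂ} (h : ConvL2 μ f g) (hf : ∀ k, MemLp (f k) 2 μ)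
    (hg : MemLp g 2 μ) {ψ : Eu n → ℝ} (hψ : Continuous ψ) (hc : HasCompactSupport ψ) :
    Tendsto (fun k => ∫ x, ψ x • f k x ∂μ) atTop (𝓝 (∫ x, ψ x • g x ∂μ)) := by
  have hψm : MemLp (fun x => ((ψ x : ℝ) : ℂ)) 2 μ :=
    (Complex.continuous_ofReal.comp hψ).memLp_of_hasCompactSupport
      (hc.comp_left (g := fun t : ℝ => (t : ℂ)) Complex.ofReal_zero)
  have hint : ∀ {u : Eu n → ℂ}, MemLp u 2 μ → Integrable (fun x => ψ x • u x) μ := fun hu =>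
    (hu.locallyIntegrable (by norm_num)).integrable_smul_left_of_hasCompactSupport hψ hc
  rw [tendsto_iff_norm_sub_tendsto_zero]
  have h1 : Tendsto (fun k => (eLpNorm (fun x => ((ψ x : ℝ) : ℂ)) 2 μ).toReal
      * (eLpNorm (f k - g) 2 μ).toReal) atTop (𝓝 0) := by
    have h2 := ((ENNReal.tendsto_toReal ENNReal.zero_ne_top).comp h).const_mul
      (eLpNorm (fun x => ((ψ x : ℝ) : ℂ)) 2 μ).toReal
    simpa using h2
  refine squeeze_zero (fun _ => norm_nonneg _) (fun k => ?_) h1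
  rw [← integral_sub (hint (hf k)) (hint hg)]
  refine le_trans (le_of_eq ?_) (norm_integral_conj_mul_le hψm ((hf k).sub hg))
  congr 1
  refine integral_congr_ae (Eventually.of_forall fun x => ?_)
  simp only [Complex.conj_ofReal, Pi.sub_apply, Complex.real_smul, mul_sub]

variable {G : Opens (Eu n)}

lemma IsTest.isSmoothCompact {ψ : Eu n → ℝ} (h : IsTest (G : Set (Eu n)) ψ) : IsSmoothCompact ψ :=
  ⟨h.1, h.2.1⟩

lemma setIntegral_smul_eq {ψ : Eu n → ℝ} (h : tsupport ψ ⊆ G) (f : Eu n → ℂ) :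
    ∫ x in (G : Set (Eu n)), ψ x • f x = ∫ x, ψ x • f x :=
  setIntegral_eq_integral_of_forall_compl_eq_zero fun x hx => by
    rw [image_eq_zero_of_notMem_tsupport (fun h' => hx (h h')), zero_smul]

lemma integral_pd_smul {ψ : Eu n → ℝ} {f : Eu n → ℂ} (hψ : IsSmoothCompact ψ)
    (hf : IsSmoothCompact f) (i : Fin n) :
    ∫ x, pd i ψ x • f x = -∫ x, ψ x • pd i f x := by
  have hc : ∀ {u : Eu n → ℝ} {v : Eu n → ℂ}, IsSmoothCompact u → IsSmoothCompact v →
      Integrable fun x => u x • v x := fun {u v} hu hv =>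
    (hu.continuous.smul hv.continuous).integrable_of_hasCompactSupport hv.2.smul_left
  have h := integral_smul_fderiv_eq_neg_fderiv_smul_of_integrable (μ := volume) (v := unitVec i)
    (hc (hψ.pd i) hf) (hc hψ (hf.pd i)) (hc hψ hf) (fun x _ => hψ.differentiable x)
    (fun x _ => hf.differentiable x)
  rw [← neg_eq_iff_eq_neg]
  exact h.symm

lemma isWeakPartial_of_convL2 {f : ℕ → Eu n → ℂ} (hf : ∀ k, IsSmoothCompact (f k)) {i : Fin n}
    {w p : L2 G} (hw : ConvL2 (volume.restrict (G : Set (Eu n))) f w)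
    (hp : ConvL2 (volume.restrict (G : Set (Eu n))) (fun k => pd i (f k)) p) :
    IsWeakPartial G i w p := by
  intro ψ hψ
  have h1 := tendsto_integral_smul hw (fun k => (hf k).memLp 2 _) (Lp.memLp w)
    (hψ.fderiv_continuous (unitVec i)) (hψ.fderiv_compact (unitVec i))
  have h2 := tendsto_integral_smul hp (fun k => ((hf k).pd i).memLp 2 _) (Lp.memLp p)
    hψ.continuous hψ.2.1
  refine tendsto_nhds_unique h1 (h2.neg.congr fun k => ?_)
  change -∫ x in (G : Set (Eu n)), ψ x • pd i (f k) x = ∫ x in (G : Set (Eu n)), pd i ψ x • f k x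
  rw [setIntegral_smul_eq hψ.2.2, setIntegral_smul_eq ((tsupport_pd_subset i ψ).trans hψ.2.2),
    ← integral_pd_smul hψ.isSmoothCompact (hf k)]

/-- Limits of test functions whose Laplacians converge belong to `H²`. -/
lemma memH2_of_convL2 {φ : ℕ → Eu n → ℂ} (hφ : ∀ k, IsSmoothCompact (φ k)) {R : ℝ} (hR : 0 ≤ R)
    (hs : ∀ k, tsupport (φ k) ⊆ Metric.closedBall 0 R) {F : Eu n → ℂ} (hF : MemLp F 2 volume)
    (hlim : ConvL2 volume (fun k => lapl (φ k)) F) {w : L2 G}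
    (hw : ConvL2 (volume.restrict (G : Set (Eu n))) φ w) :
    MemH2 G w ∧
      (∀ i, ConvL2 (volume.restrict (G : Set (Eu n))) (fun k => pd i (φ k)) (wPartial G i w)) ∧
      (∀ i j, ConvL2 (volume.restrict (G : Set (Eu n))) (fun k => pd j (pd i (φ k)))
        (wPartial G j (wPartial G i w))) ∧
      ∀ f : L2 G, ConvL2 (volume.restrict (G : Set (Eu n))) (fun k => lapl (φ k)) f →
        lap G w = f := by
  have hsub : ∀ k l, tsupport (φ k - φ l) ⊆ Metric.closedBall 0 R := fun k l =>
    (tsupport_sub _ _).trans (union_subset (hs k) (hs l))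
  have hmono : ∀ {u : Eu n → ℂ}, IsSmoothCompact u →
      (eLpNorm u 2 (volume.restrict (G : Set (Eu n)))).toReal ≤ (eLpNorm u 2 volume).toReal :=
    fun hu => ENNReal.toReal_mono (hu.memLp 2 volume).eLpNorm_ne_top
      (eLpNorm_mono_measure _ Measure.restrict_le_self)
  have h1 : ∀ i, ∃ p : L2 G,
      ConvL2 (volume.restrict (G : Set (Eu n))) (fun k => pd i (φ k)) p := fun i =>
    hlim.exists_limit (fun k => (hφ k).lapl.memLp 2 _) hF (fun k => ((hφ k).pd i).memLp 2 _) (2 * R)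
      fun k l => by
        rw [← (hφ k).pd_sub (hφ l), ← (hφ k).lapl_sub (hφ l)]
        exact (hmono (((hφ k).sub (hφ l)).pd i)).trans
          (eLpNorm_pd_le_lapl ((hφ k).sub (hφ l)) hR (hsub k l) i)
  have h2 : ∀ i j, ∃ q : L2 G,
      ConvL2 (volume.restrict (G : Set (Eu n))) (fun k => pd j (pd i (φ k))) q := fun i j =>
    hlim.exists_limit (fun k => (hφ k).lapl.memLp 2 _) hF
      (fun k => (((hφ k).pd i).pd j).memLp 2 _) 1 fun k l => by
        rw [← ((hφ k).pd i).pd_sub ((hφ l).pd i), ← (hφ k).pd_sub (hφ l),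
          ← (hφ k).lapl_sub (hφ l), one_mul]
        exact (hmono ((((hφ k).sub (hφ l)).pd i).pd j)).trans
          (eLpNorm_pd_pd_le ((hφ k).sub (hφ l)) i j)
  choose p hp using h1
  choose q hq using h2
  have hwp : ∀ i, IsWeakPartial G i w (p i) := fun i => isWeakPartial_of_convL2 hφ hw (hp i)
  have hpq : ∀ i j, IsWeakPartial G j (p i) (q i j) := fun i j =>
    isWeakPartial_of_convL2 (fun k => (hφ k).pd i) (hp i) (hq i j)
  have ep : ∀ i, wPartial G i w = p i := fun i => (hwp i).wPartial_eq
  have eq : ∀ i j, wPartial G j (p i) = q i j := fun i j => (hpq i j).wPartial_eq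
  refine ⟨⟨fun i => ⟨_, hwp i⟩, fun i j => ?_⟩, fun i => ?_, fun i j => ?_, fun f hf => ?_⟩
  · rw [ep]; exact ⟨_, hpq i j⟩
  · rw [ep]; exact hp i
  · rw [ep, eq]; exact hq i j
  · simp only [lap, ep, eq]
    have h3 := (convL2_iff_tendsto (fun k => (hφ k).lapl.memLp 2 _) f).1 hf
    have h4 := tendsto_finsetSum Finset.univ fun i _ =>
      (convL2_iff_tendsto (fun k => (((hφ k).pd i).pd i).memLp 2 _) (q i i)).1 (hq i i)
    refine tendsto_nhds_unique h4 (h3.congr fun k => ?_)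
    exact toLp_finset_sum Finset.univ fun i => ((((hφ k).pd i).pd i).memLp 2 _)

end limits

/-! ### The Laplacian of functions glued along the interface -/

section glue

variable {n : ℕ} {Ω Ω₂ : Opens (Eu n)}

/-- The function on `ℝⁿ` which equals `u₁` on `Ω₁`, `u₂` on `Ω₂` and `0` elsewhere. -/
def glue (Ω Ω₂ : Opens (Eu n)) (u₁ : L2 (outerPart Ω Ω₂)) (u₂ : L2 Ω₂) : Eu n → ℂ :=
  (outerPart Ω Ω₂ : Set (Eu n)).indicator u₁ + (Ω₂ : Set (Eu n)).indicator u₂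

/-- The distributional Laplacian on `ℝⁿ` of the glued function `(u₁, u₂)` is the glued function
`(f₁, f₂)`. -/
def IsGluedLaplacian (Ω Ω₂ : Opens (Eu n)) (u₁ : L2 (outerPart Ω Ω₂)) (u₂ : L2 Ω₂)
    (f₁ : L2 (outerPart Ω Ω₂)) (f₂ : L2 Ω₂) : Prop :=
  ∀ φ : Eu n → ℝ, IsSmoothCompact φ →
    (∫ x in (outerPart Ω Ω₂ : Set (Eu n)), lapl φ x • u₁ x)
        + ∫ x in (Ω₂ : Set (Eu n)), lapl φ x • u₂ x
      = (∫ x in (outerPart Ω Ω₂ : Set (Eu n)), φ x • f₁ x) + ∫ x in (Ω₂ : Set (Eu n)), φ x • f₂ x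

variable (u₁ : L2 (outerPart Ω Ω₂)) (u₂ : L2 Ω₂)

lemma memLp_glue : MemLp (glue Ω Ω₂ u₁ u₂) 2 volume :=
  ((memLp_indicator_iff_restrict (outerPart Ω Ω₂).isOpen.measurableSet).2 (Lp.memLp u₁)).add
    ((memLp_indicator_iff_restrict Ω₂.isOpen.measurableSet).2 (Lp.memLp u₂))

lemma integral_smul_glue {ψ : Eu n → ℝ} (hc : Continuous ψ) (hs : HasCompactSupport ψ) :
    ∫ x, ψ x • glue Ω Ω₂ u₁ u₂ x
      = (∫ x in (outerPart Ω Ω₂ : Set (Eu n)), ψ x • u₁ x)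
        + ∫ x in (Ω₂ : Set (Eu n)), ψ x • u₂ x := by
  have h1 := (outerPart Ω Ω₂).isOpen.measurableSet
  have h2 := Ω₂.isOpen.measurableSet
  rw [← integral_indicator h1, ← integral_indicator h2,
    ← integral_add ((integrable_indicator_iff h1).2 (integrable_smul_L2 u₁ hc hs))
      ((integrable_indicator_iff h2).2 (integrable_smul_L2 u₂ hc hs))]
  refine integral_congr_ae (Eventually.of_forall fun x => ?_)
  simp only [glue, Pi.add_apply, smul_add, indicator_smul_apply]

lemma glue_ae_eq_outer : glue Ω Ω₂ u₁ u₂ =ᵐ[volume.restrict (outerPart Ω Ω₂ : Set (Eu n))] u₁ := by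
  filter_upwards [ae_restrict_mem (outerPart Ω Ω₂).isOpen.measurableSet] with x hx
  have hx2 : x ∉ (Ω₂ : Set (Eu n)) := fun h => hx.2 (subset_closure h)
  simp [glue, indicator_of_mem hx, indicator_of_notMem hx2]

lemma glue_ae_eq_inner : glue Ω Ω₂ u₁ u₂ =ᵐ[volume.restrict (Ω₂ : Set (Eu n))] u₂ := by
  filter_upwards [ae_restrict_mem Ω₂.isOpen.measurableSet] with x hx
  have hx2 : x ∉ (outerPart Ω Ω₂ : Set (Eu n)) := fun h => h.2 (subset_closure hx)
  simp [glue, indicator_of_mem hx, indicator_of_notMem hx2]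

lemma glue_eq_zero (hsub : closure (Ω₂ : Set (Eu n)) ⊆ Ω) {x : Eu n} (hx : x ∉ Ω) :
    glue Ω Ω₂ u₁ u₂ x = 0 := by
  have h1 : x ∉ (outerPart Ω Ω₂ : Set (Eu n)) := fun h => hx h.1
  have h2 : x ∉ (Ω₂ : Set (Eu n)) := fun h => hx (hsub (subset_closure h))
  simp [glue, indicator_of_notMem h1, indicator_of_notMem h2]

lemma eLpNorm_glue_le : (eLpNorm (glue Ω Ω₂ u₁ u₂) 2 volume).toReal ≤ ‖u₁‖ + ‖u₂‖ := by
  rw [Lp.norm_def, Lp.norm_def, ← ENNReal.toReal_add (Lp.eLpNorm_ne_top _) (Lp.eLpNorm_ne_top _)]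
  refine ENNReal.toReal_mono (ENNReal.add_ne_top.2 ⟨Lp.eLpNorm_ne_top _, Lp.eLpNorm_ne_top _⟩) ?_
  have h1 := (outerPart Ω Ω₂).isOpen.measurableSet
  have h2 := Ω₂.isOpen.measurableSet
  rw [← eLpNorm_indicator_eq_eLpNorm_restrict h1, ← eLpNorm_indicator_eq_eLpNorm_restrict h2]
  exact eLpNorm_add_le ((memLp_indicator_iff_restrict h1).2 (Lp.memLp u₁)).1
    ((memLp_indicator_iff_restrict h2).2 (Lp.memLp u₂)).1 (by norm_num)

lemma norm_le_eLpNorm_glue_outer : ‖u₁‖ ≤ (eLpNorm (glue Ω Ω₂ u₁ u₂) 2 volume).toReal := by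
  rw [Lp.norm_def, ← eLpNorm_congr_ae (glue_ae_eq_outer u₁ u₂)]
  exact ENNReal.toReal_mono (memLp_glue u₁ u₂).eLpNorm_ne_top
    (eLpNorm_mono_measure _ Measure.restrict_le_self)

lemma norm_le_eLpNorm_glue_inner : ‖u₂‖ ≤ (eLpNorm (glue Ω Ω₂ u₁ u₂) 2 volume).toReal := by
  rw [Lp.norm_def, ← eLpNorm_congr_ae (glue_ae_eq_inner u₁ u₂)]
  exact ENNReal.toReal_mono (memLp_glue u₁ u₂).eLpNorm_ne_top
    (eLpNorm_mono_measure _ Measure.restrict_le_self)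

variable {u₁ u₂} {f₁ : L2 (outerPart Ω Ω₂)} {f₂ : L2 Ω₂}

lemma IsGluedLaplacian.exists_approx (h : IsGluedLaplacian Ω Ω₂ u₁ u₂ f₁ f₂)
    (hsub : closure (Ω₂ : Set (Eu n)) ⊆ Ω) {R : ℝ}
    (hR : (Ω : Set (Eu n)) ⊆ Metric.closedBall 0 R) :
    ∃ φ : ℕ → Eu n → ℂ, (∀ k, IsSmoothCompact (φ k)) ∧
      (∀ k, tsupport (φ k) ⊆ Metric.closedBall 0 (R + 1)) ∧
      ConvL2 volume φ (glue Ω Ω₂ u₁ u₂) ∧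
      ConvL2 volume (fun k => lapl (φ k)) (glue Ω Ω₂ f₁ f₂) := by
  refine exists_smooth_approx (memLp_glue u₁ u₂) (memLp_glue f₁ f₂)
    (fun x hx => glue_eq_zero u₁ u₂ hsub fun hxΩ => hx (hR hxΩ)) fun φ hφ => ?_
  rw [integral_smul_glue u₁ u₂ hφ.lapl.continuous hφ.lapl.2,
    integral_smul_glue f₁ f₂ hφ.continuous hφ.2]
  exact h φ hφ

lemma ConvL2.tendsto_eLpNorm {μ : Measure (Eu n)} {f : ℕ → Eu n → ℂ} {g : Eu n → ℂ}
    (h : ConvL2 μ f g) (hf : ∀ k, MemLp (f k) 2 μ) (hg : MemLp g 2 μ) :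
    Tendsto (fun k => (eLpNorm (f k) 2 μ).toReal) atTop (𝓝 (eLpNorm g 2 μ).toReal) := by
  have h1 := (h.tendsto_toLp hf hg).norm
  simpa only [Lp.norm_toLp] using h1

/-- The Poincaré estimate for test functions supported in the ball of radius `R + 1` passes to the
limit along the mollifications. -/
lemma IsGluedLaplacian.eLpNorm_le (h : IsGluedLaplacian Ω Ω₂ u₁ u₂ f₁ f₂)
    (hsub : closure (Ω₂ : Set (Eu n)) ⊆ Ω) {R : ℝ} (hR0 : 0 ≤ R)
    (hR : (Ω : Set (Eu n)) ⊆ Metric.closedBall 0 R) (i : Fin n) :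
    (eLpNorm (glue Ω Ω₂ u₁ u₂) 2 volume).toReal ≤ (2 * (R + 1)) ^ 2 * (‖f₁‖ + ‖f₂‖) := by
  obtain ⟨φ, hφ, hs, h1, h2⟩ := h.exists_approx hsub hR
  have t1 := h1.tendsto_eLpNorm (fun k => (hφ k).memLp 2 _) (memLp_glue u₁ u₂)
  have t2 := (h2.tendsto_eLpNorm (fun k => (hφ k).lapl.memLp 2 _) (memLp_glue f₁ f₂)).const_mul
    ((2 * (R + 1)) ^ 2)
  refine (le_of_tendsto_of_tendsto' t1 t2 fun k =>
    eLpNorm_le_lapl (hφ k) (by linarith) (hs k) i).trans ?_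
  gcongr
  exact eLpNorm_glue_le f₁ f₂

end glue

/-! ### Regularity of glued functions -/

section regularity

variable {m : ℕ}

lemma h1sq_eq {n : ℕ} (S : Set (Eu n)) (φ : Eu n → ℂ) :
    h1sq S φ = eLpNorm φ 2 (volume.restrict S) ^ 2
      + ∑ i, eLpNorm (pd i φ) 2 (volume.restrict S) ^ 2 := by
  simp only [h1sq, eLpNorm_two_sq]

/-- The trace inequality for functions whose `H¹` norm is controlled by a number `L`. -/
lemma trace_toReal_le {n : ℕ} {G : Set (Eu n)} {φ : Eu n → ℂ} (hφ : IsSmoothCompact φ) {C : ℝ≥0}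
    (hC : eLpNorm φ 2 (surfaceMeasure G) ^ 2 ≤ C * h1sq (closure G)ᶜ φ) {a b L : ℝ} (hL : 0 ≤ L)
    (ha : (eLpNorm φ 2 volume).toReal ≤ a * L)
    (hb : ∀ i, (eLpNorm (pd i φ) 2 volume).toReal ≤ b * L) :
    eLpNorm φ 2 (surfaceMeasure G) ≠ ⊤ ∧
      (eLpNorm φ 2 (surfaceMeasure G)).toReal ≤ √(C * (a ^ 2 + n * b ^ 2)) * L := by
  have hle : h1sq (closure G)ᶜ φ ≤ eLpNorm φ 2 volume ^ 2 + ∑ i, eLpNorm (pd i φ) 2 volume ^ 2 := by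
    rw [h1sq_eq]
    gcongr <;> exact Measure.restrict_le_self
  have hfin : eLpNorm φ 2 volume ^ 2 ≠ ⊤ := ENNReal.pow_ne_top (hφ.memLp 2 volume).eLpNorm_ne_top
  have hfin' : ∀ i ∈ Finset.univ, eLpNorm (pd i φ) 2 volume ^ 2 ≠ ⊤ := fun i _ =>
    ENNReal.pow_ne_top ((hφ.pd i).memLp 2 volume).eLpNorm_ne_top
  have htop : (C : ℝ≥0∞) * (eLpNorm φ 2 volume ^ 2 + ∑ i, eLpNorm (pd i φ) 2 volume ^ 2) ≠ ⊤ :=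
    ENNReal.mul_ne_top ENNReal.coe_ne_top
      (ENNReal.add_ne_top.2 ⟨hfin, (ENNReal.sum_lt_top.2 fun i hi => (hfin' i hi).lt_top).ne⟩)
  have h1 : eLpNorm φ 2 (surfaceMeasure G) ^ 2
      ≤ C * (eLpNorm φ 2 volume ^ 2 + ∑ i, eLpNorm (pd i φ) 2 volume ^ 2) := hC.trans (by gcongr)
  refine ⟨fun h => htop (top_le_iff.1 (by simpa [h] using h1)), ?_⟩
  have h2 := ENNReal.toReal_mono htop h1
  rw [ENNReal.toReal_pow, ENNReal.toReal_mul, ENNReal.toReal_add hfin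
    (ENNReal.sum_lt_top.2 fun i hi => (hfin' i hi).lt_top).ne, ENNReal.toReal_sum hfin',
    ENNReal.coe_toReal] at h2
  simp only [ENNReal.toReal_pow] at h2
  rw [← abs_of_nonneg hL, ← Real.sqrt_sq_eq_abs, ← Real.sqrt_mul (by positivity)]
  refine Real.le_sqrt_of_sq_le (h2.trans ?_)
  have h3 : (eLpNorm φ 2 volume).toReal ^ 2 ≤ (a * L) ^ 2 := by gcongr
  have h4 : ∑ i, (eLpNorm (pd i φ) 2 volume).toReal ^ 2 ≤ ∑ _i : Fin n, (b * L) ^ 2 := by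
    gcongr with i
    exact hb i
  rw [Finset.sum_const, Finset.card_univ, Fintype.card_fin, nsmul_eq_mul] at h4
  calc (C : ℝ) * ((eLpNorm φ 2 volume).toReal ^ 2 + ∑ i, (eLpNorm (pd i φ) 2 volume).toReal ^ 2)
      ≤ C * ((a * L) ^ 2 + n * (b * L) ^ 2) := by gcongr
    _ = _ := by ring

lemma surfaceMeasure_outerPart_le {n : ℕ} (Ω Ω₂ : Opens (Eu n)) :
    surfaceMeasure (outerPart Ω Ω₂ : Set (Eu n))
      ≤ surfaceMeasure (Ω : Set (Eu n)) + surfaceMeasure (Ω₂ : Set (Eu n)) := by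
  have hf : frontier (outerPart Ω Ω₂ : Set (Eu n)) ⊆ frontier (Ω : Set (Eu n)) ∪ frontier Ω₂ := by
    intro x hx
    rcases frontier_inter_subset (Ω : Set (Eu n)) (closure (Ω₂ : Set (Eu n)))ᶜ hx with h | h
    · exact Or.inl h.1
    · rw [frontier_compl] at h
      exact Or.inr (frontier_closure_subset h.2)
  exact (Measure.restrict_mono hf le_rfl).trans (Measure.restrict_union_le _ _)

lemma disjoint_frontier {n : ℕ} {Ω Ω₂ : Opens (Eu n)} (hsub : closure (Ω₂ : Set (Eu n)) ⊆ Ω)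
    {x : Eu n} (hx : x ∈ frontier (Ω : Set (Eu n))) : x ∉ frontier (Ω₂ : Set (Eu n)) := fun h => by
  rw [Ω.isOpen.frontier_eq] at hx
  exact hx.2 (hsub (frontier_subset_closure h))

/-- Functions which vanish on `∂Ω` and converge in `L²(∂Ω₂)` provide a common trace. -/
lemma exists_common_trace {n : ℕ} {Ω Ω₂ : Opens (Eu n)} (hsub : closure (Ω₂ : Set (Eu n)) ⊆ Ω)
    {w₁ : L2 (outerPart Ω Ω₂)} {w₂ : L2 Ω₂} (hw₁ : MemH1 _ w₁) (hw₂ : MemH1 _ w₂)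
    {φ : ℕ → Eu n → ℂ} (hφ : ∀ k, IsSmoothCompact (φ k))
    (h₁ : ConvL2 (volume.restrict (outerPart Ω Ω₂ : Set (Eu n))) φ w₁)
    (h₂ : ConvL2 (volume.restrict (Ω₂ : Set (Eu n))) φ w₂)
    (h₁' : ∀ i, ConvL2 (volume.restrict (outerPart Ω Ω₂ : Set (Eu n))) (fun k => pd i (φ k))
      (wPartial _ i w₁))
    (h₂' : ∀ i, ConvL2 (volume.restrict (Ω₂ : Set (Eu n))) (fun k => pd i (φ k))
      (wPartial _ i w₂))
    (hΓ₁ : ConvL2 (surfaceMeasure (Ω : Set (Eu n))) φ 0)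
    {g : Lp ℂ 2 (surfaceMeasure (Ω₂ : Set (Eu n)))}
    (hΓ : ConvL2 (surfaceMeasure (Ω₂ : Set (Eu n))) φ g) :
    ∃ d : Eu n → ℂ, IsTrace _ w₁ d ∧ IsTrace _ w₂ d ∧ d =ᵐ[surfaceMeasure (Ω : Set (Eu n))] 0 := by
  -- The limit on `∂Ω₂` is extended by zero. The two boundaries are disjoint, so this one function
  -- is the trace on both pieces and vanishes on `∂Ω`.
  have e2 : (g : Eu n → ℂ) =ᵐ[surfaceMeasure (Ω₂ : Set (Eu n))]
      (frontier (Ω₂ : Set (Eu n))).indicator g := by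
    filter_upwards [ae_restrict_mem isClosed_frontier.measurableSet] with x hx
    rw [indicator_of_mem hx]
  have e1 : (frontier (Ω₂ : Set (Eu n))).indicator g =ᵐ[surfaceMeasure (Ω : Set (Eu n))] 0 := by
    filter_upwards [ae_restrict_mem isClosed_frontier.measurableSet] with x hx
    rw [indicator_of_notMem (disjoint_frontier hsub hx)]
    rfl
  have m2 : MemLp ((frontier (Ω₂ : Set (Eu n))).indicator g) 2
      (surfaceMeasure (Ω₂ : Set (Eu n))) := (memLp_congr_ae e2).1 (Lp.memLp g)
  have m1 : MemLp ((frontier (Ω₂ : Set (Eu n))).indicator g) 2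
      (surfaceMeasure (Ω : Set (Eu n))) := (memLp_congr_ae e1).2 MemLp.zero
  exact ⟨_, ⟨hw₁, (memLp_two_add_measure m1 m2).mono_measure (surfaceMeasure_outerPart_le Ω Ω₂),
    φ, hφ, h₁, h₁', ((hΓ₁.congr e1.symm).add_measure (hΓ.congr e2)).mono_measure
      (surfaceMeasure_outerPart_le Ω Ω₂)⟩, ⟨hw₂, m2, φ, hφ, h₂, h₂', hΓ.congr e2⟩, e1⟩

/-- The trace inequality bounds squares; a square root, taken as a continuous power on `ℝ≥0∞`,
returns to the norms. -/
lemma convL2_zero_of_trace_le {n : ℕ} {G : Set (Eu n)} {φ : ℕ → Eu n → ℂ} {C : ℝ≥0}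
    (hC : ∀ k, eLpNorm (φ k) 2 (surfaceMeasure G) ^ 2 ≤ C * h1sq (closure G)ᶜ (φ k))
    (h0 : ConvL2 (volume.restrict (closure G)ᶜ) φ 0)
    (h1 : ∀ i, ConvL2 (volume.restrict (closure G)ᶜ) (fun k => pd i (φ k)) 0) :
    ConvL2 (surfaceMeasure G) φ 0 := by
  simp only [ConvL2, sub_zero] at h0 h1 ⊢
  have h2 : Tendsto (fun k => (C : ℝ≥0∞) * h1sq (closure G)ᶜ (φ k)) atTop (𝓝 0) := by
    simp only [h1sq_eq]
    have h3 : ∀ i, Tendsto (fun k => eLpNorm (pd i (φ k)) 2 (volume.restrict (closure G)ᶜ) ^ 2)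
        atTop (𝓝 0) := fun i => by simpa using (ENNReal.Tendsto.pow (n := 2) (h1 i))
    have h4 := (ENNReal.Tendsto.pow (n := 2) h0).add (tendsto_finsetSum Finset.univ fun i _ => h3 i)
    have h5 := ENNReal.Tendsto.const_mul (a := (C : ℝ≥0∞)) h4 (Or.inr ENNReal.coe_ne_top)
    simpa using h5
  have h6 := tendsto_of_tendsto_of_tendsto_of_le_of_le tendsto_const_nhds h2 (fun _ => zero_le) hC
  have h7 := (ENNReal.continuous_rpow_const (y := 1 / 2)).continuousAt.tendsto.comp h6
  simp only [ENNReal.zero_rpow_of_pos (by norm_num : (0 : ℝ) < 1 / 2)] at h7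
  refine h7.congr fun k => ?_
  simp only [Function.comp_apply]
  rw [← ENNReal.rpow_natCast, ← ENNReal.rpow_mul]
  norm_num

variable {Ω Ω₂ : Opens (Eu (m + 1))} {u₁ f₁ : L2 (outerPart Ω Ω₂)} {u₂ f₂ : L2 Ω₂}

/-- A glued function with `L²` Laplacian belongs to `X(Ω)`. -/
theorem IsGluedLaplacian.memX (h : IsGluedLaplacian Ω Ω₂ u₁ u₂ f₁ f₂)
    (hsub : closure (Ω₂ : Set (Eu (m + 1))) ⊆ Ω)
    (hb : Bornology.IsBounded (Ω : Set (Eu (m + 1))))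
    (hΩ : HasCkBoundary 4 (Ω : Set (Eu (m + 1)))) (hΩ₂ : HasCkBoundary 4 (Ω₂ : Set (Eu (m + 1)))) :
    MemX Ω Ω₂ u₁ u₂ ∧ lap _ u₁ = f₁ ∧ lap _ u₂ = f₂ := by
  obtain ⟨R₀, hR₀⟩ := hb.subset_closedBall 0
  obtain ⟨R, hR0, hR⟩ : ∃ R : ℝ, 0 ≤ R ∧ (Ω : Set (Eu (m + 1))) ⊆ Metric.closedBall 0 R :=
    ⟨max R₀ 0, le_max_right _ _, hR₀.trans (Metric.closedBall_subset_closedBall (le_max_left _ _))⟩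
  obtain ⟨φ, hφ, hs, c0, c2⟩ := h.exists_approx hsub hR
  have hR1 : 0 ≤ R + 1 := by linarith
  have hF := memLp_glue f₁ f₂
  have hb₂ : Bornology.IsBounded (Ω₂ : Set (Eu (m + 1))) := hb.subset (subset_closure.trans hsub)
  obtain ⟨C₁, hC₁⟩ := exists_trace_le Ω.isOpen hΩ hb
  obtain ⟨C₂, hC₂⟩ := exists_trace_le Ω₂.isOpen hΩ₂ hb₂
  have r1 : ConvL2 (volume.restrict (outerPart Ω Ω₂ : Set (Eu (m + 1)))) φ u₁ :=
    (c0.mono_measure Measure.restrict_le_self).congr (glue_ae_eq_outer u₁ u₂)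
  have r2 : ConvL2 (volume.restrict (Ω₂ : Set (Eu (m + 1)))) φ u₂ :=
    (c0.mono_measure Measure.restrict_le_self).congr (glue_ae_eq_inner u₁ u₂)
  obtain ⟨a1, a2, a3, a4⟩ := memH2_of_convL2 hφ hR1 hs hF c2 r1
  obtain ⟨b1, b2, b3, b4⟩ := memH2_of_convL2 hφ hR1 hs hF c2 r2
  -- On the exterior of `Ω` the glued function is zero. The regularity lemma applied there, with
  -- limit `0`, shows that the mollifications and their derivatives up to order two tend to zero in
  -- `L²(E)`; hence the traces on `∂Ω` of the function and of its gradient vanish.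
  let E : Opens (Eu (m + 1)) := ⟨(closure (Ω : Set (Eu (m + 1))))ᶜ, isClosed_closure.isOpen_compl⟩
  have z0 : ((0 : L2 E) : Eu (m + 1) → ℂ) =ᵐ[volume.restrict (E : Set (Eu (m + 1)))] 0 :=
    Lp.coeFn_zero _ _ _
  have hE : glue Ω Ω₂ u₁ u₂ =ᵐ[volume.restrict (E : Set (Eu (m + 1)))] 0 := by
    filter_upwards [ae_restrict_mem E.isOpen.measurableSet] with x hx
    exact glue_eq_zero u₁ u₂ hsub fun hxΩ => hx (subset_closure hxΩ)
  have r0 : ConvL2 (volume.restrict (E : Set (Eu (m + 1)))) φ (0 : Eu (m + 1) → ℂ) :=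
    (c0.mono_measure Measure.restrict_le_self).congr hE
  obtain ⟨-, e2, e3, -⟩ := memH2_of_convL2 hφ hR1 hs hF c2 (r0.congr z0.symm)
  simp only [wPartial_zero] at e2 e3
  have sub2 : ∀ k l, tsupport (φ k - φ l) ⊆ Metric.closedBall 0 (R + 1) := fun k l =>
    (tsupport_sub _ _).trans (union_subset (hs k) (hs l))
  have t0 : ConvL2 (surfaceMeasure (Ω : Set (Eu (m + 1)))) φ 0 :=
    convL2_zero_of_trace_le (fun k => hC₁ _ (hφ k)) r0 fun i => (e2 i).congr z0
  have t1 : ∀ i, ConvL2 (surfaceMeasure (Ω : Set (Eu (m + 1)))) (fun k => pd i (φ k)) 0 := fun i =>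
    convL2_zero_of_trace_le (fun k => hC₁ _ ((hφ k).pd i)) ((e2 i).congr z0)
      fun j => (e3 i j).congr z0
  -- The comparison quantity `L` is `‖Δψ‖`. It controls the traces on `∂Ω₂` of `ψ` and, in `key1`,
  -- of its derivatives, so these are Cauchy along the mollifications.
  have key0 : ∀ ψ : Eu (m + 1) → ℂ, IsSmoothCompact ψ → tsupport ψ ⊆ Metric.closedBall 0 (R + 1) →
      _ := fun ψ hψ hψs => trace_toReal_le hψ (hC₂ _ hψ)
        (ENNReal.toReal_nonneg (a := eLpNorm (lapl ψ) 2 volume))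
        (eLpNorm_le_lapl hψ hR1 hψs 0) fun i => eLpNorm_pd_le_lapl hψ hR1 hψs i
  have key1 : ∀ ψ : Eu (m + 1) → ℂ, IsSmoothCompact ψ → tsupport ψ ⊆ Metric.closedBall 0 (R + 1) →
      ∀ i, _ := fun ψ hψ hψs i => trace_toReal_le (hψ.pd i) (hC₂ _ (hψ.pd i))
        (ENNReal.toReal_nonneg (a := eLpNorm (lapl ψ) 2 volume))
        (eLpNorm_pd_le_lapl hψ hR1 hψs i)
        fun j => (eLpNorm_pd_pd_le hψ i j).trans (one_mul _).ge
  have memLp_surf : ∀ {ψ : Eu (m + 1) → ℂ}, IsSmoothCompact ψ →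
      eLpNorm ψ 2 (surfaceMeasure (Ω₂ : Set (Eu (m + 1)))) ≠ ⊤ →
      MemLp ψ 2 (surfaceMeasure (Ω₂ : Set (Eu (m + 1)))) := fun hψ ht =>
    ⟨hψ.continuous.aestronglyMeasurable, ht.lt_top⟩
  obtain ⟨g, hg⟩ := c2.exists_limit (fun k => (hφ k).lapl.memLp 2 _) hF
    (fun k => memLp_surf (hφ k) (key0 _ (hφ k) (hs k)).1) _ fun k l => by
      rw [← (hφ k).lapl_sub (hφ l)]
      exact (key0 _ ((hφ k).sub (hφ l)) (sub2 k l)).2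
  have hd : ∀ i, ∃ g : Lp ℂ 2 (surfaceMeasure (Ω₂ : Set (Eu (m + 1)))),
      ConvL2 (surfaceMeasure (Ω₂ : Set (Eu (m + 1)))) (fun k => pd i (φ k)) g := fun i =>
    c2.exists_limit (fun k => (hφ k).lapl.memLp 2 _) hF
      (fun k => memLp_surf ((hφ k).pd i) (key1 _ (hφ k) (hs k) i).1) _ fun k l => by
        rw [← (hφ k).lapl_sub (hφ l), ← (hφ k).pd_sub (hφ l)]
        exact (key1 _ ((hφ k).sub (hφ l)) (sub2 k l) i).2
  choose d hd using hd
  obtain ⟨G, G1, G2, G3⟩ := exists_common_trace hsub a1.1 b1.1 hφ r1 r2 a2 b2 t0 hg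
  have hD := fun i => exists_common_trace hsub (a1.2 i) (b1.2 i) (fun k => (hφ k).pd i)
    (a2 i) (b2 i) (a3 i) (b3 i) (t1 i) (hd i)
  choose D D1 D2 D3 using hD
  -- Both sides use the same traces `G` and `D`, so the transmission conditions hold by reflexivity.
  refine ⟨⟨a1, b1, G, G, D, D, G1, G2, D1, D2, G3, ?_, EventuallyEq.rfl, EventuallyEq.rfl⟩,
    a4 f₁ ((c2.mono_measure Measure.restrict_le_self).congr (glue_ae_eq_outer f₁ f₂)),
    b4 f₂ ((c2.mono_measure Measure.restrict_le_self).congr (glue_ae_eq_inner f₁ f₂))⟩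
  filter_upwards [eventually_all.2 D3] with x hx
  exact Finset.sum_eq_zero fun i _ => by rw [hx i]; simp

end regularity

/-! ### Green's formula with traces -/

section localization

variable {n : ℕ}

open scoped Manifold in
-- Take a smooth `f` that is `0` near the complement of `U` and `1` near the part of the support of
-- `φ` outside `V`; the pieces are `f φ` and `φ - f φ`.
lemma exists_smooth_split {φ : Eu n → ℝ} (hφ : IsSmoothCompact φ) {U V : Set (Eu n)}
    (hU : IsOpen U) (hV : IsOpen V) (h : tsupport φ ⊆ U ∪ V) :
    ∃ φ₁ φ₂ : Eu n → ℝ, IsSmoothCompact φ₁ ∧ IsSmoothCompact φ₂ ∧ tsupport φ₁ ⊆ U ∧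
      tsupport φ₂ ⊆ V ∧ φ = φ₁ + φ₂ := by
  obtain ⟨f, h0, h1, -⟩ := exists_contMDiffMap_zero_one_nhds_of_isClosed (n := ⊤) 𝓘(ℝ, Eu n)
    hU.isClosed_compl ((isClosed_tsupport φ).sdiff hV)
    (disjoint_left.2 fun x hx hx' => ((h hx'.1).resolve_left hx |> hx'.2).elim)
  have hf : ContDiff ℝ ∞ f := f.contMDiff.contDiff
  have hs : IsSmoothCompact fun x => f x • φ x := hφ.smul hf
  refine ⟨fun x => f x • φ x, φ - fun x => f x • φ x, hs, hφ.sub hs, fun x hx => ?_, fun x hx => ?_,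
    by abel⟩
  · by_contra hxU
    have h2 : ∀ᶠ y in 𝓝 x, f y = 0 := h0.filter_mono (nhds_le_nhdsSet hxU)
    exact notMem_tsupport_iff_eventuallyEq.2 (h2.mono fun y hy => by simp [hy]) hx
  · by_contra hxV
    have hxφ : x ∈ tsupport φ := by
      by_contra hn
      refine notMem_tsupport_iff_eventuallyEq.2 ?_ hx
      filter_upwards [notMem_tsupport_iff_eventuallyEq.1 hn] with y hy
      simp [hy]
    have h2 : ∀ᶠ y in 𝓝 x, f y = 1 := h1.filter_mono (nhds_le_nhdsSet (show x ∈ tsupport φ \ V from ⟨hxφ, hxV⟩))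
    exact notMem_tsupport_iff_eventuallyEq.2 (h2.mono fun y hy => by simp [hy]) hx

/-- An additive property of test functions holds if it holds for small supports. -/
lemma forall_isSmoothCompact_of_local {P : (Eu n → ℝ) → Prop} (h0 : P 0)
    (hadd : ∀ φ ψ, IsSmoothCompact φ → IsSmoothCompact ψ → P φ → P ψ → P (φ + ψ))
    (hloc : ∀ x, ∃ r > 0, ∀ φ, IsSmoothCompact φ → tsupport φ ⊆ Metric.ball x r → P φ)
    {φ : Eu n → ℝ} (hφ : IsSmoothCompact φ) : P φ := by
  have key : ∃ U, IsOpen U ∧ tsupport φ ⊆ U ∧ ∀ ψ, IsSmoothCompact ψ → tsupport ψ ⊆ U → P ψ := by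
    refine IsCompact.induction_on hφ.2.isCompact
      (p := fun S => ∃ U, IsOpen U ∧ S ⊆ U ∧ ∀ ψ, IsSmoothCompact ψ → tsupport ψ ⊆ U → P ψ)
      ?_ ?_ ?_ ?_
    · refine ⟨∅, isOpen_empty, subset_rfl, fun ψ _ hs => ?_⟩
      rw [subset_empty_iff, tsupport_eq_empty_iff] at hs
      rwa [hs]
    · rintro S T hST ⟨U, hU, hTU, h⟩
      exact ⟨U, hU, hST.trans hTU, h⟩
    · rintro S T ⟨U, hU, hSU, h⟩ ⟨V, hV, hTV, h'⟩
      refine ⟨U ∪ V, hU.union hV, union_subset_union hSU hTV, fun ψ hψ hs => ?_⟩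
      obtain ⟨ψ₁, ψ₂, a, b, c, d, rfl⟩ := exists_smooth_split hψ hU hV hs
      exact hadd _ _ a b (h _ a c) (h' _ b d)
    · intro x _
      obtain ⟨r, hr, h⟩ := hloc x
      exact ⟨Metric.ball x r, mem_nhdsWithin_of_mem_nhds (Metric.ball_mem_nhds x hr),
        Metric.ball x r, Metric.isOpen_ball, subset_rfl, h⟩
  obtain ⟨U, -, hsU, h⟩ := key
  exact h φ hφ hsU

variable {G : Opens (Eu n)}

lemma setIntegral_smul_eq_zero {ψ f : Eu n → ℝ} {S : Set (Eu n)} (hs : tsupport ψ ⊆ S)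
    (hd : Disjoint S G) (hf : tsupport f ⊆ tsupport ψ) (u : Eu n → ℂ) :
    ∫ x in (G : Set (Eu n)), f x • u x = 0 :=
  setIntegral_eq_zero_of_forall_eq_zero fun x hx => by
    rw [image_eq_zero_of_notMem_tsupport fun h => disjoint_left.1 hd (hs (hf h)) hx, zero_smul]

lemma tsupport_lapl_subset {F : Type*} [NormedAddCommGroup F] [NormedSpace ℝ F] (f : Eu n → F) :
    tsupport (lapl f) ⊆ tsupport f := by
  refine closure_minimal (fun x hx => ?_) (isClosed_tsupport f)
  by_contra hn
  refine hx ?_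
  rw [lapl, Finset.sum_apply]
  exact Finset.sum_eq_zero fun i _ => image_eq_zero_of_notMem_tsupport fun h =>
    hn (tsupport_pd_subset i f (tsupport_pd_subset i _ h))

lemma integral_lapl_smul {φ : Eu n → ℝ} (hφ : IsSmoothCompact φ) (u : L2 G) :
    ∫ x in (G : Set (Eu n)), lapl φ x • u x
      = ∑ j, ∫ x in (G : Set (Eu n)), pd j (pd j φ) x • u x := by
  rw [← integral_finsetSum _ fun j _ => integrable_smul_L2 u ((hφ.pd j).pd j).continuous
    ((hφ.pd j).pd j).2]
  simp only [lapl, Finset.sum_apply, Finset.sum_smul]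

lemma integral_smul_finset_sum {φ : Eu n → ℝ} (hφ : IsSmoothCompact φ) {ι : Type*} (s : Finset ι)
    (f : ι → L2 G) : ∫ x in (G : Set (Eu n)), φ x • (∑ j ∈ s, f j : L2 G) x
      = ∑ j ∈ s, ∫ x in (G : Set (Eu n)), φ x • f j x := by
  classical
  induction s using Finset.induction_on with
  | empty =>
    simp only [Finset.sum_empty]
    refine integral_eq_zero_of_ae ?_
    filter_upwards [Lp.coeFn_zero ℂ 2 (volume.restrict (G : Set (Eu n)))] with x hx
    rw [hx, Pi.zero_apply, smul_zero]
  | insert a s ha ih =>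
    rw [Finset.sum_insert ha, Finset.sum_insert ha, integral_smul_add _ _ hφ.continuous hφ.2, ih]

lemma MemH2.integral_lapl {u : L2 G} (hu : MemH2 G u) {φ : Eu n → ℝ}
    (hφ : IsTest (G : Set (Eu n)) φ) :
    ∫ x in (G : Set (Eu n)), lapl φ x • u x = ∫ x in (G : Set (Eu n)), φ x • lap G u x := by
  rw [integral_lapl_smul hφ.isSmoothCompact, lap, integral_smul_finset_sum hφ.isSmoothCompact]
  refine Finset.sum_congr rfl fun j _ => ?_
  have h1 := hu.1.spec j (pd j φ) (hφ.partial (unitVec j))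
  have h2 := (hu.2 j).spec j φ hφ
  exact h1.trans (neg_eq_iff_eq_neg.2 h2)

end localization

/-! ### Green's formula in a chart. -/

namespace GraphChart

variable {m : ℕ} {g : GraphChart m} {x₀ : Eu (m + 1)} {r : ℝ}

instance : IsFiniteMeasureOnCompacts g.meas where
  lt_top_of_isCompact K hK := by
    rw [meas, Measure.map_apply g.contDiff_param.continuous.measurable hK.measurableSet]
    refine (measure_mono fun y hy => ?_).trans_lt
      (hK.image (lipschitzWith_rem g.i).continuous).measure_lt_top
    exact ⟨g.param y, hy, g.rem_param y⟩

lemma continuous_nrm (j : Fin (m + 1)) : Continuous fun x => g.nrm x j :=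
  continuous_const.sub (g.contDiff_pd_γ j).continuous

variable {G : Opens (Eu (m + 1))}

/-- The product rule reduces this to the divergence theorem for `ζ f`. Outside the ball `ζ`
vanishes, and inside it `G` coincides with the region below the graph. -/
lemma IsChart.integral_smooth (h : g.IsChart (G : Set (Eu (m + 1))) x₀ r) {ζ : Eu (m + 1) → ℝ}
    (hζ : IsSmoothCompact ζ) (hs : tsupport ζ ⊆ Metric.ball x₀ r) {f : Eu (m + 1) → ℂ}
    (hf : IsSmoothCompact f) (j : Fin (m + 1)) :
    (∫ x in (G : Set (Eu (m + 1))), pd j ζ x • f x) + ∫ x in (G : Set (Eu (m + 1))), ζ x • pd j f x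
      = ∫ x in Metric.ball x₀ r, (g.nrm x j * ζ x) • f x ∂g.meas := by
  have hp : IsSmoothCompact fun x => ζ x • f x := hf.smul hζ.1
  have hint : ∀ {u : Eu (m + 1) → ℝ} {v : Eu (m + 1) → ℂ}, IsSmoothCompact u → IsSmoothCompact v →
      IntegrableOn (fun x => u x • v x) G := fun {u v} hu hv =>
    ((hu.continuous.smul hv.continuous).integrable_of_hasCompactSupport hv.2.smul_left).integrableOn
  have e1 : ∀ x, pd j (fun x => ζ x • f x) x = pd j ζ x • f x + ζ x • pd j f x := fun x => by
    rw [pd_smul hf.differentiable hζ.differentiable]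
  have h1 := g.integral_below_pd (hp.1.of_le (by norm_cast)) hp.2 j
  rw [← integral_add (hint (hζ.pd j) hf) (hint hζ (hf.pd j))]
  have h2 : ∫ x in (G : Set (Eu (m + 1))), (pd j ζ x • f x + ζ x • pd j f x)
      = ∫ x in g.below, pd j (fun x => ζ x • f x) x := by
    simp only [e1]
    rw [← integral_indicator G.isOpen.measurableSet,
      ← integral_indicator g.isOpen_below.measurableSet]
    congr 1
    funext x
    by_cases hx : x ∈ Metric.ball x₀ r
    · have := h x hx
      by_cases hx' : x ∈ (G : Set (Eu (m + 1)))
      · rw [indicator_of_mem hx', indicator_of_mem (this.1 hx')]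
      · rw [indicator_of_notMem hx', indicator_of_notMem (fun h' => hx' (this.2 h'))]
    · have z0 : ζ x = 0 := image_eq_zero_of_notMem_tsupport fun h' => hx (hs h')
      have z1 : pd j ζ x = 0 :=
        image_eq_zero_of_notMem_tsupport fun h' => hx (hs (tsupport_pd_subset j ζ h'))
      simp [indicator, z0, z1]
  rw [h2, h1]
  have h3 := g.integral_meas (f := fun x => g.nrm x j • ζ x • f x)
    ((g.continuous_nrm j).smul hp.continuous)
  rw [← h3, setIntegral_eq_integral_of_forall_compl_eq_zero]
  · simp only [mul_smul]
  · intro x hx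
    rw [image_eq_zero_of_notMem_tsupport fun h' => hx (hs h'), mul_zero, zero_smul]

/-- The divergence theorem for an `H¹` function with a trace. -/
lemma IsChart.integral_trace (h : g.IsChart (G : Set (Eu (m + 1))) x₀ r) {ζ : Eu (m + 1) → ℝ}
    (hζ : IsSmoothCompact ζ) (hs : tsupport ζ ⊆ Metric.ball x₀ r) {w : L2 G} {d : Eu (m + 1) → ℂ}
    (hw : IsTrace G w d) (j : Fin (m + 1)) :
    (∫ x in (G : Set (Eu (m + 1))), pd j ζ x • w x)
        + ∫ x in (G : Set (Eu (m + 1))), ζ x • wPartial G j w x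
      = ∫ x in Metric.ball x₀ r, (g.nrm x j * ζ x) • d x ∂g.meas := by
  obtain ⟨-, hd, φ, hφ, c0, c1, c2⟩ := hw
  have hφ' : ∀ k, IsSmoothCompact (φ k) := hφ
  have hle := h.meas_restrict_le G.isOpen
  have t0 := tendsto_integral_smul c0 (fun k => (hφ' k).memLp 2 _) (Lp.memLp w)
    (hζ.pd j).continuous (hζ.pd j).2
  have t1 := tendsto_integral_smul (c1 j) (fun k => ((hφ' k).pd j).memLp 2 _)
    (Lp.memLp (wPartial G j w)) hζ.continuous hζ.2
  have t2 := tendsto_integral_smul (c2.mono_measure hle) (fun k => (hφ' k).memLp 2 _)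
    (hd.mono_measure hle) ((g.continuous_nrm j).mul hζ.continuous) hζ.2.mul_left
  exact tendsto_nhds_unique (t0.add t1) (t2.congr fun k =>
    (h.integral_smooth hζ hs (hφ' k) j).symm)

/-- Green's formula for the Laplacian near a boundary point. -/
lemma IsChart.green (h : g.IsChart (G : Set (Eu (m + 1))) x₀ r) {φ : Eu (m + 1) → ℝ}
    (hφ : IsSmoothCompact φ) (hs : tsupport φ ⊆ Metric.ball x₀ r) {u : L2 G}
    {t : Eu (m + 1) → ℂ} {d : Fin (m + 1) → Eu (m + 1) → ℂ} (ht : IsTrace G u t)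
    (hd : ∀ j, IsTrace G (wPartial G j u) (d j)) :
    (∫ x in (G : Set (Eu (m + 1))), lapl φ x • u x) - ∫ x in (G : Set (Eu (m + 1))), φ x • lap G u x
      = (∑ j, ∫ x in Metric.ball x₀ r, (g.nrm x j * pd j φ x) • t x ∂g.meas)
        - ∫ x in Metric.ball x₀ r, φ x • ∑ j, g.nrm x j • d j x ∂g.meas := by
  have hle := h.meas_restrict_le G.isOpen
  have hint : ∀ j ∈ Finset.univ, Integrable (fun x => (g.nrm x j * φ x) • d j x)
      (g.meas.restrict (Metric.ball x₀ r)) := fun j _ =>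
    (((hd j).2.1.mono_measure hle).locallyIntegrable
      (by norm_num)).integrable_smul_left_of_hasCompactSupport
      ((g.continuous_nrm j).mul hφ.continuous) hφ.2.mul_left
  have e : ∀ x, φ x • ∑ j, g.nrm x j • d j x = ∑ j, (g.nrm x j * φ x) • d j x := fun x => by
    rw [Finset.smul_sum]
    exact Finset.sum_congr rfl fun j _ => by rw [smul_smul, mul_comm]
  simp only [e]
  rw [integral_finsetSum _ hint, integral_lapl_smul hφ, lap, integral_smul_finset_sum hφ,
    ← Finset.sum_sub_distrib, ← Finset.sum_sub_distrib]
  refine Finset.sum_congr rfl fun j _ => ?_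
  have h1 := h.integral_trace (hφ.pd j) ((tsupport_pd_subset j φ).trans hs) ht j
  have h2 := h.integral_trace hφ hs (hd j) j
  rw [← h1, ← h2]
  ring

/-- The normal derivative in the direction of `nrm` is determined by the one in the direction of
the outer normal. -/
lemma IsChart.sum_nrm_smul {S : Set (Eu (m + 1))} (h : g.IsChart S x₀ r)
    {x : Eu (m + 1)} (hx : x ∈ Metric.ball x₀ r) (hxs : x ∈ g.surf) :
    ∃ c : ℝ, ∀ d : Fin (m + 1) → Eu (m + 1) → ℂ,
      ∑ j, g.nrm x j • d j x = c • normalPart (outerNormal S) d x := by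
  obtain ⟨c, hc⟩ := h.exists_nrm_eq hx hxs
  refine ⟨c, fun d => ?_⟩
  rw [normalPart, Finset.smul_sum]
  refine Finset.sum_congr rfl fun j _ => ?_
  rw [hc, mul_smul, Complex.real_smul (x := outerNormal S x j)]

lemma ae_meas_mem_surf : ∀ᵐ x ∂g.meas, x ∈ g.surf :=
  (ae_map_iff g.contDiff_param.continuous.aemeasurable g.isClosed_surf.measurableSet).2
    (Eventually.of_forall g.param_mem)

end GraphChart

/-! ### From `X(Ω)` to a distributional Laplacian on the whole space. -/

section green

variable {m : ℕ} {Ω Ω₂ : Opens (Eu (m + 1))} {u₁ : L2 (outerPart Ω Ω₂)} {u₂ : L2 Ω₂}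

namespace GraphChart

variable {g : GraphChart m} {x₀ : Eu (m + 1)} {r : ℝ}

lemma integral_boundary_congr {F F' : Eu (m + 1) → ℂ} {S : Set (Eu (m + 1))}
    (h : g.IsChart S x₀ r) (hS : IsOpen S)
    (hF : ∀ᵐ x ∂surfaceMeasure S, x ∈ Metric.ball x₀ r → x ∈ g.surf → F x = F' x) :
    ∫ x in Metric.ball x₀ r, F x ∂g.meas = ∫ x in Metric.ball x₀ r, F' x ∂g.meas := by
  refine integral_congr_ae ?_
  filter_upwards [ae_mono (h.meas_restrict_le hS) hF, ae_restrict_mem measurableSet_ball,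
    ae_restrict_of_ae g.ae_meas_mem_surf] with x h1 h2 h3 using h1 h2 h3

end GraphChart

/-- The glued Laplacian of an element of `X(Ω)` is its piecewise Laplacian. -/
theorem MemX.isGluedLaplacian (h : MemX Ω Ω₂ u₁ u₂)
    (hsub : closure (Ω₂ : Set (Eu (m + 1))) ⊆ Ω)
    (hΩ : HasCkBoundary 4 (Ω : Set (Eu (m + 1)))) (hΩ₂ : HasCkBoundary 4 (Ω₂ : Set (Eu (m + 1)))) :
    IsGluedLaplacian Ω Ω₂ u₁ u₂ (lap _ u₁) (lap _ u₂) := by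
  obtain ⟨hu₁, hu₂, t₁, t₂, d₁, d₂, ht₁, ht₂, hd₁, hd₂, b₁, b₂, b₃, b₄⟩ := h
  intro φ hφ
  refine forall_isSmoothCompact_of_local (P := fun φ =>
    (∫ x in (outerPart Ω Ω₂ : Set (Eu (m + 1))), lapl φ x • u₁ x)
        + ∫ x in (Ω₂ : Set (Eu (m + 1))), lapl φ x • u₂ x
      = (∫ x in (outerPart Ω Ω₂ : Set (Eu (m + 1))), φ x • lap _ u₁ x)
        + ∫ x in (Ω₂ : Set (Eu (m + 1))), φ x • lap _ u₂ x) ?_ ?_ ?_ hφ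
  · have hl : lapl (0 : Eu (m + 1) → ℝ) = 0 := by
      funext x
      exact image_eq_zero_of_notMem_tsupport fun hx => by
        simpa [tsupport] using tsupport_lapl_subset _ hx
    simp [hl]
  · intro φ ψ hφ hψ e1 e2
    have hl : lapl (φ + ψ) = lapl φ + lapl ψ := by
      have := (hφ.add hψ).lapl_sub hψ
      rw [add_sub_cancel_right] at this
      rw [this, sub_add_cancel]
    have hi : ∀ {G : Opens (Eu (m + 1))} (v : L2 G) {α β : Eu (m + 1) → ℝ}, IsSmoothCompact α →
        IsSmoothCompact β → ∫ x in (G : Set (Eu (m + 1))), (α + β) x • v x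
          = (∫ x in (G : Set (Eu (m + 1))), α x • v x)
            + ∫ x in (G : Set (Eu (m + 1))), β x • v x := by
      intro G v α β hα hβ
      rw [← integral_add (integrable_smul_L2 v hα.continuous hα.2)
        (integrable_smul_L2 v hβ.continuous hβ.2)]
      simp only [Pi.add_apply, add_smul]
    simp only [hl, hi _ hφ.lapl hψ.lapl, hi _ hφ hψ]
    linear_combination e1 + e2
  -- There are five positions of `x₀`: in `Ω₂`, on `∂Ω₂`, in `Ω₁`, on `∂Ω`, or outside the closure
  -- of `Ω`. Only the two boundary positions use the traces.
  · intro x₀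
    have inside : ∀ G : Opens (Eu (m + 1)), x₀ ∈ G → ∃ r > 0, Metric.ball x₀ r ⊆ G := fun G hx =>
      Metric.isOpen_iff.1 G.isOpen x₀ hx
    have zero : ∀ {G : Opens (Eu (m + 1))} {r : ℝ} {φ : Eu (m + 1) → ℝ},
        tsupport φ ⊆ Metric.ball x₀ r → Disjoint (Metric.ball x₀ r) (G : Set (Eu (m + 1))) →
        ∀ u : L2 G, (∫ x in (G : Set (Eu (m + 1))), lapl φ x • u x = 0) ∧
          ∫ x in (G : Set (Eu (m + 1))), φ x • u x = 0 := fun hs hd u =>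
      ⟨setIntegral_smul_eq_zero hs hd (tsupport_lapl_subset _) u,
        setIntegral_smul_eq_zero hs hd subset_rfl u⟩
    have d12 : ∀ x ∈ (Ω₂ : Set (Eu (m + 1))), x ∉ (outerPart Ω Ω₂ : Set (Eu (m + 1))) :=
      fun x hx hx' => hx'.2 (subset_closure hx)
    have hfar : x₀ ∉ closure (Ω₂ : Set (Eu (m + 1))) →
        ∃ r > 0, Disjoint (Metric.ball x₀ r) (closure (Ω₂ : Set (Eu (m + 1)))) := fun hx => by
      obtain ⟨r, hr, h⟩ := Metric.isOpen_iff.1 isClosed_closure.isOpen_compl x₀ hx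
      exact ⟨r, hr, disjoint_left.2 h⟩
    by_cases c1 : x₀ ∈ (Ω₂ : Set (Eu (m + 1)))
    · obtain ⟨r, hr, hrG⟩ := inside Ω₂ c1
      refine ⟨r, hr, fun φ hφ hs => ?_⟩
      have hd : Disjoint (Metric.ball x₀ r) (outerPart Ω Ω₂ : Set (Eu (m + 1))) :=
        disjoint_left.2 fun x hx => d12 x (hrG hx)
      rw [(zero hs hd u₁).1, (zero hs hd _).2, hu₂.integral_lapl ⟨hφ.1, hφ.2, hs.trans hrG⟩]
    by_cases c2 : x₀ ∈ closure (Ω₂ : Set (Eu (m + 1)))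
    · have hx₀ : x₀ ∈ frontier (Ω₂ : Set (Eu (m + 1))) := by
        rw [Ω₂.isOpen.frontier_eq]; exact ⟨c2, c1⟩
      obtain ⟨g, r₁, hr₁, hg⟩ := GraphChart.exists_isChart hΩ₂ hx₀
      obtain ⟨r₂, hr₂, hrΩ⟩ := inside Ω (hsub c2)
      refine ⟨min r₁ r₂, lt_min hr₁ hr₂, fun φ hφ hs => ?_⟩
      have hg2 := hg.mono (min_le_left r₁ r₂)
      -- Near `∂Ω₂` the set `Ω₁` is the other side of the same graph. Its normal is the opposite
      -- one, so equal traces and equal normal derivatives make the boundary terms cancel when the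
      -- two Green formulas are added.
      have hg1 : g.flip.IsChart (outerPart Ω Ω₂ : Set (Eu (m + 1))) x₀ (min r₁ r₂) := fun x hx =>
        ⟨fun h => (hg2.compl_closure x hx).1 h.2, fun h =>
          ⟨hrΩ (Metric.ball_subset_ball (min_le_right _ _) hx), (hg2.compl_closure x hx).2 h⟩⟩
      have g1 := hg1.green hφ hs ht₁ hd₁
      have g2 := hg2.green hφ hs ht₂ hd₂
      rw [GraphChart.flip_meas] at g1
      have e1 : ∀ j, ∫ x in Metric.ball x₀ (min r₁ r₂), (g.flip.nrm x j * pd j φ x) • t₁ x ∂g.meas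
          = -∫ x in Metric.ball x₀ (min r₁ r₂), (g.nrm x j * pd j φ x) • t₂ x ∂g.meas := fun j => by
        rw [← integral_neg]
        refine GraphChart.integral_boundary_congr hg2 Ω₂.isOpen (b₃.mono fun x hx _ _ => ?_)
        rw [GraphChart.flip_nrm, hx, neg_mul, neg_smul]
      have e2 : ∫ x in Metric.ball x₀ (min r₁ r₂), φ x • ∑ j, g.flip.nrm x j • d₁ j x ∂g.meas
          = -∫ x in Metric.ball x₀ (min r₁ r₂), φ x • ∑ j, g.nrm x j • d₂ j x ∂g.meas := by
        rw [← integral_neg]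
        refine GraphChart.integral_boundary_congr hg2 Ω₂.isOpen (b₄.mono fun x hx hxb hxs => ?_)
        obtain ⟨c, hc⟩ := hg2.sum_nrm_smul hxb hxs
        simp only [GraphChart.flip_nrm, neg_smul, Finset.sum_neg_distrib, hc, hx, smul_neg]
      simp only [e1, e2, Finset.sum_neg_distrib] at g1
      linear_combination g1 + g2
    obtain ⟨r₂, hr₂, hrd⟩ := hfar c2
    have hd₂' : Disjoint (Metric.ball x₀ r₂) (Ω₂ : Set (Eu (m + 1))) := hrd.mono_right subset_closure
    by_cases c3 : x₀ ∈ (Ω : Set (Eu (m + 1)))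
    · obtain ⟨r, hr, hrG⟩ := inside (outerPart Ω Ω₂) ⟨c3, c2⟩
      refine ⟨r, hr, fun φ hφ hs => ?_⟩
      have hd : Disjoint (Metric.ball x₀ r) (Ω₂ : Set (Eu (m + 1))) :=
        disjoint_left.2 fun x hx hx' => d12 x hx' (hrG hx)
      rw [(zero hs hd u₂).1, (zero hs hd _).2, hu₁.integral_lapl ⟨hφ.1, hφ.2, hs.trans hrG⟩]
    by_cases c4 : x₀ ∈ closure (Ω : Set (Eu (m + 1)))
    · have hx₀ : x₀ ∈ frontier (Ω : Set (Eu (m + 1))) := by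
        rw [Ω.isOpen.frontier_eq]; exact ⟨c4, c3⟩
      obtain ⟨g, r₁, hr₁, hg⟩ := GraphChart.exists_isChart hΩ hx₀
      refine ⟨min r₁ r₂, lt_min hr₁ hr₂, fun φ hφ hs => ?_⟩
      have hsb := Metric.ball_subset_ball (x := x₀) (min_le_right r₁ r₂)
      have hg0 := hg.mono (min_le_left r₁ r₂)
      have hg1 : g.IsChart (outerPart Ω Ω₂ : Set (Eu (m + 1))) x₀ (min r₁ r₂) := fun x hx =>
        ⟨fun h => (hg0 x hx).1 h.1, fun h =>
          ⟨(hg0 x hx).2 h, disjoint_left.1 hrd (hsb hx)⟩⟩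
      have g1 := hg1.green hφ hs ht₁ hd₁
      -- On `∂Ω` there is only one side, and both boundary terms vanish by the clamped conditions.
      have e1 : ∀ j, ∫ x in Metric.ball x₀ (min r₁ r₂), (g.nrm x j * pd j φ x) • t₁ x ∂g.meas
          = 0 := fun j => by
        rw [← integral_zero (Eu (m + 1)) ℂ (μ := g.meas.restrict (Metric.ball x₀ (min r₁ r₂)))]
        refine GraphChart.integral_boundary_congr hg0 Ω.isOpen (b₁.mono fun x hx _ _ => ?_)
        rw [hx, Pi.zero_apply, smul_zero]
      have e2 : ∫ x in Metric.ball x₀ (min r₁ r₂), φ x • ∑ j, g.nrm x j • d₁ j x ∂g.meas = 0 := by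
        rw [← integral_zero (Eu (m + 1)) ℂ (μ := g.meas.restrict (Metric.ball x₀ (min r₁ r₂)))]
        refine GraphChart.integral_boundary_congr hg0 Ω.isOpen (b₂.mono fun x hx hxb hxs => ?_)
        obtain ⟨c, hc⟩ := hg0.sum_nrm_smul hxb hxs
        rw [hc, hx, Pi.zero_apply, smul_zero, smul_zero]
      simp only [e1, e2, Finset.sum_const_zero, sub_zero] at g1
      have hd' := hd₂'.mono_left hsb
      rw [(zero hs hd' u₂).1, (zero hs hd' _).2]
      linear_combination g1
    · obtain ⟨r, hr, h⟩ := Metric.isOpen_iff.1 isClosed_closure.isOpen_compl x₀ c4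
      refine ⟨r, hr, fun φ hφ hs => ?_⟩
      have hd : Disjoint (Metric.ball x₀ r) (outerPart Ω Ω₂ : Set (Eu (m + 1))) :=
        disjoint_left.2 fun x hx hx' => h hx (subset_closure hx'.1)
      have hd' : Disjoint (Metric.ball x₀ r) (Ω₂ : Set (Eu (m + 1))) :=
        disjoint_left.2 fun x hx hx' => h hx (subset_closure (hsub (subset_closure hx')))
      rw [(zero hs hd u₁).1, (zero hs hd _).2, (zero hs hd' u₂).1, (zero hs hd' _).2]

end green

/-! ### Closedness of weak derivatives -/

section closedness

variable {n : ℕ} {G : Opens (Eu n)}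

lemma continuous_setIntegral_smul {ψ : Eu n → ℝ} (hψ : Continuous ψ) (hc : HasCompactSupport ψ) :
    Continuous fun u : L2 G => ∫ x in (G : Set (Eu n)), ψ x • u x := by
  refine continuous_iff_seqContinuous.2 fun u w h => ?_
  refine tendsto_integral_smul (f := fun k => u k) ?_ (fun k => Lp.memLp (u k)) (Lp.memLp w) hψ hc
  refine (convL2_iff_tendsto (fun k => Lp.memLp (u k)) w).2 ?_
  simpa only [Lp.toLp_coeFn] using h

lemma isClosed_isWeakPartial (i : Fin n) :
    IsClosed {p : L2 G × L2 G | IsWeakPartial G i p.1 p.2} := by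
  simp only [IsWeakPartial, ofPred_forall]
  refine isClosed_iInter fun φ => isClosed_iInter fun hφ => isClosed_eq ?_ ?_
  · exact (continuous_setIntegral_smul (hφ.fderiv_continuous _) (hφ.fderiv_compact _)).comp
      continuous_fst
  · exact ((continuous_setIntegral_smul hφ.continuous hφ.2.1).comp continuous_snd).neg

/-- For each test function the condition equates two functionals continuous in `L²`. All limits in
`X(Ω)` are taken through this fact. -/
lemma isClosed_isGluedLaplacian (Ω Ω₂ : Opens (Eu n)) :
    IsClosed {p : (L2 (outerPart Ω Ω₂) × L2 Ω₂) × L2 (outerPart Ω Ω₂) × L2 Ω₂ |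
      IsGluedLaplacian Ω Ω₂ p.1.1 p.1.2 p.2.1 p.2.2} := by
  simp only [IsGluedLaplacian, ofPred_forall]
  refine isClosed_iInter fun φ => isClosed_iInter fun hφ => isClosed_eq (.add ?_ ?_) (.add ?_ ?_)
  · exact (continuous_setIntegral_smul hφ.lapl.continuous hφ.lapl.2).comp
      (continuous_fst.comp continuous_fst)
  · exact (continuous_setIntegral_smul hφ.lapl.continuous hφ.lapl.2).comp
      (continuous_snd.comp continuous_fst)
  · exact (continuous_setIntegral_smul hφ.continuous hφ.2).comp
      (continuous_fst.comp continuous_snd)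
  · exact (continuous_setIntegral_smul hφ.continuous hφ.2).comp
      (continuous_snd.comp continuous_snd)

end closedness

/-! ### Test functions as elements of `X(Ω)` -/

section test

variable {n : ℕ} {G : Opens (Eu n)}

lemma IsSmoothCompact.ofReal {φ : Eu n → ℝ} (hφ : IsSmoothCompact φ) :
    IsSmoothCompact fun x => ((φ x : ℝ) : ℂ) :=
  ⟨Complex.ofRealCLM.contDiff.comp hφ.1, hφ.2.comp_left (g := fun t : ℝ => (t : ℂ))
    Complex.ofReal_zero⟩

lemma pd_ofReal {φ : Eu n → ℝ} (hφ : Differentiable ℝ φ) (i : Fin n) :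
    pd i (fun x => ((φ x : ℝ) : ℂ)) = fun x => ((pd i φ x : ℝ) : ℂ) := by
  funext x
  have h := (Complex.ofRealCLM.hasFDerivAt (x := φ x)).comp x (hφ x).hasFDerivAt
  have h' : HasFDerivAt (fun x => ((φ x : ℝ) : ℂ)) (Complex.ofRealCLM.comp (fderiv ℝ φ x)) x := h
  rw [pd, h'.fderiv]
  rfl

lemma lapl_ofReal {φ : Eu n → ℝ} (hφ : IsSmoothCompact φ) :
    lapl (fun x => ((φ x : ℝ) : ℂ)) = fun x => ((lapl φ x : ℝ) : ℂ) := by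
  funext x
  simp only [lapl, Finset.sum_apply, pd_ofReal hφ.differentiable,
    fun i => pd_ofReal (hφ.pd i).differentiable i, Complex.ofReal_sum]

/-- A real test function as an element of `L²(G)`. -/
def IsSmoothCompact.toL2 (G : Opens (Eu n)) {φ : Eu n → ℝ} (hφ : IsSmoothCompact φ) : L2 G :=
  (hφ.ofReal.memLp 2 (volume.restrict (G : Set (Eu n)))).toLp _

lemma IsSmoothCompact.coeFn_toL2 {φ : Eu n → ℝ} (hφ : IsSmoothCompact φ) :
    (hφ.toL2 G : Eu n → ℂ) =ᵐ[volume.restrict (G : Set (Eu n))] fun x => ((φ x : ℝ) : ℂ) :=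
  MemLp.coeFn_toLp _

lemma IsSmoothCompact.integral_smul_toL2 {φ : Eu n → ℝ} (hφ : IsSmoothCompact φ) (ψ : Eu n → ℝ) :
    ∫ x in (G : Set (Eu n)), ψ x • (hφ.toL2 G) x
      = ∫ x in (G : Set (Eu n)), ψ x • ((φ x : ℝ) : ℂ) :=
  integral_congr_ae (hφ.coeFn_toL2.mono fun x hx => by simp only [hx])

lemma IsSmoothCompact.inner_toL2 {φ : Eu n → ℝ} (hφ : IsSmoothCompact φ) (w : L2 G) :
    inner ℂ (hφ.toL2 G) w = ∫ x in (G : Set (Eu n)), φ x • w x := by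
  rw [L2.inner_def]
  refine integral_congr_ae (hφ.coeFn_toL2.mono fun x hx => ?_)
  simp only [hx, RCLike.inner_apply, Complex.conj_ofReal, Complex.real_smul]
  exact mul_comm _ _

lemma IsSmoothCompact.isWeakPartial_toL2 {φ : Eu n → ℝ} (hφ : IsSmoothCompact φ) (i : Fin n) :
    IsWeakPartial G i (hφ.toL2 G) ((hφ.pd i).toL2 G) := by
  intro ψ hψ
  change ∫ x in (G : Set (Eu n)), PlateTransmission.pd i ψ x • (hφ.toL2 G) x = _
  rw [hφ.integral_smul_toL2, (hφ.pd i).integral_smul_toL2, setIntegral_smul_eq hψ.2.2,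
    setIntegral_smul_eq ((tsupport_pd_subset i ψ).trans hψ.2.2),
    integral_pd_smul hψ.isSmoothCompact hφ.ofReal, pd_ofReal hφ.differentiable]

lemma integral_lapl_smul_comm {ψ : Eu n → ℝ} {f : Eu n → ℂ} (hψ : IsSmoothCompact ψ)
    (hf : IsSmoothCompact f) : ∫ x, lapl ψ x • f x = ∫ x, ψ x • lapl f x := by
  have hc : ∀ {u : Eu n → ℝ} {v : Eu n → ℂ}, IsSmoothCompact u → IsSmoothCompact v →
      Integrable fun x => u x • v x := fun {u v} hu hv =>
    (hu.continuous.smul hv.continuous).integrable_of_hasCompactSupport hv.2.smul_left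
  simp only [lapl, Finset.sum_apply, Finset.sum_smul, Finset.smul_sum]
  rw [integral_finsetSum _ fun i _ => hc ((hψ.pd i).pd i) hf,
    integral_finsetSum _ fun i _ => hc hψ ((hf.pd i).pd i)]
  refine Finset.sum_congr rfl fun i _ => ?_
  rw [integral_pd_smul (hψ.pd i) hf, integral_pd_smul hψ (hf.pd i), neg_neg]

lemma IsTest.setIntegral_lapl_smul {φ : Eu n → ℝ} (hφ : IsTest (G : Set (Eu n)) φ)
    {ψ : Eu n → ℝ} (hψ : IsSmoothCompact ψ) :
    ∫ x in (G : Set (Eu n)), lapl ψ x • (hφ.isSmoothCompact.toL2 G) x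
      = ∫ x in (G : Set (Eu n)), ψ x • (hφ.isSmoothCompact.lapl.toL2 G) x := by
  have hz : ∀ {α β : Eu n → ℝ}, tsupport β ⊆ G → ∫ x in (G : Set (Eu n)), α x • ((β x : ℝ) : ℂ)
      = ∫ x, α x • ((β x : ℝ) : ℂ) := fun hβ =>
    setIntegral_eq_integral_of_forall_compl_eq_zero fun x hx => by
      rw [image_eq_zero_of_notMem_tsupport fun h => hx (hβ h)]; simp
  rw [IsSmoothCompact.integral_smul_toL2, IsSmoothCompact.integral_smul_toL2, hz hφ.2.2,
    hz ((tsupport_lapl_subset φ).trans hφ.2.2),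
    integral_lapl_smul_comm hψ hφ.isSmoothCompact.ofReal, lapl_ofReal hφ.isSmoothCompact]

lemma integral_smul_zero (ψ : Eu n → ℝ) :
    ∫ x in (G : Set (Eu n)), ψ x • (0 : L2 G) x = 0 := by
  simpa using integral_smul_smul (0 : ℂ) (0 : L2 G) ψ

/-- A test function supported on one side, extended by zero, has no layers; it therefore lies in
`X(Ω)` and is admissible in the variational problem. -/
lemma IsTest.isGluedLaplacian_outer {Ω Ω₂ : Opens (Eu n)} {φ : Eu n → ℝ}
    (hφ : IsTest (outerPart Ω Ω₂ : Set (Eu n)) φ) :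
    IsGluedLaplacian Ω Ω₂ (hφ.isSmoothCompact.toL2 _) 0 (hφ.isSmoothCompact.lapl.toL2 _) 0 :=
  fun ψ hψ => by rw [hφ.setIntegral_lapl_smul hψ, integral_smul_zero, integral_smul_zero]

lemma IsTest.isGluedLaplacian_inner {Ω Ω₂ : Opens (Eu n)} {φ : Eu n → ℝ}
    (hφ : IsTest (Ω₂ : Set (Eu n)) φ) :
    IsGluedLaplacian Ω Ω₂ 0 (hφ.isSmoothCompact.toL2 _) 0 (hφ.isSmoothCompact.lapl.toL2 _) :=
  fun ψ hψ => by rw [hφ.setIntegral_lapl_smul hψ, integral_smul_zero, integral_smul_zero]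

end test

/-! ### The state space is a Hilbert space -/

/-- The geometric assumptions: `Ω` is bounded, `closure Ω₂ ⊆ Ω`, and both have `C⁴` boundary. -/
structure IsPlateGeometry {m : ℕ} (Ω Ω₂ : Opens (Eu (m + 1))) : Prop where
  bounded : Bornology.IsBounded (Ω : Set (Eu (m + 1)))
  closure_subset : closure (Ω₂ : Set (Eu (m + 1))) ⊆ Ω
  boundary_outer : HasCkBoundary 4 (Ω : Set (Eu (m + 1)))
  boundary_inner : HasCkBoundary 4 (Ω₂ : Set (Eu (m + 1)))

section hilbert

variable {m : ℕ} {Ω Ω₂ : Opens (Eu (m + 1))}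

lemma IsPlateGeometry.memX (hG : IsPlateGeometry Ω Ω₂) {u₁ f₁ : L2 (outerPart Ω Ω₂)}
    {u₂ f₂ : L2 Ω₂} (h : IsGluedLaplacian Ω Ω₂ u₁ u₂ f₁ f₂) :
    MemX Ω Ω₂ u₁ u₂ ∧ lap _ u₁ = f₁ ∧ lap _ u₂ = f₂ :=
  h.memX hG.closure_subset hG.bounded hG.boundary_outer hG.boundary_inner

lemma IsPlateGeometry.isGluedLaplacian (hG : IsPlateGeometry Ω Ω₂) {u₁ : L2 (outerPart Ω Ω₂)}
    {u₂ : L2 Ω₂} (h : MemX Ω Ω₂ u₁ u₂) : IsGluedLaplacian Ω Ω₂ u₁ u₂ (lap _ u₁) (lap _ u₂) :=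
  h.isGluedLaplacian hG.closure_subset hG.boundary_outer hG.boundary_inner

/-- This Poincaré inequality on `X(Ω)` makes the seminorm of `ℋ` definite and yields `L²` limits of
`u₁` and `u₂`. -/
lemma IsPlateGeometry.exists_norm_le (hG : IsPlateGeometry Ω Ω₂) : ∃ C : ℝ,
    ∀ (u₁ : L2 (outerPart Ω Ω₂)) (u₂ : L2 Ω₂), MemX Ω Ω₂ u₁ u₂ →
      ‖u₁‖ ≤ C * (‖lap _ u₁‖ + ‖lap _ u₂‖) ∧ ‖u₂‖ ≤ C * (‖lap _ u₁‖ + ‖lap _ u₂‖) := by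
  obtain ⟨R₀, hR₀⟩ := hG.bounded.subset_closedBall 0
  refine ⟨(2 * (max R₀ 0 + 1)) ^ 2, fun u₁ u₂ hu => ?_⟩
  have h := (hG.isGluedLaplacian hu).eLpNorm_le hG.closure_subset (le_max_right R₀ 0)
    (hR₀.trans (Metric.closedBall_subset_closedBall (le_max_left _ _))) 0
  exact ⟨(norm_le_eLpNorm_glue_outer u₁ u₂).trans h, (norm_le_eLpNorm_glue_inner u₁ u₂).trans h⟩

namespace HSpace

lemma norm_lap_u₁_le (U : HSpace Ω Ω₂) : ‖lap _ U.u₁‖ ≤ ‖U‖ := by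
  rw [← pow_le_pow_iff_left₀ (norm_nonneg _) (norm_nonneg _) two_ne_zero, norm_sq]
  nlinarith [sq_nonneg ‖lap _ U.u₂‖, sq_nonneg ‖U.v₁‖, sq_nonneg ‖U.v₂‖]

lemma norm_lap_u₂_le (U : HSpace Ω Ω₂) : ‖lap _ U.u₂‖ ≤ ‖U‖ := by
  rw [← pow_le_pow_iff_left₀ (norm_nonneg _) (norm_nonneg _) two_ne_zero, norm_sq]
  nlinarith [sq_nonneg ‖lap _ U.u₁‖, sq_nonneg ‖U.v₁‖, sq_nonneg ‖U.v₂‖]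

lemma norm_v₁_le (U : HSpace Ω Ω₂) : ‖U.v₁‖ ≤ ‖U‖ := by
  rw [← pow_le_pow_iff_left₀ (norm_nonneg _) (norm_nonneg _) two_ne_zero, norm_sq]
  nlinarith [sq_nonneg ‖lap _ U.u₁‖, sq_nonneg ‖lap _ U.u₂‖, sq_nonneg ‖U.v₂‖]

lemma norm_v₂_le (U : HSpace Ω Ω₂) : ‖U.v₂‖ ≤ ‖U‖ := by
  rw [← pow_le_pow_iff_left₀ (norm_nonneg _) (norm_nonneg _) two_ne_zero, norm_sq]
  nlinarith [sq_nonneg ‖lap _ U.u₁‖, sq_nonneg ‖lap _ U.u₂‖, sq_nonneg ‖U.v₁‖]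

lemma ext {U V : HSpace Ω Ω₂} (h₁ : U.u₁ = V.u₁) (h₂ : U.u₂ = V.u₂) (h₃ : U.v₁ = V.v₁)
    (h₄ : U.v₂ = V.v₂) : U = V :=
  Prod.ext (Subtype.ext (Prod.ext h₁ h₂)) (Prod.ext h₃ h₄)

lemma eq_zero_of_norm_eq_zero (hG : IsPlateGeometry Ω Ω₂) (U : HSpace Ω Ω₂) (h : ‖U‖ = 0) :
    U = 0 := by
  obtain ⟨C, hC⟩ := hG.exists_norm_le
  have h1 := norm_eq_zero.1 (le_antisymm (h ▸ U.norm_lap_u₁_le) (norm_nonneg _))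
  have h2 := norm_eq_zero.1 (le_antisymm (h ▸ U.norm_lap_u₂_le) (norm_nonneg _))
  have h3 := norm_eq_zero.1 (le_antisymm (h ▸ U.norm_v₁_le) (norm_nonneg _))
  have h4 := norm_eq_zero.1 (le_antisymm (h ▸ U.norm_v₂_le) (norm_nonneg _))
  have h5 := hC _ _ U.memX
  rw [h1, h2, norm_zero, norm_zero, add_zero, mul_zero] at h5
  exact ext (norm_le_zero_iff.1 h5.1) (norm_le_zero_iff.1 h5.2) h3 h4

/-- A bounded linear map from `ℋ` maps Cauchy sequences to convergent ones. -/
lemma exists_tendsto_of_cauchySeq {E : Type*} [NormedAddCommGroup E] [NormedSpace ℂ E]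
    [CompleteSpace E] {f : HSpace Ω Ω₂ →ₗ[ℂ] E} {C : ℝ} (hf : ∀ U, ‖f U‖ ≤ C * ‖U‖)
    {U : ℕ → HSpace Ω Ω₂} (hU : CauchySeq U) : ∃ y, Tendsto (fun k => f (U k)) atTop (𝓝 y) :=
  cauchySeq_tendsto_of_complete
    ((f.mkContinuous C hf).uniformContinuous.comp_cauchySeq hU)

/-- Along a Cauchy sequence the six functions `u₁`, `u₂`, `Δu₁`, `Δu₂`, `v₁`, `v₂` converge in `L²`.
It remains to see that the limits of the Laplacians are the Laplacians of the limits. -/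
theorem completeSpace (hG : IsPlateGeometry Ω Ω₂) : CompleteSpace (HSpace Ω Ω₂) := by
  obtain ⟨C, hC⟩ := hG.exists_norm_le
  have hC' : ∀ U : HSpace Ω Ω₂, C * (‖lap _ U.u₁‖ + ‖lap _ U.u₂‖) ≤ |C| * 2 * ‖U‖ := fun U => by
    have h1 := U.norm_lap_u₁_le
    have h2 := U.norm_lap_u₂_le
    calc C * (‖lap _ U.u₁‖ + ‖lap _ U.u₂‖) ≤ |C| * (‖U‖ + ‖U‖) := by
          gcongr
          exact le_abs_self C
      _ = _ := by ring
  refine Metric.complete_of_cauchySeq_tendsto fun U hU => ?_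
  let Lu₁ : HSpace Ω Ω₂ →ₗ[ℂ] L2 (outerPart Ω Ω₂) := ⟨⟨u₁, u₁_add⟩, u₁_smul⟩
  let Lu₂ : HSpace Ω Ω₂ →ₗ[ℂ] L2 Ω₂ := ⟨⟨u₂, u₂_add⟩, u₂_smul⟩
  let Lv₁ : HSpace Ω Ω₂ →ₗ[ℂ] L2 (outerPart Ω Ω₂) := ⟨⟨v₁, v₁_add⟩, v₁_smul⟩
  let Lv₂ : HSpace Ω Ω₂ →ₗ[ℂ] L2 Ω₂ := ⟨⟨v₂, v₂_add⟩, v₂_smul⟩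
  let LΔ₁ : HSpace Ω Ω₂ →ₗ[ℂ] L2 (outerPart Ω Ω₂) := ⟨⟨fun U => lap _ U.u₁, fun U V =>
    U.memX.1.lap_add V.memX.1⟩, fun c U => U.memX.1.lap_smul c⟩
  let LΔ₂ : HSpace Ω Ω₂ →ₗ[ℂ] L2 Ω₂ := ⟨⟨fun U => lap _ U.u₂, fun U V =>
    U.memX.2.1.lap_add V.memX.2.1⟩, fun c U => U.memX.2.1.lap_smul c⟩
  obtain ⟨a₁, ha₁⟩ := exists_tendsto_of_cauchySeq (f := Lu₁)
    (fun U => (hC _ _ U.memX).1.trans (hC' U)) hU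
  obtain ⟨a₂, ha₂⟩ := exists_tendsto_of_cauchySeq (f := Lu₂)
    (fun U => (hC _ _ U.memX).2.trans (hC' U)) hU
  obtain ⟨b₁, hb₁⟩ := exists_tendsto_of_cauchySeq (f := LΔ₁) (C := 1)
    (fun U => by rw [one_mul]; exact U.norm_lap_u₁_le) hU
  obtain ⟨b₂, hb₂⟩ := exists_tendsto_of_cauchySeq (f := LΔ₂) (C := 1)
    (fun U => by rw [one_mul]; exact U.norm_lap_u₂_le) hU
  obtain ⟨c₁, hc₁⟩ := exists_tendsto_of_cauchySeq (f := Lv₁) (C := 1)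
    (fun U => by rw [one_mul]; exact U.norm_v₁_le) hU
  obtain ⟨c₂, hc₂⟩ := exists_tendsto_of_cauchySeq (f := Lv₂) (C := 1)
    (fun U => by rw [one_mul]; exact U.norm_v₂_le) hU
  -- The glued relation is closed, and it returns both membership in `X(Ω)` and the values of the
  -- Laplacians.
  have hlim : IsGluedLaplacian Ω Ω₂ a₁ a₂ b₁ b₂ :=
    (isClosed_isGluedLaplacian Ω Ω₂).mem_of_tendsto
      ((ha₁.prodMk_nhds ha₂).prodMk_nhds (hb₁.prodMk_nhds hb₂))
      (Eventually.of_forall fun k => hG.isGluedLaplacian (U k).memX)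
  obtain ⟨hX, e₁, e₂⟩ := hG.memX hlim
  let W : HSpace Ω Ω₂ := (⟨(a₁, a₂), hX⟩, c₁, c₂)
  refine ⟨W, tendsto_iff_norm_sub_tendsto_zero.2 ?_⟩
  have h2 : Tendsto (fun k => ‖U k - W‖ ^ 2) atTop (𝓝 0) := by
    have z : ∀ {E : Type _} [NormedAddCommGroup E] {x : ℕ → E} {y : E}, Tendsto x atTop (𝓝 y) →
        Tendsto (fun k => ‖x k - y‖ ^ 2) atTop (𝓝 0) := fun h => by
      simpa using (tendsto_iff_norm_sub_tendsto_zero.1 h).pow 2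
    have hs := (((z hb₁).add (z hb₂)).add (z hc₁)).add (z hc₂)
    simp only [add_zero] at hs
    refine hs.congr fun k => ?_
    rw [norm_sq]
    have d₁ : lap _ (U k - W).u₁ = LΔ₁ (U k) - b₁ := (map_sub LΔ₁ (U k) W).trans (by rw [← e₁]; rfl)
    have d₂ : lap _ (U k - W).u₂ = LΔ₂ (U k) - b₂ := (map_sub LΔ₂ (U k) W).trans (by rw [← e₂]; rfl)
    rw [d₁, d₂]
    rfl
  have h3 := h2.sqrt
  simpa using h3

end HSpace

end hilbert

/-! ### The resolvent equation -/

/-- The normal equation for a linear map with closed range. -/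
lemma exists_inner_map_eq {E K : Type*} [AddCommGroup E] [Module ℂ E] [NormedAddCommGroup K]
    [InnerProductSpace ℂ K] [CompleteSpace K] (J : E →ₗ[ℂ] K) (hJ : IsClosed (range J)) (h : K) :
    ∃ e, ∀ φ, inner ℂ (J φ) (J e) = inner ℂ (J φ) h := by
  have hc : CompleteSpace (LinearMap.range J) :=
    (show IsClosed (LinearMap.range J : Set K) by rwa [LinearMap.coe_range]).completeSpace_coe
  -- The solution is a preimage of the orthogonal projection of `h` onto the range.
  obtain ⟨e, he⟩ := ((LinearMap.range J).starProjection_apply_mem h : _)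
  refine ⟨e, fun φ => ?_⟩
  have h1 := (LinearMap.range J).starProjection_inner_eq_zero h (J φ) (LinearMap.mem_range_self J φ)
  rw [inner_sub_left, sub_eq_zero] at h1
  rw [he, ← inner_conj_symm, ← h1, inner_conj_symm]

section resolvent

variable {m : ℕ} {Ω Ω₂ : Opens (Eu (m + 1))}

/-- The target space of `energyMap`. -/
abbrev EnergySpace (Ω Ω₂ : Opens (Eu (m + 1))) : Type :=
  WithLp 2 (WithLp 2 (WithLp 2 (L2 (outerPart Ω Ω₂) × L2 Ω₂) ×
    WithLp 2 (L2 (outerPart Ω Ω₂) × L2 Ω₂)) × PiLp 2 fun _ : Fin (m + 1) => L2 (outerPart Ω Ω₂))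

/-- The map `v ↦ (Δv, a v, b ∇v₁)`. -/
def energyMap (Ω Ω₂ : Opens (Eu (m + 1))) (a b : ℂ) : XSpace Ω Ω₂ →ₗ[ℂ] EnergySpace Ω Ω₂ where
  toFun v := WithLp.toLp 2 (WithLp.toLp 2 (WithLp.toLp 2 (lap _ v.1.1, lap _ v.1.2),
    WithLp.toLp 2 (a • v.1.1, a • v.1.2)), WithLp.toLp 2 fun i => b • wPartial _ i v.1.1)
  map_add' v w := by
    have h1 := v.2.1.lap_add w.2.1
    have h2 := v.2.2.1.lap_add w.2.2.1
    have h3 := fun i => v.2.1.1.wPartial_add w.2.1.1 i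
    simp only [Submodule.coe_add, Prod.fst_add, Prod.snd_add, h1, h2, h3, smul_add]
    rfl
  map_smul' c v := by
    have h1 := v.2.1.lap_smul c
    have h2 := v.2.2.1.lap_smul c
    have h3 := fun i => v.2.1.1.wPartial_smul c i
    simp only [Submodule.coe_smul, Prod.smul_fst, Prod.smul_snd, h1, h2, h3, smul_comm _ c]
    rfl

/-- The components determine `v` after division by `a`. Lying in the range then means that the other
components are the glued Laplacian and the weak gradient of that `v`, which are closed conditions.
-/
lemma isClosed_range_energyMap (hG : IsPlateGeometry Ω Ω₂) {a b : ℂ} (ha : a ≠ 0) (hb : b ≠ 0) :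
    IsClosed (range (energyMap Ω Ω₂ a b)) := by
  have he : range (energyMap Ω Ω₂ a b) = {z | IsGluedLaplacian Ω Ω₂ (a⁻¹ • z.fst.snd.fst)
      (a⁻¹ • z.fst.snd.snd) z.fst.fst.fst z.fst.fst.snd} ∩
      ⋂ i, {z | IsWeakPartial _ i (a⁻¹ • z.fst.snd.fst) (b⁻¹ • z.snd i)} := by
    ext z
    simp only [mem_inter_iff, mem_iInter, mem_ofPred_eq]
    constructor
    · rintro ⟨v, rfl⟩
      change IsGluedLaplacian Ω Ω₂ (a⁻¹ • a • v.1.1) (a⁻¹ • a • v.1.2) (lap _ v.1.1) (lap _ v.1.2) ∧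
        ∀ i, IsWeakPartial _ i (a⁻¹ • a • v.1.1) (b⁻¹ • b • wPartial _ i v.1.1)
      simp only [inv_smul_smul₀ ha, inv_smul_smul₀ hb]
      exact ⟨hG.isGluedLaplacian v.2, fun i => v.2.1.1.spec i⟩
    · rintro ⟨h1, h2⟩
      obtain ⟨hX, e1, e2⟩ := hG.memX h1
      refine ⟨⟨(a⁻¹ • z.fst.snd.fst, a⁻¹ • z.fst.snd.snd), hX⟩, ?_⟩
      simp only [energyMap, LinearMap.coe_mk, AddHom.coe_mk, e1, e2, (h2 _).wPartial_eq,
        smul_inv_smul₀ ha, smul_inv_smul₀ hb]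
      rfl
  rw [he]
  refine IsClosed.inter ?_ (isClosed_iInter fun i => ?_)
  · exact (isClosed_isGluedLaplacian Ω Ω₂).preimage
      (f := fun z : EnergySpace Ω Ω₂ => ((a⁻¹ • z.fst.snd.fst, a⁻¹ • z.fst.snd.snd),
        (z.fst.fst.fst, z.fst.fst.snd))) (by fun_prop)
  · exact (isClosed_isWeakPartial i).preimage
      (f := fun z : EnergySpace Ω Ω₂ => (a⁻¹ • z.fst.snd.fst, b⁻¹ • z.snd i)) (by fun_prop)

/-- The variational form of the resolvent equation. -/
lemma exists_variational_solution (hG : IsPlateGeometry Ω Ω₂) {ρ l : ℝ} (hρ : 0 < ρ) (hl : 0 < l)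
    (f₁ g₁ : L2 (outerPart Ω Ω₂)) (f₂ g₂ : L2 Ω₂) :
    ∃ v₁ v₂, MemX Ω Ω₂ v₁ v₂ ∧ ∀ φ₁ φ₂, MemX Ω Ω₂ φ₁ φ₂ →
      inner ℂ (lap _ φ₁) (lap _ v₁) + inner ℂ (lap _ φ₂) (lap _ v₂)
          + (l : ℂ) ^ 2 * (inner ℂ φ₁ v₁ + inner ℂ φ₂ v₂)
          + (l * ρ : ℂ) * gradInner _ v₁ φ₁
        = -(inner ℂ (lap _ φ₁) f₁ + inner ℂ (lap _ φ₂) f₂)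
          + (l : ℂ) * (inner ℂ φ₁ g₁ + inner ℂ φ₂ g₂) := by
  -- With `a = l` and `b = √(l ρ)` the inner product pulled back by `energyMap` is the form on the
  -- left-hand side. The target `((-f, g), 0)` gives the right-hand side; pairing with `a φ`
  -- produces the factor `l` before `g`.
  have hs : 0 < √(l * ρ) := Real.sqrt_pos.2 (by positivity)
  obtain ⟨v, hv⟩ := exists_inner_map_eq (energyMap Ω Ω₂ (l : ℂ) (√(l * ρ) : ℂ))
    (isClosed_range_energyMap hG (by exact_mod_cast hl.ne') (by exact_mod_cast hs.ne'))
    (WithLp.toLp 2 (WithLp.toLp 2 (WithLp.toLp 2 (-f₁, -f₂), WithLp.toLp 2 (g₁, g₂)), 0))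
  refine ⟨v.1.1, v.1.2, v.2, fun φ₁ φ₂ hφ => ?_⟩
  have h := hv ⟨(φ₁, φ₂), hφ⟩
  simp only [energyMap, LinearMap.coe_mk, AddHom.coe_mk, WithLp.prod_inner_apply,
    PiLp.inner_apply, inner_smul_left, inner_smul_right, inner_neg_right, Complex.conj_ofReal,
    inner_zero_right, ← Finset.mul_sum, add_zero] at h
  have hsq : (√(l * ρ) : ℂ) * (√(l * ρ) : ℂ) = l * ρ := by
    rw [← Complex.ofReal_mul, Real.mul_self_sqrt (by positivity), Complex.ofReal_mul]
  rw [gradInner]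
  rw [← mul_assoc (√(l * ρ) : ℂ), hsq] at h
  linear_combination h

variable {ρ : ℝ}

lemma IsTest.laplacian_eq_lapl {n : ℕ} {G : Opens (Eu n)} {φ : Eu n → ℝ}
    (hφ : IsTest (G : Set (Eu n)) φ) : Δ φ = lapl φ := by
  rw [hφ.laplacian_eq]
  funext x
  simp only [lapl, Finset.sum_apply]
  rfl

lemma gradInner_toL2 {n : ℕ} {G : Opens (Eu n)} {v : L2 G} (hv : MemH2 G v) {φ : Eu n → ℝ}
    (hφ : IsTest (G : Set (Eu n)) φ) :
    gradInner G v (hφ.isSmoothCompact.toL2 G)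
      = -inner ℂ (hφ.isSmoothCompact.toL2 G) (lap G v) := by
  rw [gradInner, lap, inner_sum, ← Finset.sum_neg_distrib]
  refine Finset.sum_congr rfl fun i _ => ?_
  rw [(hφ.isSmoothCompact.isWeakPartial_toL2 i).wPartial_eq, IsSmoothCompact.inner_toL2,
    IsSmoothCompact.inner_toL2]
  exact (hv.2 i).spec i φ hφ

/-- The first two equations force `u = (v + y_u) / l`, where `y_u` is the `X(Ω)` component of `y`.
Inserting this in the weak form of the other two and multiplying by `l` gives the variational
problem for `v`, which is used here in reverse. -/
lemma IsPlateGeometry.surj (hG : IsPlateGeometry Ω Ω₂) (hρ : 0 < ρ) {l : ℝ} (hl : 0 < l)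
    (y : HSpace Ω Ω₂) :
    ∃ x : (opA Ω Ω₂ ρ).domain, (l : ℂ) • (x : HSpace Ω Ω₂) - opA Ω Ω₂ ρ x = y := by
  have hl' : (l : ℂ) ≠ 0 := by exact_mod_cast hl.ne'
  obtain ⟨v₁, v₂, hv, h⟩ := exists_variational_solution hG hρ hl (lap _ y.u₁) y.v₁ (lap _ y.u₂) y.v₂
  have hw : MemX Ω Ω₂ ((l : ℂ)⁻¹ • (v₁ + y.u₁)) ((l : ℂ)⁻¹ • (v₂ + y.u₂)) :=
    (XSpace Ω Ω₂).smul_mem (l : ℂ)⁻¹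
      ((XSpace Ω Ω₂).add_mem (x := (v₁, v₂)) (y := (y.u₁, y.u₂)) hv y.memX)
  set w₁ := (l : ℂ)⁻¹ • (v₁ + y.u₁) with hw₁
  set w₂ := (l : ℂ)⁻¹ • (v₂ + y.u₂) with hw₂
  have e₁ : lap _ w₁ = (l : ℂ)⁻¹ • (lap _ v₁ + lap _ y.u₁) := by
    rw [hw₁, (hv.1.add y.memX.1).lap_smul, hv.1.lap_add y.memX.1]
  have e₂ : lap _ w₂ = (l : ℂ)⁻¹ • (lap _ v₂ + lap _ y.u₂) := by
    rw [hw₂, (hv.2.1.add y.memX.2.1).lap_smul, hv.2.1.lap_add y.memX.2.1]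
  -- The variational identity divided by `l`, rewritten in terms of `w = (v + y_u) / l`. Its
  -- restrictions to test functions on either side yield `Δ²w₁` and `Δ²w₂`; with these, it is the
  -- weak transmission identity.
  have key : ∀ φ₁ φ₂, MemX Ω Ω₂ φ₁ φ₂ →
      inner ℂ (lap _ φ₁) (lap _ w₁) + inner ℂ (lap _ φ₂) (lap _ w₂) + (ρ : ℂ) * gradInner _ v₁ φ₁
        = inner ℂ φ₁ (y.v₁ - (l : ℂ) • v₁) + inner ℂ φ₂ (y.v₂ - (l : ℂ) • v₂) := by
    intro φ₁ φ₂ hφ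
    have h1 := h φ₁ φ₂ hφ
    rw [e₁, e₂]
    simp only [inner_smul_right, inner_add_right, inner_sub_right]
    field_simp
    linear_combination h1
  have b₁ : IsWeakLaplacian _ (lap _ w₁) (y.v₁ - (l : ℂ) • v₁ + (ρ : ℂ) • lap _ v₁) := by
    intro φ hφ
    obtain ⟨hX, h1, h2⟩ := hG.memX hφ.isGluedLaplacian_outer
    have h3 := key _ _ hX
    rw [h1, h2, gradInner_toL2 hv.1 hφ, inner_zero_left, inner_zero_left, add_zero, add_zero] at h3
    rw [hφ.laplacian_eq_lapl, ← hφ.isSmoothCompact.lapl.inner_toL2, ← hφ.isSmoothCompact.inner_toL2,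
      inner_add_right, inner_smul_right]
    linear_combination h3
  have b₂ : IsWeakLaplacian _ (lap _ w₂) (y.v₂ - (l : ℂ) • v₂) := by
    intro φ hφ
    obtain ⟨hX, h1, h2⟩ := hG.memX (hφ.isGluedLaplacian_inner (Ω := Ω))
    have h3 := key _ _ hX
    have h4 : gradInner _ v₁ (0 : L2 (outerPart Ω Ω₂)) = 0 := by
      simp only [gradInner, wPartial_zero, inner_zero_left, Finset.sum_const_zero]
    rw [h1, h2, h4, inner_zero_left, inner_zero_left, zero_add, mul_zero, add_zero, zero_add] at h3
    rw [hφ.laplacian_eq_lapl, ← hφ.isSmoothCompact.lapl.inner_toL2, ← hφ.isSmoothCompact.inner_toL2]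
    exact h3
  have c₁ : bilap _ w₁ = y.v₁ - (l : ℂ) • v₁ + (ρ : ℂ) • lap _ v₁ := b₁.wLaplacian_eq
  have c₂ : bilap _ w₂ = y.v₂ - (l : ℂ) • v₂ := b₂.wLaplacian_eq
  let U : HSpace Ω Ω₂ := (⟨(w₁, w₂), hw⟩, v₁, v₂)
  have hU : U ∈ (opA Ω Ω₂ ρ).domain := by
    refine ⟨hv, ⟨_, b₁⟩, ⟨_, b₂⟩, fun φ₁ φ₂ hφ => ?_⟩
    change inner ℂ φ₁ (bilap _ w₁ - (ρ : ℂ) • lap _ v₁) + inner ℂ φ₂ (bilap _ w₂)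
      = inner ℂ (lap _ φ₁) (lap _ w₁) + inner ℂ (lap _ φ₂) (lap _ w₂)
        + (ρ : ℂ) * gradInner _ v₁ φ₁
    rw [key φ₁ φ₂ hφ, c₁, c₂, add_sub_cancel_right]
  refine ⟨⟨U, hU⟩, HSpace.ext ?_ ?_ ?_ ?_⟩
  · change (l : ℂ) • w₁ - v₁ = y.u₁
    rw [hw₁, smul_inv_smul₀ hl', add_sub_cancel_left]
  · change (l : ℂ) • w₂ - v₂ = y.u₂
    rw [hw₂, smul_inv_smul₀ hl', add_sub_cancel_left]
  · change (l : ℂ) • v₁ - (-bilap _ w₁ + (ρ : ℂ) • lap _ v₁) = y.v₁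
    rw [c₁]
    abel
  · change (l : ℂ) • v₂ - -bilap _ w₂ = y.v₂
    rw [c₂]
    abel

/-- Choosing `φ = v` in the weak transmission identity replaces the terms with `Δ²u` and `ρ Δv₁`.
Differences of conjugate inner products drop out of the real part, leaving `-ρ ‖∇v₁‖²`. -/
lemma re_inner_opA_le (hρ : 0 < ρ) (x : (opA Ω Ω₂ ρ).domain) :
    (inner ℂ (x : HSpace Ω Ω₂) (opA Ω Ω₂ ρ x)).re ≤ 0 := by
  obtain ⟨U, hU⟩ := x
  have h := hU.2.2.2 U.v₁ U.v₂ hU.1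
  change (inner ℂ (lap _ U.u₁) (lap _ U.v₁) + inner ℂ (lap _ U.u₂) (lap _ U.v₂)
    + inner ℂ U.v₁ (-bilap _ U.u₁ + (ρ : ℂ) • lap _ U.v₁) + inner ℂ U.v₂ (-bilap _ U.u₂)).re ≤ 0
  have e : inner ℂ (lap _ U.u₁) (lap _ U.v₁) + inner ℂ (lap _ U.u₂) (lap _ U.v₂)
      + inner ℂ U.v₁ (-bilap _ U.u₁ + (ρ : ℂ) • lap _ U.v₁) + inner ℂ U.v₂ (-bilap _ U.u₂)
      = (inner ℂ (lap _ U.u₁) (lap _ U.v₁) - inner ℂ (lap _ U.v₁) (lap _ U.u₁))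
        + (inner ℂ (lap _ U.u₂) (lap _ U.v₂) - inner ℂ (lap _ U.v₂) (lap _ U.u₂))
        - (ρ : ℂ) * gradInner _ U.v₁ U.v₁ := by
    simp only [inner_add_right, inner_sub_right, inner_neg_right] at h ⊢
    linear_combination -h
  have s : ∀ {G : Opens (Eu (m + 1))} (x y : L2 G), (inner ℂ x y - inner ℂ y x : ℂ).re = 0 :=
    fun x y => by
      rw [Complex.sub_re, sub_eq_zero]
      exact inner_re_symm (𝕜 := ℂ) x y
  have hg : 0 ≤ (gradInner _ U.v₁ U.v₁).re := by
    rw [gradInner, Complex.re_sum]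
    exact Finset.sum_nonneg fun i _ => inner_self_nonneg (𝕜 := ℂ)
  rw [e, Complex.sub_re, Complex.add_re, s, s, Complex.re_ofReal_mul]
  nlinarith

end resolvent

end PlateTransmission

end

theorem mainTheorem5 (n : ℕ) (hn : 1 ≤ n) (hn4 : n ≤ 4)
    (Ω Ω₂ : TopologicalSpace.Opens (EuclideanSpace ℝ (Fin n)))
    (hΩ : IsConnected (Ω : Set (EuclideanSpace ℝ (Fin n))))
    (hΩb : Bornology.IsBounded (Ω : Set (EuclideanSpace ℝ (Fin n))))
    (hΩ₂ : IsConnected (Ω₂ : Set (EuclideanSpace ℝ (Fin n))))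
    (hsub : closure (Ω₂ : Set (EuclideanSpace ℝ (Fin n))) ⊆ Ω)
    (hΩC : PlateTransmission.HasCkBoundary 4 (Ω : Set (EuclideanSpace ℝ (Fin n))))
    (hΩ₂C : PlateTransmission.HasCkBoundary 4 (Ω₂ : Set (EuclideanSpace ℝ (Fin n))))
    (ρ : ℝ) (hρ : 0 < ρ) :
    -- `ℋ` is a Hilbert space
    (∀ U : PlateTransmission.HSpace Ω Ω₂, ‖U‖ = 0 → U = 0) ∧
    CompleteSpace (PlateTransmission.HSpace Ω Ω₂) ∧
    -- `𝒜` generates a `C₀`-semigroup of contractions on `ℋ`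
    (∃ T : ℝ≥0 → PlateTransmission.HSpace Ω Ω₂ →L[ℂ] PlateTransmission.HSpace Ω Ω₂,
      PlateTransmission.IsC0Semigroup T ∧ (∀ t, ‖T t‖ ≤ 1) ∧
      PlateTransmission.IsGenerator T (PlateTransmission.opA Ω Ω₂ ρ)) ∧
    -- unique classical solvability of the Cauchy problem
    ∀ U₀ ∈ (PlateTransmission.opA Ω Ω₂ ρ).domain,
      ∃ U : ℝ → PlateTransmission.HSpace Ω Ω₂,
        PlateTransmission.IsClassicalSolution (PlateTransmission.opA Ω Ω₂ ρ) U₀ U ∧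
        ∀ V : ℝ → PlateTransmission.HSpace Ω Ω₂,
          PlateTransmission.IsClassicalSolution (PlateTransmission.opA Ω Ω₂ ρ) U₀ V →
            ∀ t, 0 ≤ t → V t = U t := by
  -- Writing `n = m + 1` singles out one vertical axis and `m` remaining coordinates for the graph
  -- charts.
  obtain ⟨m, rfl⟩ := Nat.exists_eq_add_of_le' hn
  have hG : PlateTransmission.IsPlateGeometry Ω Ω₂ := ⟨hΩb, hsub, hΩC, hΩ₂C⟩
  have hsep := PlateTransmission.HSpace.eq_zero_of_norm_eq_zero hG
  have hcomp := PlateTransmission.HSpace.completeSpace hG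
  -- Definiteness upgrades the existing seminorm to a norm without changing it, so the Hilbert space
  -- results apply to `ℋ` with its given inner product.
  let inst : NormedAddCommGroup (PlateTransmission.HSpace Ω Ω₂) :=
    NormedAddCommGroup.ofSeparation hsep
  have hA : PlateTransmission.IsMaxDissipative (PlateTransmission.opA Ω Ω₂ ρ) :=
    ⟨PlateTransmission.re_inner_opA_le hρ, fun _ hl y => hG.surj hρ hl y⟩
  obtain ⟨T, h0, h1, h2, h3⟩ := hA.exists_semigroup
  exact ⟨hsep, hcomp, ⟨T, h0, h1, h2⟩, fun U₀ hU₀ => ⟨_, h3 U₀ hU₀, fun V hV t ht =>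
    hA.classicalSolution_unique (h3 U₀ hU₀) hV t ht⟩⟩
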